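/- Let $(W,H,\mu)$ be an abstract Wiener space, $H\hookrightarrow W$, with $W$ a separable Banach space and $H$ an infinite-dimensional separable Hilbert space. Let $(e_i)_{i\ge 1}$ be a complete orthonormal basis of $H$ induced by elements of $W^*$, and put $\delta e_i(w)={}_{W^*}\langle e_i,w\rangle_W$. Fix $T>0$, and let $Q^a=(Q^a_r)_{r\in[0,T]}$ and $Q^b=(Q^b_r)_{r\in[0,T]}$ be families of maps from $W$ to the bounded operators on $H$, such that each $Q\in\{Q^a,Q^b\}$ belongs to the following class $M$: for some $m$ (not depending on $r$), the functions $q_{ij}=(e_j,Q_re_i)_H$ satisfy (a) $q_{ij}=0$ if $i>m$ or $j>m$; (b) $q_{ij}=-q_{ji}$; (c) $q_{ij}=f^r_{ij}(\delta e_1,\dots,\delta e_m)$ for $i,j\le m$, where $f^r_{ij}\in C^2(\mathbb R^m)$ has bounded first derivatives and $r\mapsto f^r_{ij}(x)$ is measurable for each $x$; moreover $\sup_x|\nabla f^r_{ij}(x)|\le K(r)$ with $K\in L^1([0,T])$, and for every $R>0$ the functions $|f^r_{ij}|$ and $|\nabla^2f^r_{ij}|$ are bounded on $\{|x|\le R\}$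 by $g_R(r)$ with $g_R\in L^1([0,T])$. Set $B_r=\sum_{i=1}^m\delta(Q_re_i)\,e_i$, where $\delta\big(\sum_{j\le m}u_je_j\big)=\sum_{j\le m}(u_j\,\delta e_j-\nabla_{e_j}u_j)$ is the divergence, and $$|||\nabla B_r|||(w)=\sup\{|\nabla_h({}_W\langle B_r,\alpha\rangle_{W^*})(w)|:\ h\in H,\ |h|_W=1,\ \alpha\in W^*,\ |\alpha|_{W^*}\le 1\}.$$ Write $B^a,B^b$ for the fields obtained from $Q^a,Q^b$. Let $\varepsilon>0$, put $$\Gamma_{s,t}=E\int_s^t\big(\exp(\varepsilon|||\nabla B^a_r|||)+\exp(\varepsilon|||\nabla B^b_r|||)\big)\,dr ,$$ and assume $\Gamma_{0,T}<\infty$. Let $\varphi^a,\varphi^b$ be the flows induced by $Q^a,Q^b$: for every $s\in[0,T]$ and $\mu$-almost every $w$, $$\varphi_{s,t}(w)=w+\int_s^tB_r(\varphi_{s,r}(w))\,dr\qquad(s\le t\le T),$$ the integrand being integrable on $[s,T]$, with $B=B^a$ for $\varphi^a$ and $B=B^b$ for $\varphi^b$. Let $1<p,q<\infty$ with $\frac1p+\frac1q=1$.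 Then for all $0\le s<t\le T$ with $t-s\le 1$ and $(t-s)q\le\varepsilon$, $$E\sup_{u\in[s,t]}\big|\varphi^a_{s,u}-\varphi^b_{s,u}\big|_W\ \le\ \Big(E\int_s^t|B^a_r-B^b_r|_W^p\,dr\Big)^{1/p}\,\Gamma_{s,t}^{1/q}\,\Big(\frac1{t-s}\Big)^{1/q}.$$ -/

import Mathlib

open MeasureTheory ProbabilityTheory Set
open scoped ENNReal NNReal

/-- `(W, H, μ)` is an abstract Wiener space: the Hilbert space `H` is continuously and densely
embedded in the Banach space `W` by `ι`, and every `α ∈ W*` is, under `μ`, a centred Gaussian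
variable with variance `|α|_H ^ 2`; here `α.comp ι ∈ H* = H` is the image of `α` in `H`. -/
structure IsAbstractWienerSpace {W H : Type*} [NormedAddCommGroup W] [NormedSpace ℝ W]
    [MeasurableSpace W] [NormedAddCommGroup H] [InnerProductSpace ℝ H]
    (ι : H →L[ℝ] W) (μ : Measure W) : Prop where
  injective : Function.Injective ι
  denseRange : DenseRange ι
  gaussian : ∀ α : StrongDual ℝ W, μ.map α = gaussianReal 0 (‖α.comp ι‖₊ ^ 2)

/-- The elements `e' n` of `W*` induce the orthonormal basis `e n` of `H`.  For such a basis
`δ (e n)` is the random variable `w ↦ e' n w`. -/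
def InducedBy {W H : Type*} [NormedAddCommGroup W] [NormedSpace ℝ W]
    [NormedAddCommGroup H] [InnerProductSpace ℝ H]
    (ι : H →L[ℝ] W) (e : HilbertBasis ℕ ℝ H) (e' : ℕ → StrongDual ℝ W) : Prop :=
  ∀ (n : ℕ) (h : H), e' n (ι h) = inner ℝ (e n) h

/-- `Q r`, `0 ≤ r ≤ T`, is a (Carathéodory) family in the class of cylindrical skew-symmetric
operators.  With `q_ij = (e_j, Q e_i)`:
* `q_ij = 0` if `i` or `j` is not among the first `m` indices;
* `q_ij = - q_ji`;
* `q_ij = f_ij (δ e_0, …, δ e_{m-1})` where `f_ij` is `C²` with bounded first derivatives.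
The functions `f_ij` depend measurably on `r`; the bound on the first derivatives, and bounds
for `f_ij` and its second derivatives on bounded sets, are integrable in `r`. -/
structure IsCylindricalSkewFamily {W H : Type*} [NormedAddCommGroup W] [NormedSpace ℝ W]
    [NormedAddCommGroup H] [InnerProductSpace ℝ H]
    (e : HilbertBasis ℕ ℝ H) (e' : ℕ → StrongDual ℝ W) (T : ℝ) (m : ℕ)
    (Q : ℝ → W → H →L[ℝ] H) : Prop where
  zero : ∀ r ∈ Icc 0 T, ∀ (w : W) (i j : ℕ), m ≤ i ∨ m ≤ j →
    inner ℝ (e j) (Q r w (e i)) = 0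
  skew : ∀ r ∈ Icc 0 T, ∀ (w : W) (i j : ℕ),
    inner ℝ (e j) (Q r w (e i)) = - inner ℝ (e i) (Q r w (e j))
  cylindrical : ∀ i < m, ∀ j < m, ∃ f : ℝ → (Fin m → ℝ) → ℝ,
    (∀ r ∈ Icc 0 T, ∀ w : W,
      inner ℝ (e j) (Q r w (e i)) = f r (fun k => e' k w)) ∧
    (∀ r ∈ Icc 0 T, ContDiff ℝ 2 (f r)) ∧
    (∀ x, AEMeasurable (fun r => f r x) (volume.restrict (Icc 0 T))) ∧
    (∃ K : ℝ → ℝ, IntegrableOn K (Icc 0 T) ∧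
      ∀ r ∈ Icc 0 T, ∀ x, ‖fderiv ℝ (f r) x‖ ≤ K r) ∧
    (∀ R : ℝ, ∃ g : ℝ → ℝ, IntegrableOn g (Icc 0 T) ∧
      ∀ r ∈ Icc 0 T, ∀ x, ‖x‖ ≤ R →
        |f r x| ≤ g r ∧ ‖iteratedFDeriv ℝ 2 (f r) x‖ ≤ g r)

/-- The divergence (Skorokhod integral) of a cylindrical field `u = ∑_{j < m} u_j e_j`, that is
`δ u = ∑_{j < m} (u_j δ e_j - ∇_{e_j} u_j)`. -/
noncomputable def cylDivergence {W H : Type*} [NormedAddCommGroup W] [NormedSpace ℝ W]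
    [NormedAddCommGroup H] [InnerProductSpace ℝ H]
    (ι : H →L[ℝ] W) (e : HilbertBasis ℕ ℝ H) (e' : ℕ → StrongDual ℝ W) (m : ℕ)
    (u : W → H) (w : W) : ℝ :=
  ∑ j ∈ Finset.range m,
    (inner ℝ (e j) (u w) * e' j w
      - lineDeriv ℝ (fun v => inner ℝ (e j) (u v)) w (ι (e j)))

/-- The vector field `B = ∑_{i < m} δ (Q e_i) e_i` on `W`. -/
noncomputable def tangentField {W H : Type*} [NormedAddCommGroup W] [NormedSpace ℝ W]
    [NormedAddCommGroup H] [InnerProductSpace ℝ H]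
    (ι : H →L[ℝ] W) (e : HilbertBasis ℕ ℝ H) (e' : ℕ → StrongDual ℝ W) (m : ℕ)
    (Q : W → H →L[ℝ] H) (w : W) : W :=
  ∑ i ∈ Finset.range m, cylDivergence ι e e' m (fun v => Q v (e i)) w • ι (e i)

/-- `|||∇B||| (w) = sup |∇_h ⟨B, α⟩ (w)|`, the supremum over `h ∈ H` with `|h|_W = 1` and `α` in
the unit ball of `W*`. -/
noncomputable def gradNorm {W H : Type*} [NormedAddCommGroup W] [NormedSpace ℝ W]
    [NormedAddCommGroup H] [InnerProductSpace ℝ H]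
    (ι : H →L[ℝ] W) (B : W → W) (w : W) : ℝ≥0∞ :=
  ⨆ (h : H) (_ : ‖ι h‖ = 1) (α : StrongDual ℝ W) (_ : ‖α‖ ≤ 1),
    ‖lineDeriv ℝ (fun v => α (B v)) w (ι h)‖ₑ

/-- `Γ_{s,t} = E ∫_s^t (exp (ε |||∇B^a_r|||) + exp (ε |||∇B^b_r|||)) dr`. -/
noncomputable def expGradMoment {W H : Type*} [NormedAddCommGroup W] [NormedSpace ℝ W]
    [MeasurableSpace W] [NormedAddCommGroup H] [InnerProductSpace ℝ H]
    (ι : H →L[ℝ] W) (μ : Measure W) (ε : ℝ) (Ba Bb : ℝ → W → W) (s t : ℝ) : ℝ≥0∞ :=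
  ∫⁻ w, ∫⁻ r in Icc s t,
    (EReal.exp ((ε : EReal) * (gradNorm ι (Ba r) w : EReal))
      + EReal.exp ((ε : EReal) * (gradNorm ι (Bb r) w : EReal))) ∂volume ∂μ

/-- `φ s t`, `0 ≤ s ≤ t ≤ T`, is the flow of the time-dependent field `B`: for each `s` and almost
every `w`, `φ s t w = w + ∫_s^t B r (φ s r w) dr` for all `t ∈ [s, T]`, with a Bochner integrable
integrand. -/
def IsFlowOf {W : Type*} [NormedAddCommGroup W] [NormedSpace ℝ W] [MeasurableSpace W]
    (μ : Measure W) (T : ℝ) (B : ℝ → W → W) (φ : ℝ → ℝ → W → W) : Prop :=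
  ∀ s ∈ Icc 0 T, ∀ᵐ w ∂μ,
    IntegrableOn (fun r => B r (φ s r w)) (Icc s T) ∧
    ∀ t ∈ Icc s T, φ s t w = w + ∫ r in s..t, B r (φ s r w)

set_option linter.unusedSectionVars false

/-! Both fields depend only on the first `n = max ma mb` coordinates of `w` and take values in the
span of the first `n` basis vectors. A trajectory is therefore `w` plus the image under `embedMap`
of a displacement in `ℝⁿ`, and the `W`-distance of the two flows is the distance of two flows on
`ℝⁿ`, measured in the norm transported by `L = embedEquiv he n`. The coordinates of `w` have the
standard Gaussian law (`map_coordMap_eq_smul`).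

On `ℝⁿ` the field `b r` is the Gaussian divergence of a skew-symmetric matrix. Skew-symmetry has two
consequences: the radial part of the field grows at most linearly at an integrable rate, so
trajectories cannot explode, and `trace (Db) = ⟨b, x⟩`, so the flow preserves the Gaussian measure
(`map_fieldFlow_gaussVolume`). Solutions from every point are obtained from the given flow on `W`:
it provides them for almost every, hence for a dense set of, starting coordinates, and local
Lipschitz bounds allow a passage to the limit (`exists_isSol_of_dense`).

The two flows are compared by interpolation (`norm_fieldFlow_sub_fieldFlow_le`): follow `b` from `s`
to `θ`, then `c` from `θ` to `u`. Moving `θ` from `s` to `u` leads from one flow to the other, at a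
speed bounded by `‖L (b - c)‖` along the `b`-trajectory times the exponential of the integrated
operator norm of `Dc` along the `c`-trajectory. Hölder's inequality separates the two factors.
Invariance under the flow of `b` turns the first into the `L^p` distance of the fields. For the
second, invariance under `b`, Jensen's inequality on `[s, t]` with `(t - s) q ≤ ε`, and invariance
under `c` give the exponential moment of the slope of `c` (`lintegral_fieldFlow_sub_fieldFlow_le`),
which `gradNorm` dominates (`ofReal_fieldSlope_le_gradNorm`). The factor `1 / (t - s)` from Jensen
cancels against the length of `[s, t]`; the one in the theorem is at least `1` because `t - s ≤ 1`.

The fields are merely integrable in time, so nothing is differentiated in time. Instead, a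
continuous function is shown to be constant or monotone by bounding its increments by the square of
those of a primitive `∫ g` of an integrable bound (`le_of_sub_le_sq`). -/

/-! ### Monotonicity from local increments, and Grönwall's inequality with an `L¹` rate -/

/-- A continuous function whose right increments are locally dominated by those of `Φ`, up to an
arbitrarily small multiple of the increments of `G`, grows at most as much as `Φ`. -/
theorem sub_le_sub_of_eventually_right {f Φ G : ℝ → ℝ} {a b : ℝ} (hab : a ≤ b)
    (hf : ContinuousOn f (Icc a b)) (hΦ : ContinuousOn Φ (Icc a b))
    (hG : ContinuousOn G (Icc a b))
    (H : ∀ ε > 0, ∀ x ∈ Ico a b, ∀ᶠ y in nhdsWithin x (Ioi x),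
      f y - f x ≤ Φ y - Φ x + ε * (G y - G x)) :
    f b - f a ≤ Φ b - Φ a := by
  have key : ∀ ε > 0, f b - f a ≤ Φ b - Φ a + ε * (G b - G a) := by
    intro ε hε
    set S : Set ℝ := {x | f x - f a ≤ Φ x - Φ a + ε * (G x - G a)} with hS
    have hcl : IsClosed (S ∩ Icc a b) := by
      have h1 : ContinuousOn (fun x => f x - f a - (Φ x - Φ a + ε * (G x - G a))) (Icc a b) := by
        fun_prop
      have := h1.preimage_isClosed_of_isClosed isClosed_Icc (isClosed_Iic (a := (0 : ℝ)))
      convert this using 1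
      ext x
      simp only [hS, mem_inter_iff, mem_ofPred_eq, mem_preimage, mem_Iic, sub_nonpos]
      tauto
    -- Continuous induction: `S` is closed in the interval, and the local bound extends it to the
    -- right of each of its points.
    have hsub : Icc a b ⊆ S := by
      refine hcl.Icc_subset_of_forall_exists_gt (by simp [hS]) ?_
      rintro x ⟨hxS, hx⟩ y hy
      have h2 := H ε hε x hx
      have h3 : ∀ᶠ z in nhdsWithin x (Ioi x), z ∈ Ioc x y :=
        Ioc_mem_nhdsGT hy
      obtain ⟨z, hz1, hz2⟩ := (h2.and h3).exists
      refine ⟨z, ?_, hz2⟩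
      simp only [hS, mem_ofPred_eq] at hxS ⊢
      linarith
    exact hsub (right_mem_Icc.2 hab)
  by_contra! hlt
  have h4 : 0 ≤ G b - G a := by
    have := key 1 one_pos
    linarith
  rcases h4.eq_or_lt with h5 | h5
  · have := key 1 one_pos
    rw [← h5] at this
    linarith
  -- With this `ε` the error term is half of the supposed excess.
  · have := key ((f b - f a - (Φ b - Φ a)) / (2 * (G b - G a))) (by
      apply div_pos <;> linarith)
    have h6 : (f b - f a - (Φ b - Φ a)) / (2 * (G b - G a)) * (G b - G a)
        = (f b - f a - (Φ b - Φ a)) / 2 := by field_simp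
    linarith

/-- A continuous function whose increments are at most quadratic in the increments of a continuous
monotone function does not increase. -/
theorem le_of_sub_le_sq {f G : ℝ → ℝ} {a b C δ : ℝ} (hab : a ≤ b) (hδ : 0 < δ)
    (hf : ContinuousOn f (Icc a b)) (hG : ContinuousOn G (Icc a b)) (hGm : MonotoneOn G (Icc a b))
    (H : ∀ x ∈ Icc a b, ∀ y ∈ Icc x b, G y - G x ≤ δ → f y - f x ≤ C * (G y - G x) ^ 2) :
    f b ≤ f a := by
  have := sub_le_sub_of_eventually_right (Φ := fun _ => 0) hab hf continuousOn_const hG ?_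
  · linarith
  intro ε hε x hx
  have hc : Filter.Tendsto G (nhdsWithin x (Ioi x)) (nhds (G x)) := by
    have := (hG x (Ico_subset_Icc_self hx)).mono (Ioc_subset_Icc_self.trans
      (Icc_subset_Icc_left hx.1))
    have h2 : nhdsWithin x (Ioc x b) = nhdsWithin x (Ioi x) := nhdsWithin_Ioc_eq_nhdsGT hx.2
    rw [← h2]
    exact this
  -- Once the increment of `G` is below `ε / (|C| + 1)`, the quadratic bound is at most `ε` times
  -- that increment.
  have hpos : 0 < min δ (ε / (|C| + 1)) := by positivity
  have h1 : ∀ᶠ y in nhdsWithin x (Ioi x), G y < G x + min δ (ε / (|C| + 1)) :=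
    hc.eventually_lt_const (by linarith)
  filter_upwards [h1, Ioc_mem_nhdsGT hx.2] with y hy hyb
  have h3 : 0 ≤ G y - G x := sub_nonneg.2 (hGm (Ico_subset_Icc_self hx)
    ⟨hx.1.trans hyb.1.le, hyb.2⟩ hyb.1.le)
  have h4 := H x (Ico_subset_Icc_self hx) y ⟨hyb.1.le, hyb.2⟩
    (by linarith [min_le_left δ (ε / (|C| + 1))])
  have h5 : (|C| + 1) * (G y - G x) ≤ ε := by
    rw [mul_comm, ← le_div_iff₀ (by positivity)]
    linarith [min_le_right δ (ε / (|C| + 1))]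
  have h6 := le_abs_self C
  nlinarith

theorem eq_of_abs_sub_le_sq {f G : ℝ → ℝ} {a b C δ : ℝ} (hab : a ≤ b) (hδ : 0 < δ)
    (hf : ContinuousOn f (Icc a b)) (hG : ContinuousOn G (Icc a b)) (hGm : MonotoneOn G (Icc a b))
    (H : ∀ x ∈ Icc a b, ∀ y ∈ Icc x b, G y - G x ≤ δ → |f y - f x| ≤ C * (G y - G x) ^ 2) :
    f b = f a := by
  apply le_antisymm
  · exact le_of_sub_le_sq hab hδ hf hG hGm fun x hx y hy h => (le_abs_self _).trans (H x hx y hy h)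
  · have := le_of_sub_le_sq (f := fun x => - f x) (C := C) hab hδ hf.neg hG hGm
      fun x hx y hy h => by
        have := (neg_le_abs _).trans (H x hx y hy h)
        linarith
    linarith

theorem intervalIntegral_sub_eq {k : ℝ → ℝ} (hk : Integrable k) (s x y : ℝ) :
    (∫ v in s..y, k v) - ∫ v in s..x, k v = ∫ v in x..y, k v :=
  intervalIntegral.integral_interval_sub_left hk.intervalIntegrable hk.intervalIntegrable

theorem continuous_integral_primitive {F : Type*} [NormedAddCommGroup F] [NormedSpace ℝ F]
    {k : ℝ → F} (hk : Integrable k) (s : ℝ) : Continuous fun x => ∫ v in s..x, k v :=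
  intervalIntegral.continuous_primitive (fun _ _ => hk.intervalIntegrable) s

theorem monotone_integral_primitive {k : ℝ → ℝ} (hk : Integrable k) (hk0 : ∀ x, 0 ≤ k x) (s : ℝ) :
    Monotone fun x => ∫ v in s..x, k v := by
  intro x y hxy
  have := intervalIntegral_sub_eq hk s x y
  have h2 : 0 ≤ ∫ v in x..y, k v := intervalIntegral.integral_nonneg hxy fun v _ => hk0 v
  simp only
  linarith

/-- Grönwall's inequality with an integrable rate, from bounds on all increments. -/
theorem le_mul_exp_of_increments {k h : ℝ → ℝ} {s t : ℝ} (hst : s ≤ t) (hk : Integrable k)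
    (hk0 : ∀ x, 0 ≤ k x) (hh : ContinuousOn h (Icc s t)) (h0 : ∀ τ ∈ Icc s t, 0 ≤ h τ)
    (H : ∀ τ ∈ Icc s t, ∀ τ' ∈ Icc τ t, h τ' ≤ h τ + ∫ v in τ..τ', k v * h v) :
    h t ≤ h s * Real.exp (∫ v in s..t, k v) := by
  obtain ⟨M, hM⟩ := isCompact_Icc.bddAbove_image hh
  have hM' : ∀ τ ∈ Icc s t, h τ ≤ M := fun τ hτ => hM (mem_image_of_mem _ hτ)
  have hM0 : 0 ≤ M := (h0 s ⟨le_rfl, hst⟩).trans (hM' s ⟨le_rfl, hst⟩)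
  set K : ℝ → ℝ := fun x => ∫ v in s..x, k v with hK
  have hKc : Continuous K := continuous_integral_primitive hk s
  have hKm : Monotone K := monotone_integral_primitive hk hk0 s
  have hle : ∀ τ ∈ Icc s t, ∀ τ' ∈ Icc τ t, ∀ A, (∀ v ∈ Icc τ τ', h v ≤ A) →
      ∫ v in τ..τ', k v * h v ≤ A * (K τ' - K τ) := by
    intro τ hτ τ' hτ' A hA
    rw [hK, intervalIntegral_sub_eq hk, ← intervalIntegral.integral_const_mul]
    apply intervalIntegral.integral_mono_on hτ'.1
    · have : IntegrableOn (fun v => k v * h v) (Icc τ τ') :=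
        hk.integrableOn.mul_continuousOn (hh.mono (Icc_subset_Icc hτ.1 hτ'.2)) isCompact_Icc
      rw [intervalIntegrable_iff_integrableOn_Icc_of_le hτ'.1]
      exact this
    · exact (hk.const_mul _).intervalIntegrable
    · intro v hv
      rw [mul_comm]
      exact mul_le_mul_of_nonneg_right (hA v hv) (hk0 v)
  -- Feeding the crude bound `h ≤ h x + M Δ` back into the integral gives `h y ≤ h x (1 + Δ) + M
  -- Δ²`. As `(1 + Δ) exp (-Δ) ≤ 1`, the product with `exp (-K)` increases by at most `M Δ²`.
  have main := le_of_sub_le_sq (f := fun x => h x * Real.exp (-K x)) (G := K) (C := M) hst one_pos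
    (hh.mul (by fun_prop)) hKc.continuousOn (hKm.monotoneOn _) ?_
  · simp only [hK, intervalIntegral.integral_same, neg_zero, Real.exp_zero, mul_one,
      Real.exp_neg] at main
    rwa [← div_eq_mul_inv, div_le_iff₀ (Real.exp_pos _)] at main
  · intro x hx y hy _
    set Δ := K y - K x with hΔ
    have hΔ0 : 0 ≤ Δ := sub_nonneg.2 (hKm hy.1)
    have h1 : ∀ v ∈ Icc x y, h v ≤ h x + M * Δ := by
      intro v hv
      refine (H x hx v ⟨hv.1, hv.2.trans hy.2⟩).trans ?_
      have h2 := hle x hx v ⟨hv.1, hv.2.trans hy.2⟩ M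
        fun z hz => hM' z ⟨hx.1.trans hz.1, (hz.2.trans hv.2).trans hy.2⟩
      have h3 : K v - K x ≤ Δ := by simpa [hΔ] using hKm hv.2
      nlinarith
    have h2 := (H x hx y hy).trans (add_le_add_right (hle x hx y hy _ h1) _)
    have h3 : Real.exp (-K y) = Real.exp (-K x) * Real.exp (-Δ) := by
      rw [← Real.exp_add]; congr 1; rw [hΔ]; ring
    have h4 : (1 + Δ) * Real.exp (-Δ) ≤ 1 := by
      rw [Real.exp_neg, ← div_eq_mul_inv, div_le_one (Real.exp_pos _), add_comm]
      exact Real.add_one_le_exp _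
    have h5 : Real.exp (-K y) ≤ 1 := by
      apply Real.exp_le_one_iff.2
      have := hKm (hx.1.trans hy.1)
      simp only [hK, intervalIntegral.integral_same] at this
      simpa using this
    have h6 := Real.exp_pos (-K y)
    have h7 := Real.exp_pos (-K x)
    have h8 : h y * Real.exp (-K y) ≤ (h x + (h x + M * Δ) * Δ) * Real.exp (-K y) :=
      mul_le_mul_of_nonneg_right h2 h6.le
    have h9 : h x * Real.exp (-K x) * ((1 + Δ) * Real.exp (-Δ)) ≤ h x * Real.exp (-K x) := by
      have := h0 x hx
      apply mul_le_of_le_one_right (by positivity) h4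
    have h10 : M * Δ ^ 2 * Real.exp (-K y) ≤ M * Δ ^ 2 :=
      mul_le_of_le_one_right (by positivity) h5
    have h11 : (h x + (h x + M * Δ) * Δ) * Real.exp (-K y)
      = h x * Real.exp (-K x) * ((1 + Δ) * Real.exp (-Δ)) + M * Δ ^ 2 * Real.exp (-K y) := by
      rw [h3]; ring
    linarith

/-- Grönwall's inequality, backwards in time. -/
theorem le_mul_exp_of_decrements {k h : ℝ → ℝ} {s t : ℝ} (hst : s ≤ t) (hk : Integrable k)
    (hk0 : ∀ x, 0 ≤ k x) (hh : ContinuousOn h (Icc s t)) (h0 : ∀ τ ∈ Icc s t, 0 ≤ h τ)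
    (H : ∀ τ ∈ Icc s t, ∀ τ' ∈ Icc τ t, h τ ≤ h τ' + ∫ v in τ..τ', k v * h v) :
    h s ≤ h t * Real.exp (∫ v in s..t, k v) := by
  have hmem : ∀ {τ a b : ℝ}, τ ∈ Icc (-b) (-a) → -τ ∈ Icc a b := fun {τ a b} hτ =>
    ⟨by linarith [hτ.2], by linarith [hτ.1]⟩
  have := le_mul_exp_of_increments (k := fun v => k (-v)) (h := fun v => h (-v)) (s := -t) (t := -s)
    (by linarith) hk.comp_neg (fun x => hk0 _)
    (hh.comp continuous_neg.continuousOn fun x hx => hmem hx) (fun τ hτ => h0 _ (hmem hτ)) ?_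
  · rw [intervalIntegral.integral_comp_neg k] at this
    simpa only [neg_neg] using this
  · intro τ hτ τ' hτ'
    have h1 := H (-τ') ⟨by linarith [hτ'.2], by linarith [hτ.1, hτ'.1]⟩ (-τ)
      ⟨by linarith [hτ'.1], by linarith [hτ.1]⟩
    rw [intervalIntegral.integral_comp_neg fun v => k v * h v]
    exact h1

/-! ### Flows of Carathéodory fields on a finite-dimensional space -/

/-- A time-dependent `C¹` field, measurable in time, with bounds on balls that are integrable in
time, with integrable radial growth, and divergence free for the standard Gaussian measure. -/
structure IsGaussianField {E : Type*} [NormedAddCommGroup E] [InnerProductSpace ℝ E]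
    [MeasurableSpace E] (b : ℝ → E → E) : Prop where
  measurable : ∀ x, Measurable fun r => b r x
  contDiff : ∀ r, ContDiff ℝ 1 (b r)
  bound : ∀ R : ℝ, ∃ g : ℝ → ℝ, Integrable g ∧
    ∀ r x, ‖x‖ ≤ R → ‖b r x‖ ≤ g r ∧ ‖fderiv ℝ (b r) x‖ ≤ g r
  radial : ∃ κ : ℝ → ℝ, Integrable κ ∧ ∀ r x, |inner ℝ (b r x) x| ≤ κ r * ‖x‖
  trace : ∀ r x, LinearMap.trace ℝ E (fderiv ℝ (b r) x) = inner ℝ (b r x) x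

/-- `X` is a solution of the integral equation of the field `b` from the point `x` at time `s`. -/
structure IsSol {E : Type*} [NormedAddCommGroup E] [NormedSpace ℝ E]
    (b : ℝ → E → E) (s : ℝ) (x : E) (X : ℝ → E) : Prop where
  continuous : Continuous X
  eq : ∀ t, s ≤ t → X t = x + ∫ r in s..t, b r (X r)

section
variable {E : Type*} [NormedAddCommGroup E] [InnerProductSpace ℝ E] [FiniteDimensional ℝ E]
  [MeasurableSpace E] [BorelSpace E] {b : ℝ → E → E}

namespace IsGaussianField

theorem exists_bound (hb : IsGaussianField b) (R : ℝ) : ∃ g : ℝ → ℝ, Integrable g ∧ (∀ r, 0 ≤ g r) ∧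
    ∀ r x, ‖x‖ ≤ R → ‖b r x‖ ≤ g r ∧ ‖fderiv ℝ (b r) x‖ ≤ g r := by
  obtain ⟨g, hg, h⟩ := hb.bound R
  exact ⟨fun r => |g r|, hg.abs, fun r => abs_nonneg _, fun r x hx =>
    ⟨(h r x hx).1.trans (le_abs_self _), (h r x hx).2.trans (le_abs_self _)⟩⟩

theorem lipschitz (hb : IsGaussianField b) {R : ℝ} {g : ℝ → ℝ}
    (hg : ∀ r x, ‖x‖ ≤ R → ‖b r x‖ ≤ g r ∧ ‖fderiv ℝ (b r) x‖ ≤ g r) (r : ℝ) {x y : E}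
    (hx : ‖x‖ ≤ R) (hy : ‖y‖ ≤ R) : ‖b r x - b r y‖ ≤ g r * ‖x - y‖ := by
  apply (convex_closedBall (0 : E) R).norm_image_sub_le_of_norm_fderiv_le (𝕜 := ℝ)
  · intro z _
    exact ((hb.contDiff r).differentiable one_ne_zero) z
  · intro z hz
    exact (hg r z (by simpa using hz)).2
  · simpa using hy
  · simpa using hx

theorem measurable_uncurry (hb : IsGaussianField b) : Measurable fun p : ℝ × E => b p.1 p.2 := by
  have h := measurable_uncurry_of_continuous_of_measurable (u := fun x r => b r x)
    (fun r => (hb.contDiff r).continuous) hb.measurable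
  exact h.comp measurable_swap

theorem measurable_comp (hb : IsGaussianField b) {X : ℝ → E} (hX : Continuous X) :
    Measurable fun r => b r (X r) :=
  hb.measurable_uncurry.comp (measurable_id.prodMk hX.measurable)

theorem integrable_comp (hb : IsGaussianField b) {X : ℝ → E} (hX : Continuous X) {R : ℝ}
    (hR : ∀ r, ‖X r‖ ≤ R) : Integrable fun r => b r (X r) := by
  obtain ⟨g, hg, hg0, h⟩ := hb.exists_bound R
  exact hg.mono' (hb.measurable_comp hX).aestronglyMeasurable
    (Filter.Eventually.of_forall fun r => (h r _ (hR r)).1)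

theorem intervalIntegrable (hb : IsGaussianField b) {X : ℝ → E} (hX : Continuous X) (s t : ℝ) :
    IntervalIntegrable (fun r => b r (X r)) volume s t := by
  obtain ⟨R, hR⟩ := isCompact_uIcc.exists_bound_of_continuousOn (s := uIcc s t) hX.continuousOn
  obtain ⟨g, hg, hg0, h⟩ := hb.exists_bound R
  refine (hg.intervalIntegrable (a := s) (b := t)).mono_fun
    (hb.measurable_comp hX).aestronglyMeasurable ?_
  refine (ae_restrict_iff' measurableSet_uIoc).2 (Filter.Eventually.of_forall fun r hr => ?_)
  exact (h r _ (hR r (uIoc_subset_uIcc hr))).1.trans (le_abs_self _)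

end IsGaussianField

namespace IsSol

variable {s : ℝ} {x : E} {X : ℝ → E}

theorem init (h : IsSol b s x X) : X s = x := by simpa using h.eq s le_rfl

theorem sub_eq (hb : IsGaussianField b) (h : IsSol b s x X) {τ t : ℝ} (hτ : s ≤ τ) (ht : s ≤ t) :
    X t - X τ = ∫ r in τ..t, b r (X r) := by
  rw [h.eq t ht, h.eq τ hτ, add_sub_add_left_eq_sub]
  exact intervalIntegral.integral_interval_sub_left (hb.intervalIntegrable h.continuous _ _)
    (hb.intervalIntegrable h.continuous _ _)

theorem restart (hb : IsGaussianField b) (h : IsSol b s x X) {τ : ℝ} (hτ : s ≤ τ) :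
    IsSol b τ (X τ) X :=
  ⟨h.continuous, fun t ht => by rw [← h.sub_eq hb hτ (hτ.trans ht)]; abel⟩

/-- The equation says nothing before time `s`; freezing the path there makes bounds valid after `s`
hold on all of `ℝ`. -/
theorem comp_max (h : IsSol b s x X) : IsSol b s x fun v => X (max s v) := by
  refine ⟨h.continuous.comp (by fun_prop), fun t ht => ?_⟩
  rw [max_eq_right ht, h.eq t ht]
  congr 1
  refine intervalIntegral.integral_congr fun r hr => ?_
  rw [uIcc_of_le ht] at hr
  simp [max_eq_right hr.1]

/-- A chain rule for a path with merely integrable speed. On a step with `∫ g = δ`, freezing the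
second argument of the inner product costs `δ²`, counted twice, and the squared increment of `X`
costs another `δ²`; hence the constant `3`. -/
theorem norm_sq_eq (hb : IsGaussianField b) (h : IsSol b s x X) {t : ℝ} (ht : s ≤ t) :
    ‖X t‖ ^ 2 = ‖x‖ ^ 2 + 2 * ∫ r in s..t, inner ℝ (b r (X r)) (X r) := by
  obtain ⟨R, hR⟩ := isCompact_Icc.exists_bound_of_continuousOn (s := Icc s t)
    h.continuous.continuousOn
  obtain ⟨g, hg, hg0, hgb⟩ := hb.exists_bound R
  have hI : ∀ c d, IntervalIntegrable (fun r => inner ℝ (b r (X r)) (X r)) volume c d := by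
    intro c d
    have h1 := hb.intervalIntegrable h.continuous c d
    obtain ⟨M, hM⟩ := isCompact_uIcc.exists_bound_of_continuousOn (s := uIcc c d)
      h.continuous.continuousOn
    refine (h1.norm.const_mul M).mono_fun
      ((hb.measurable_comp h.continuous).inner h.continuous.measurable).aestronglyMeasurable ?_
    refine (ae_restrict_iff' measurableSet_uIoc).2 (Filter.Eventually.of_forall fun r hr => ?_)
    refine (norm_inner_le_norm _ _).trans (le_trans ?_ (le_abs_self _))
    rw [mul_comm]
    exact mul_le_mul_of_nonneg_right (hM r (uIoc_subset_uIcc hr)) (norm_nonneg _)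
  have key := eq_of_abs_sub_le_sq
    (f := fun τ => ‖X τ‖ ^ 2 - 2 * ∫ r in s..τ, inner ℝ (b r (X r)) (X r))
    (G := fun τ => ∫ r in s..τ, g r) (C := 3) ht one_pos
    ((h.continuous.norm.pow 2).continuousOn.sub
      (continuousOn_const.mul (intervalIntegral.continuous_primitive hI s).continuousOn))
    (continuous_integral_primitive hg s).continuousOn
    ((monotone_integral_primitive hg hg0 s).monotoneOn _) ?_
  · simp only [intervalIntegral.integral_same, mul_zero, sub_zero, h.init] at key
    linarith
  · intro τ hτ τ' hτ' _
    have hΔ : ∀ v ∈ Icc τ τ', ‖X v - X τ‖ ≤ ∫ r in τ..τ', g r := by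
      intro v hv
      rw [h.sub_eq hb hτ.1 (hτ.1.trans hv.1)]
      calc ‖∫ r in τ..v, b r (X r)‖ ≤ ∫ r in τ..v, g r := by
            refine intervalIntegral.norm_integral_le_of_norm_le hv.1
              (Filter.Eventually.of_forall fun r hr => ?_) hg.intervalIntegrable
            exact (hgb r _ (hR r ⟨hτ.1.trans hr.1.le, hr.2.trans (hv.2.trans hτ'.2)⟩)).1
        _ ≤ _ := intervalIntegral.integral_mono_interval le_rfl hv.1 hv.2
            (Filter.Eventually.of_forall hg0) hg.intervalIntegrable
    simp only [intervalIntegral_sub_eq hg]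
    set δ := ∫ r in τ..τ', g r with hδ
    have e1 : (∫ r in s..τ', inner ℝ (b r (X r)) (X r)) - (∫ r in s..τ, inner ℝ (b r (X r)) (X r))
        = ∫ r in τ..τ', inner ℝ (b r (X r)) (X r) :=
      intervalIntegral.integral_interval_sub_left (hI _ _) (hI _ _)
    have hIb := hb.intervalIntegrable h.continuous τ τ'
    have e2 : ∫ r in τ..τ', inner ℝ (b r (X r)) (X τ) = inner ℝ (X τ' - X τ) (X τ) := by
      rw [h.sub_eq hb hτ.1 (hτ.1.trans hτ'.1), real_inner_comm]
      simp_rw [real_inner_comm (X τ)]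
      exact (innerSL ℝ (X τ)).intervalIntegral_comp_comm hIb
    have hI2 : IntervalIntegrable (fun r => inner ℝ (b r (X r)) (X τ)) volume τ τ' := by
      simp_rw [real_inner_comm (X τ)]
      exact ⟨(innerSL ℝ (X τ)).integrable_comp hIb.1, (innerSL ℝ (X τ)).integrable_comp hIb.2⟩
    have e3 : |(∫ r in τ..τ', inner ℝ (b r (X r)) (X r))
        - ∫ r in τ..τ', inner ℝ (b r (X r)) (X τ)| ≤ δ * δ := by
      rw [← intervalIntegral.integral_sub (hI _ _) hI2]
      have : δ * δ = ∫ r in τ..τ', g r * δ := by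
        rw [intervalIntegral.integral_mul_const]
      rw [this, ← Real.norm_eq_abs]
      refine intervalIntegral.norm_integral_le_of_norm_le hτ'.1
        (Filter.Eventually.of_forall fun r hr => ?_) (hg.mul_const _).intervalIntegrable
      rw [← inner_sub_right]
      refine (norm_inner_le_norm _ _).trans ?_
      exact mul_le_mul (hgb r _ (hR r ⟨hτ.1.trans hr.1.le, hr.2.trans hτ'.2⟩)).1
        (hΔ r ⟨hr.1.le, hr.2⟩) (norm_nonneg _) (hg0 r)
    have e4 : ‖X τ'‖ ^ 2 = ‖X τ‖ ^ 2 + 2 * inner ℝ (X τ' - X τ) (X τ) + ‖X τ' - X τ‖ ^ 2 := by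
      have := norm_add_sq_real (X τ' - X τ) (X τ)
      rw [sub_add_cancel] at this
      linarith
    have e5 : ‖X τ' - X τ‖ ^ 2 ≤ δ ^ 2 := by
      have := hΔ τ' ⟨hτ'.1, le_rfl⟩
      gcongr
    have e6 := abs_le.1 e3
    rw [e2] at e6
    rw [abs_le]
    constructor <;> nlinarith [sq_nonneg ‖X τ' - X τ‖, e6.1, e6.2]

end IsSol

/-- Only the radial part of the field enters the evolution of `‖X‖²`, and `‖X‖ ≤ 1 + ‖X‖²` turns its
bound into a Grönwall rate. Integrating that rate over the whole line makes `A` independent of the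
times and of the solution. -/
theorem IsGaussianField.exists_growth (hb : IsGaussianField b) : ∃ A : ℝ, 0 ≤ A ∧
    ∀ {s x X}, IsSol b s x X → ∀ t, s ≤ t →
      1 + ‖X t‖ ^ 2 ≤ (1 + ‖x‖ ^ 2) * A ∧ 1 + ‖x‖ ^ 2 ≤ (1 + ‖X t‖ ^ 2) * A := by
  obtain ⟨κ, hκ, hr⟩ := hb.radial
  set k : ℝ → ℝ := fun r => 2 * |κ r| with hk
  have hki : Integrable k := hκ.abs.const_mul 2
  have hk0 : ∀ r, 0 ≤ k r := fun r => by positivity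
  refine ⟨Real.exp (∫ r, k r), by positivity, fun {s x X} h t ht => ?_⟩
  have hexp : Real.exp (∫ r in s..t, k r) ≤ Real.exp (∫ r, k r) := by
    apply Real.exp_le_exp.2
    rw [intervalIntegral.integral_of_le ht]
    exact setIntegral_le_integral hki (Filter.Eventually.of_forall hk0)
  have hinc : ∀ τ ∈ Icc s t, ∀ τ' ∈ Icc τ t, |(1 + ‖X τ'‖ ^ 2) - (1 + ‖X τ‖ ^ 2)|
      ≤ ∫ v in τ..τ', k v * (1 + ‖X v‖ ^ 2) := by
    intro τ hτ τ' hτ'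
    rw [(h.restart hb hτ.1).norm_sq_eq hb hτ'.1, add_sub_add_left_eq_sub, add_sub_cancel_left,
      ← intervalIntegral.integral_const_mul, ← Real.norm_eq_abs]
    refine intervalIntegral.norm_integral_le_of_norm_le hτ'.1
      (Filter.Eventually.of_forall fun r hr' => ?_) ?_
    · rw [Real.norm_eq_abs, abs_mul, abs_two, hk, mul_assoc]
      have h1 := (hr r (X r)).trans (mul_le_mul_of_nonneg_right (le_abs_self _) (norm_nonneg _))
      have h2 : |κ r| * ‖X r‖ ≤ |κ r| * (1 + ‖X r‖ ^ 2) := by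
        apply mul_le_mul_of_nonneg_left _ (abs_nonneg _)
        nlinarith [sq_nonneg (‖X r‖ - 1)]
      linarith
    · exact hki.intervalIntegrable.mul_continuousOn (by
        have := h.continuous; fun_prop)
  have hc : ContinuousOn (fun v => 1 + ‖X v‖ ^ 2) (Icc s t) := by
    have := h.continuous; fun_prop
  constructor
  · have := le_mul_exp_of_increments ht hki hk0 hc (fun τ _ => by positivity)
      fun τ hτ τ' hτ' => by
        have := (le_abs_self _).trans (hinc τ hτ τ' hτ')
        linarith
    rw [h.init] at this
    exact this.trans (mul_le_mul_of_nonneg_left hexp (by positivity))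
  · have := le_mul_exp_of_decrements ht hki hk0 hc (fun τ _ => by positivity)
      fun τ hτ τ' hτ' => by
        have := (neg_le_abs _).trans (hinc τ hτ τ' hτ')
        linarith
    rw [h.init] at this
    exact this.trans (mul_le_mul_of_nonneg_left hexp (by positivity))

/-- The backward half confines preimages of balls: a compactly supported function composed with the
flow keeps its support in a fixed ball. -/
theorem IsGaussianField.exists_radius (hb : IsGaussianField b) (R : ℝ) : ∃ R', R ≤ R' ∧ 0 ≤ R' ∧
    ∀ {s x X}, IsSol b s x X → ∀ t, s ≤ t →
      (‖x‖ ≤ R → ‖X t‖ ≤ R') ∧ (‖X t‖ ≤ R → ‖x‖ ≤ R') := by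
  obtain ⟨A, hA, h⟩ := hb.exists_growth
  have aux : ∀ u v : ℝ, 0 ≤ u → u ≤ R → 1 + v ^ 2 ≤ (1 + u ^ 2) * A →
      v ≤ |R| + (1 + R ^ 2) * A := by
    intro u v hu huR huv
    have h1 : (1 + u ^ 2) * A ≤ (1 + R ^ 2) * A := by gcongr
    have : v ≤ 1 + v ^ 2 := by nlinarith [sq_nonneg (v - 1)]
    linarith [abs_nonneg R]
  refine ⟨|R| + (1 + R ^ 2) * A, ?_, by positivity, fun {s x X} hs t ht =>
    ⟨fun hx => aux _ _ (norm_nonneg _) hx (h hs t ht).1,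
      fun hx => aux _ _ (norm_nonneg _) hx (h hs t ht).2⟩⟩
  have : 0 ≤ (1 + R ^ 2) * A := by positivity
  linarith [le_abs_self R]

/-- Solutions starting in a ball depend on their starting points in a Lipschitz way. -/
theorem IsGaussianField.exists_lipschitz (hb : IsGaussianField b) (R : ℝ) : ∃ C, 0 ≤ C ∧
    ∀ {s x X y Y}, IsSol b s x X → IsSol b s y Y → ‖x‖ ≤ R → ‖y‖ ≤ R → ∀ t, s ≤ t →
      ‖X t - Y t‖ ≤ C * ‖x - y‖ := by
  obtain ⟨R', -, -, hR'⟩ := hb.exists_radius R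
  obtain ⟨g, hg, hg0, hgb⟩ := hb.exists_bound R'
  refine ⟨Real.exp (∫ r, g r), by positivity, fun {s x X y Y} hX hY hx hy t ht => ?_⟩
  have hexp : Real.exp (∫ r in s..t, g r) ≤ Real.exp (∫ r, g r) := by
    apply Real.exp_le_exp.2
    rw [intervalIntegral.integral_of_le ht]
    exact setIntegral_le_integral hg (Filter.Eventually.of_forall hg0)
  have hcX := hX.continuous
  have hcY := hY.continuous
  have := le_mul_exp_of_increments (h := fun v => ‖X v - Y v‖) ht hg hg0 (by fun_prop)
    (fun τ _ => norm_nonneg _) fun τ hτ τ' hτ' => ?_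
  · simp only [hX.init, hY.init] at this
    rw [mul_comm]
    exact this.trans (mul_le_mul_of_nonneg_left hexp (norm_nonneg _))
  · have e1 := hX.sub_eq hb hτ.1 (hτ.1.trans hτ'.1)
    have e2 := hY.sub_eq hb hτ.1 (hτ.1.trans hτ'.1)
    have e3 : X τ' - Y τ' = (X τ - Y τ) + ∫ v in τ..τ', (b v (X v) - b v (Y v)) := by
      rw [intervalIntegral.integral_sub (hb.intervalIntegrable hcX _ _)
        (hb.intervalIntegrable hcY _ _), ← e1, ← e2]
      abel
    rw [e3]
    refine (norm_add_le _ _).trans (add_le_add_right ?_ _)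
    refine intervalIntegral.norm_integral_le_of_norm_le hτ'.1
      (Filter.Eventually.of_forall fun r hr => ?_)
      (hg.intervalIntegrable.mul_continuousOn (by fun_prop))
    have hsr : s ≤ r := hτ.1.trans hr.1.le
    exact hb.lipschitz hgb r ((hR' hX r hsr).1 hx) ((hR' hY r hsr).1 hy)

theorem IsSol.unique (hb : IsGaussianField b) {s : ℝ} {x : E} {X Y : ℝ → E} (hX : IsSol b s x X)
    (hY : IsSol b s x Y) {t : ℝ} (ht : s ≤ t) : X t = Y t := by
  obtain ⟨C, -, h⟩ := hb.exists_lipschitz ‖x‖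
  have := h hX hY le_rfl le_rfl t ht
  rw [sub_self, norm_zero, mul_zero] at this
  exact sub_eq_zero.1 (norm_le_zero_iff.1 this)

/-- Solutions exist from every point if they exist from a dense set of points. -/
theorem IsGaussianField.exists_isSol_of_dense (hb : IsGaussianField b) {s : ℝ}
    (hD : Dense {x | ∃ X, IsSol b s x X}) (x : E) : ∃ X, IsSol b s x X := by
  have hx : ∀ k : ℕ, ∃ y, dist x y < 1 / ((k : ℝ) + 1) ∧ ∃ X, IsSol b s y X := fun k => by
    obtain ⟨y, hy, hd⟩ := hD.exists_dist_lt x (ε := 1 / ((k : ℝ) + 1)) (by positivity)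
    exact ⟨y, hd, hy⟩
  choose y hy X₀ hX₀ using hx
  -- Frozen before `s`, the paths converge uniformly on all of `ℝ`, so the limit is continuous
  -- everywhere, as `IsSol` demands.
  set X : ℕ → ℝ → E := fun k v => X₀ k (max s v) with hXdef
  have hX : ∀ k, IsSol b s (y k) (X k) := fun k => (hX₀ k).comp_max
  have hyt : Filter.Tendsto y Filter.atTop (nhds x) := by
    rw [tendsto_iff_dist_tendsto_zero]
    refine squeeze_zero (fun _ => dist_nonneg) (fun k => ?_) tendsto_one_div_add_atTop_nhds_zero_nat
    rw [dist_comm]; exact (hy k).le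
  have hyR : ∀ k, ‖y k‖ ≤ ‖x‖ + 1 := fun k => by
    have h1 := (hy k).le.trans (show 1 / ((k : ℝ) + 1) ≤ 1 by
      rw [div_le_one (by positivity)]; linarith [(Nat.cast_nonneg k : (0 : ℝ) ≤ k)])
    rw [dist_comm, dist_eq_norm] at h1
    have := norm_add_le (y k - x) x
    rw [sub_add_cancel] at this
    linarith
  obtain ⟨C, hC, hCl⟩ := hb.exists_lipschitz (‖x‖ + 1)
  have hXl : ∀ k l t, ‖X k t - X l t‖ ≤ C * ‖y k - y l‖ := fun k l t =>
    hCl (hX₀ k) (hX₀ l) (hyR k) (hyR l) (max s t) (le_max_left _ _)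
  have hcau : ∀ t, CauchySeq fun k => X k t := by
    intro t
    have h1 := hyt.cauchySeq
    rw [Metric.cauchySeq_iff] at h1 ⊢
    intro ε hε
    obtain ⟨N, hN⟩ := h1 (ε / (C + 1)) (by positivity)
    refine ⟨N, fun m hm n hn => ?_⟩
    have h2 := hN m hm n hn
    rw [dist_eq_norm] at h2 ⊢
    rw [lt_div_iff₀ (by positivity)] at h2
    have h3 := hXl m n t
    nlinarith [norm_nonneg (y m - y n)]
  choose Z hZ using fun t => cauchySeq_tendsto_of_complete (hcau t)
  have hZl : ∀ k t, ‖X k t - Z t‖ ≤ C * ‖y k - x‖ := fun k t =>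
    le_of_tendsto_of_tendsto' ((tendsto_const_nhds.sub (hZ t)).norm)
      ((tendsto_const_nhds.sub hyt).norm.const_mul C) fun l => hXl k l t
  have hlim : Filter.Tendsto (fun k => C * ‖y k - x‖) Filter.atTop (nhds 0) := by
    have := ((hyt.sub_const x).norm.const_mul C)
    simpa using this
  have hZc : Continuous Z := by
    refine TendstoUniformly.continuous (F := X) (p := Filter.atTop) ?_
      (Filter.Eventually.of_forall fun k => (hX k).continuous).frequently
    rw [Metric.tendstoUniformly_iff]
    intro ε hε
    filter_upwards [hlim.eventually_lt_const hε] with k hk t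
    rw [dist_comm, dist_eq_norm]
    exact (hZl k t).trans_lt hk
  refine ⟨Z, hZc, fun t ht => ?_⟩
  obtain ⟨R', -, -, hR'⟩ := hb.exists_radius (‖x‖ + 1)
  obtain ⟨g, hg, hg0, hgb⟩ := hb.exists_bound R'
  have hint : Filter.Tendsto (fun k => ∫ r in s..t, b r (X k r)) Filter.atTop
      (nhds (∫ r in s..t, b r (Z r))) := by
    refine intervalIntegral.tendsto_integral_filter_of_dominated_convergence g
      (Filter.Eventually.of_forall fun k =>
        (hb.measurable_comp (hX k).continuous).aestronglyMeasurable)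
      (Filter.Eventually.of_forall fun k => Filter.Eventually.of_forall fun r hr => ?_)
      hg.intervalIntegrable (Filter.Eventually.of_forall fun r _ => ?_)
    · rw [uIoc_of_le ht] at hr
      exact (hgb r _ ((hR' (hX k) r hr.1.le).1 (hyR k))).1
    · exact ((hb.contDiff r).continuous.tendsto _).comp (hZ r)
  refine tendsto_nhds_unique (hZ t) ?_
  have := hyt.add hint
  refine this.congr fun k => ((hX k).eq t ht).symm

open Classical in
/-- The flow of the field `b`, constant in the second time variable before the first one. -/
noncomputable def fieldFlow (b : ℝ → E → E) (r v : ℝ) (x : E) : E :=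
  if h : ∃ X, IsSol b r x X then h.choose (max r v) else x

/-! ### Semigroup property and joint continuity of the flow -/

section flow

variable (hb : IsGaussianField b) (hE : ∀ s x, ∃ X, IsSol b s x X)
include hE

theorem isSol_fieldFlow (r : ℝ) (x : E) : IsSol b r x fun v => fieldFlow b r v x := by
  simp only [fieldFlow, hE r x, dif_pos]
  exact (hE r x).choose_spec.comp_max

theorem fieldFlow_of_le {r v : ℝ} (h : v ≤ r) (x : E) : fieldFlow b r v x = x := by
  simp only [fieldFlow, hE r x, dif_pos, max_eq_left h]
  exact (hE r x).choose_spec.init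

include hb

theorem IsSol.eq_fieldFlow {r v : ℝ} {x : E} {X : ℝ → E} (hX : IsSol b r x X) (h : r ≤ v) :
    X v = fieldFlow b r v x :=
  hX.unique hb (isSol_fieldFlow hE r x) h

theorem fieldFlow_fieldFlow {r θ v : ℝ} (h : r ≤ θ) (h' : θ ≤ v) (x : E) :
    fieldFlow b θ v (fieldFlow b r θ x) = fieldFlow b r v x :=
  (IsSol.eq_fieldFlow hb hE ((isSol_fieldFlow hE r x).restart hb h) h').symm

theorem exists_norm_fieldFlow_le (R : ℝ) : ∃ R', R ≤ R' ∧ 0 ≤ R' ∧ ∀ r v x,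
    (‖x‖ ≤ R → ‖fieldFlow b r v x‖ ≤ R') ∧ (‖fieldFlow b r v x‖ ≤ R → ‖x‖ ≤ R') := by
  obtain ⟨R', h1, h0, h⟩ := hb.exists_radius R
  refine ⟨R', h1, h0, fun r v x => ?_⟩
  rcases le_total r v with hrv | hrv
  · exact h (isSol_fieldFlow hE r x) v hrv
  · rw [fieldFlow_of_le hE hrv]
    exact ⟨fun h => h.trans h1, fun h => h.trans h1⟩

theorem exists_fieldFlow_lipschitz (R : ℝ) : ∃ C, 0 ≤ C ∧ ∀ r v x y, ‖x‖ ≤ R → ‖y‖ ≤ R →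
    ‖fieldFlow b r v x - fieldFlow b r v y‖ ≤ C * ‖x - y‖ := by
  obtain ⟨C, hC, h⟩ := hb.exists_lipschitz R
  refine ⟨max C 1, by positivity, fun r v x y hx hy => ?_⟩
  rcases le_total r v with hrv | hrv
  · exact (h (isSol_fieldFlow hE r x) (isSol_fieldFlow hE r y) hx hy v hrv).trans
      (mul_le_mul_of_nonneg_right (le_max_left _ _) (norm_nonneg _))
  · rw [fieldFlow_of_le hE hrv, fieldFlow_of_le hE hrv]
    exact le_mul_of_one_le_left (norm_nonneg _) (le_max_right _ _)

theorem exists_fieldFlow_time_bound (R : ℝ) : ∃ g : ℝ → ℝ, Integrable g ∧ (∀ r, 0 ≤ g r) ∧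
    ∀ r v v' x, ‖x‖ ≤ R → v ≤ v' →
    ‖fieldFlow b r v' x - fieldFlow b r v x‖ ≤ ∫ τ in v..v', g τ := by
  obtain ⟨R', h1, -, h⟩ := exists_norm_fieldFlow_le hb hE R
  obtain ⟨g, hg, hg0, hgb⟩ := hb.exists_bound R'
  refine ⟨g, hg, hg0, fun r v v' x hx hv => ?_⟩
  have h3 : ∀ w w', r ≤ w → w ≤ w' →
      ‖fieldFlow b r w' x - fieldFlow b r w x‖ ≤ ∫ τ in w..w', g τ := by
    intro w w' hw hw'
    rw [(isSol_fieldFlow hE r x).sub_eq hb hw (hw.trans hw')]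
    exact intervalIntegral.norm_integral_le_of_norm_le hw'
      (Filter.Eventually.of_forall fun τ _ => (hgb τ _ ((h r τ x).1 hx)).1) hg.intervalIntegrable
  rcases le_total r v with hrv | hrv
  · exact h3 v v' hrv hv
  · rw [fieldFlow_of_le hE hrv]
    rcases le_total r v' with hrv' | hrv'
    · have := h3 r v' le_rfl hrv'
      rw [fieldFlow_of_le hE le_rfl] at this
      exact this.trans (intervalIntegral.integral_mono_interval hrv hrv' le_rfl
        (Filter.Eventually.of_forall hg0) hg.intervalIntegrable)
    · rw [fieldFlow_of_le hE hrv', sub_self, norm_zero]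
      exact intervalIntegral.integral_nonneg hv fun _ _ => hg0 _

/-- The flow is locally Lipschitz in the point and has increments in `v` bounded by those of `G = ∫
g`. By the semigroup property, delaying the start from `r` to `r'` amounts to moving the starting
point by at most `|G r' - G r|`. -/
theorem continuous_fieldFlow : Continuous fun p : ℝ × ℝ × E => fieldFlow b p.1 p.2.1 p.2.2 := by
  rw [continuous_iff_continuousAt]
  rintro ⟨r₀, v₀, x₀⟩
  set R := ‖x₀‖ + 1
  obtain ⟨R', hRR', -, hR'⟩ := exists_norm_fieldFlow_le hb hE R
  obtain ⟨C, hC, hCl⟩ := exists_fieldFlow_lipschitz hb hE R'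
  obtain ⟨g, hg, hg0, hgt⟩ := exists_fieldFlow_time_bound hb hE R
  set G : ℝ → ℝ := fun v => ∫ τ in (0)..v, g τ with hG
  have hGc : Continuous G := continuous_integral_primitive hg 0
  have ht : ∀ r v v' x, ‖x‖ ≤ R → ‖fieldFlow b r v' x - fieldFlow b r v x‖ ≤ |G v' - G v| := by
    intro r v v' x hx
    rcases le_total v v' with h | h
    · refine (hgt r v v' x hx h).trans (le_trans (le_of_eq ?_) (le_abs_self _))
      rw [hG, intervalIntegral_sub_eq hg]
    · rw [norm_sub_rev]
      refine (hgt r v' v x hx h).trans (le_trans (le_of_eq ?_) (neg_le_abs _))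
      rw [hG, neg_sub, intervalIntegral_sub_eq hg]
  have hs' : ∀ r r' v x, r ≤ r' → ‖x‖ ≤ R →
      ‖fieldFlow b r v x - fieldFlow b r' v x‖ ≤ (C + 1) * |G r' - G r| := by
    intro r r' v x h hx
    have h1 : ‖fieldFlow b r r' x - x‖ ≤ |G r' - G r| := by
      have := ht r r r' x hx
      rwa [fieldFlow_of_le hE le_rfl] at this
    rcases le_total r' v with h2 | h2
    · rw [← fieldFlow_fieldFlow hb hE h h2]
      refine (hCl r' v _ _ ((hR' r r' x).1 hx) (hx.trans hRR')).trans ?_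
      have := mul_le_mul_of_nonneg_left h1 hC
      linarith [abs_nonneg (G r' - G r)]
    · rw [fieldFlow_of_le hE h2]
      have h3 : ‖fieldFlow b r v x - x‖ ≤ |G r' - G r| := by
        rcases le_total v r with h4 | h4
        · rw [fieldFlow_of_le hE h4]; simp
        · have h5 := hgt r r v x hx h4
          rw [fieldFlow_of_le hE le_rfl] at h5
          refine (h5.trans (intervalIntegral.integral_mono_interval le_rfl h4 h2
            (Filter.Eventually.of_forall hg0) hg.intervalIntegrable)).trans ?_
          rw [← intervalIntegral_sub_eq hg 0]
          exact le_abs_self _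
      nlinarith [abs_nonneg (G r' - G r)]
  have hs : ∀ r r' v x, ‖x‖ ≤ R →
      ‖fieldFlow b r v x - fieldFlow b r' v x‖ ≤ (C + 1) * |G r' - G r| := by
    intro r r' v x hx
    rcases le_total r r' with h | h
    · exact hs' r r' v x h hx
    · rw [norm_sub_rev, abs_sub_comm]
      exact hs' r' r v x h hx
  have hbound : ∀ p : ℝ × ℝ × E, ‖p.2.2‖ ≤ R →
      ‖fieldFlow b p.1 p.2.1 p.2.2 - fieldFlow b r₀ v₀ x₀‖
        ≤ C * ‖p.2.2 - x₀‖ + |G p.2.1 - G v₀| + (C + 1) * |G r₀ - G p.1| := by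
    rintro ⟨r, v, x⟩ hx
    have hx₀ : ‖x₀‖ ≤ R := by simp [R]
    have h1 := hCl r v x x₀ (hx.trans hRR') (hx₀.trans hRR')
    have h2 := ht r v₀ v x₀ hx₀
    have h3 := hs r r₀ v₀ x₀ hx₀
    have : fieldFlow b r v x - fieldFlow b r₀ v₀ x₀ = (fieldFlow b r v x - fieldFlow b r v x₀) +
      (fieldFlow b r v x₀ - fieldFlow b r v₀ x₀)
        + (fieldFlow b r v₀ x₀ - fieldFlow b r₀ v₀ x₀) := by abel
    simp only
    rw [this]
    refine (norm_add₃_le).trans ?_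
    linarith
  rw [ContinuousAt, tendsto_iff_norm_sub_tendsto_zero]
  refine squeeze_zero' (Filter.Eventually.of_forall fun _ => norm_nonneg _)
    (g := fun p : ℝ × ℝ × E =>
      C * ‖p.2.2 - x₀‖ + |G p.2.1 - G v₀| + (C + 1) * |G r₀ - G p.1|) ?_ ?_
  · have : ∀ᶠ p : ℝ × ℝ × E in nhds (r₀, v₀, x₀), ‖p.2.2‖ < R := by
      apply (Continuous.tendsto (by fun_prop) (r₀, v₀, x₀)).eventually_lt_const
      simp [R]
    filter_upwards [this] with p hp using hbound p hp.le
  · have : Continuous fun p : ℝ × ℝ × E =>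
        C * ‖p.2.2 - x₀‖ + |G p.2.1 - G v₀| + (C + 1) * |G r₀ - G p.1| := by fun_prop
    have h := this.tendsto (r₀, v₀, x₀)
    simpa using h

end flow
end

/-! ### First-order expansion of the determinant -/

theorem exists_prod_one_add_bound {ι : Type*} (s : Finset ι) : ∃ C : ℝ, 0 ≤ C ∧
    ∀ (m : ι → ℝ) (a : ℝ), a ≤ 1 → (∀ i, |m i| ≤ a) →
      |∏ i ∈ s, (1 + m i) - 1 - ∑ i ∈ s, m i| ≤ C * a ^ 2 := by
  classical
  induction s using Finset.induction_on with
  | empty => exact ⟨0, le_rfl, by simp⟩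
  | insert j s hj ih =>
    obtain ⟨C, hC, h⟩ := ih
    refine ⟨s.card + C * 2, by positivity, fun m a ha hm => ?_⟩
    rw [Finset.prod_insert hj, Finset.sum_insert hj]
    have h1 := h m a ha hm
    have h2 : |∑ i ∈ s, m i| ≤ s.card * a := by
      refine (Finset.abs_sum_le_sum_abs _ _).trans ?_
      have := Finset.sum_le_card_nsmul s (fun i => |m i|) a fun i _ => hm i
      simpa using this
    set P := ∏ i ∈ s, (1 + m i)
    set S := ∑ i ∈ s, m i
    have e : (1 + m j) * P - 1 - (m j + S) = m j * S + (1 + m j) * (P - 1 - S) := by ring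
    rw [e]
    have ha0 : 0 ≤ a := (abs_nonneg _).trans (hm j)
    have h3 : |m j * S| ≤ a * (s.card * a) := by
      rw [abs_mul]; exact mul_le_mul (hm j) h2 (abs_nonneg _) ha0
    have h4 : |(1 + m j) * (P - 1 - S)| ≤ 2 * (C * a ^ 2) := by
      rw [abs_mul]
      refine mul_le_mul ?_ h1 (abs_nonneg _) (by norm_num)
      have := abs_add_le 1 (m j)
      rw [abs_one] at this
      linarith [hm j]
    refine (abs_add_le _ _).trans ((add_le_add h3 h4).trans (le_of_eq ?_))
    ring

/-- The identity permutation contributes `∏ (1 + M i i)`, whose linear part is the trace. Any other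
permutation moves some `i` and then also `σ i`, so its product has two off-diagonal factors and is
of order `a²`. -/
theorem Matrix.exists_det_one_add_bound (ι : Type*) [Fintype ι] [DecidableEq ι] :
    ∃ C : ℝ, 0 ≤ C ∧ ∀ (M : Matrix ι ι ℝ) (a : ℝ), a ≤ 1 → (∀ i j, |M i j| ≤ a) →
      |(1 + M).det - 1 - M.trace| ≤ C * a ^ 2 := by
  obtain ⟨C, hC, h⟩ := exists_prod_one_add_bound (Finset.univ : Finset ι)
  set N : ℝ := (((Finset.univ : Finset (Equiv.Perm ι)).erase 1).card : ℝ)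
  refine ⟨C + N * 2 ^ Fintype.card ι, by positivity, fun M a ha hM => ?_⟩
  rw [Matrix.det_apply', ← Finset.add_sum_erase _ _ (Finset.mem_univ (1 : Equiv.Perm ι))]
  have h1 := h (fun i => M i i) a ha fun i => hM i i
  have h2 : |∑ σ ∈ (Finset.univ : Finset (Equiv.Perm ι)).erase 1,
      ((Equiv.Perm.sign σ : ℤ) : ℝ) * ∏ i, (1 + M) (σ i) i| ≤ N * (2 ^ Fintype.card ι * a ^ 2) := by
    refine (Finset.abs_sum_le_sum_abs _ _).trans ?_
    rw [← nsmul_eq_mul]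
    refine Finset.sum_le_card_nsmul _ _ _ fun σ hσ => ?_
    have hσ1 : σ ≠ 1 := Finset.ne_of_mem_erase hσ
    obtain ⟨i, hi⟩ : ∃ i, σ i ≠ i := by
      by_contra! hcon
      exact hσ1 (Equiv.ext hcon)
    have ha0 : 0 ≤ a := (abs_nonneg _).trans (hM i i)
    have hij : i ≠ σ i := fun h => hi h.symm
    have hi2 : σ (σ i) ≠ σ i := fun h => hi (σ.injective h)
    have hsign : |((Equiv.Perm.sign σ : ℤ) : ℝ)| = 1 := by
      rcases Int.units_eq_one_or (Equiv.Perm.sign σ) with h | h <;> simp [h]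
    rw [abs_mul, hsign, one_mul, Finset.abs_prod]
    have hoff : ∀ k, σ k ≠ k → |(1 + M) (σ k) k| ≤ a := fun k hk => by
      simp only [Matrix.add_apply, Matrix.one_apply_ne hk, zero_add]
      exact hM _ _
    have hall : ∀ k, |(1 + M) (σ k) k| ≤ 2 := fun k => by
      have h3 : |(1 : Matrix ι ι ℝ) (σ k) k| ≤ 1 := by
        rw [Matrix.one_apply]; split_ifs <;> simp
      refine (abs_add_le _ _).trans ?_
      linarith [hM (σ k) k]
    have hmem : σ i ∈ Finset.univ.erase i := Finset.mem_erase.2 ⟨hi, Finset.mem_univ _⟩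
    rw [← Finset.mul_prod_erase _ _ (Finset.mem_univ i), ← Finset.mul_prod_erase _ _ hmem]
    have h4 : ∏ k ∈ (Finset.univ.erase i).erase (σ i), |(1 + M) (σ k) k| ≤ 2 ^ Fintype.card ι := by
      refine (Finset.prod_le_prod (fun k _ => abs_nonneg _) fun k _ => hall k).trans ?_
      rw [Finset.prod_const]
      exact pow_le_pow_right₀ one_le_two (Finset.card_le_univ _)
    have h5 := mul_le_mul (hoff i hi) (mul_le_mul (hoff _ hi2) h4
      (Finset.prod_nonneg fun _ _ => abs_nonneg _) ha0) (by positivity) ha0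
    linarith
  have h3 : ((Equiv.Perm.sign (1 : Equiv.Perm ι) : ℤ) : ℝ) * ∏ i, (1 + M) ((1 : Equiv.Perm ι) i) i
      = ∏ i, (1 + M i i) := by simp
  rw [h3, Matrix.trace]
  set Z := ∑ σ ∈ (Finset.univ : Finset (Equiv.Perm ι)).erase 1,
      ((Equiv.Perm.sign σ : ℤ) : ℝ) * ∏ i, (1 + M) (σ i) i
  simp only [Matrix.diag]
  have e : ∏ i, (1 + M i i) + Z - 1 - ∑ i, M i i = (∏ i, (1 + M i i) - 1 - ∑ i, M i i) + Z := by
    ring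
  rw [e]
  refine (abs_add_le _ _).trans ((add_le_add h1 h2).trans (le_of_eq ?_))
  ring

section
variable {E : Type*} [NormedAddCommGroup E] [InnerProductSpace ℝ E] [FiniteDimensional ℝ E]

theorem ContinuousLinearMap.exists_det_one_add_bound (E : Type*) [NormedAddCommGroup E]
    [InnerProductSpace ℝ E] [FiniteDimensional ℝ E] : ∃ C : ℝ, 0 ≤ C ∧
    ∀ A : E →L[ℝ] E, ‖A‖ ≤ 1 →
      |(ContinuousLinearMap.id ℝ E + A).det - 1 - LinearMap.trace ℝ E A| ≤ C * ‖A‖ ^ 2 := by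
  classical
  obtain ⟨C, hC, h⟩ := Matrix.exists_det_one_add_bound (Fin (Module.finrank ℝ E))
  refine ⟨C, hC, fun A hA => ?_⟩
  set e := stdOrthonormalBasis ℝ E
  set M := LinearMap.toMatrix e.toBasis e.toBasis (A : E →ₗ[ℝ] E) with hM
  have h1 : ∀ i j, |M i j| ≤ ‖A‖ := by
    intro i j
    rw [hM, LinearMap.toMatrix_apply]
    simp only [OrthonormalBasis.coe_toBasis, ContinuousLinearMap.coe_coe,
      OrthonormalBasis.coe_toBasis_repr_apply, OrthonormalBasis.repr_apply_apply]
    refine (abs_real_inner_le_norm _ _).trans ?_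
    rw [e.norm_eq_one, one_mul]
    have := A.le_opNorm (e j)
    rwa [e.norm_eq_one, mul_one] at this
  have h2 := h M ‖A‖ hA h1
  have h3 : (ContinuousLinearMap.id ℝ E + A).det = (1 + M).det := by
    rw [ContinuousLinearMap.det, ← LinearMap.det_toMatrix e.toBasis, ContinuousLinearMap.toLinearMap_add, map_add]
    congr 2
    exact LinearMap.toMatrix_one _
  rw [h3, LinearMap.trace_eq_matrix_trace ℝ e.toBasis]
  exact h2

/-! ### Near-identity maps and the Gaussian weight -/

/-- The unnormalised density of the standard Gaussian measure. -/
noncomputable def gaussWeight (x : E) : ℝ := Real.exp (-‖x‖ ^ 2 / 2)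

theorem gaussWeight_pos (x : E) : 0 < gaussWeight x := Real.exp_pos _

theorem gaussWeight_le_one (x : E) : gaussWeight x ≤ 1 :=
  Real.exp_le_one_iff.2 (by have := sq_nonneg ‖x‖; linarith)

theorem continuous_gaussWeight : Continuous (gaussWeight : E → ℝ) := by
  unfold gaussWeight; fun_prop

theorem gaussWeight_add (x y : E) : gaussWeight (x + y) =
    gaussWeight x * Real.exp (-(inner ℝ y x + ‖y‖ ^ 2 / 2)) := by
  rw [gaussWeight, gaussWeight, ← Real.exp_add, norm_add_sq_real, real_inner_comm]
  congr 1; ring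

variable [MeasurableSpace E] [BorelSpace E]

theorem integrable_gaussWeight : Integrable (gaussWeight : E → ℝ) := by
  have h := GaussianFourier.integrable_cexp_neg_mul_sq_norm_add (V := E) (b := (1 / 2 : ℂ))
    (by norm_num) 0 0
  refine (h.norm).congr (Filter.Eventually.of_forall fun x => ?_)
  simp only [zero_mul, add_zero, Complex.norm_exp, gaussWeight]
  congr 1
  have : (-(1 / 2 : ℂ) * (‖x‖ : ℂ) ^ 2) = ((-‖x‖ ^ 2 / 2 : ℝ) : ℂ) := by push_cast; ring
  rw [this, Complex.ofReal_re]

/-- To first order the determinant is `1 + trace A` and the ratio of the weights is `1 - ⟨y, x⟩`;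
the trace condition cancels these terms. The condition `(R + 1) * δ ≤ 1` keeps the exponent in `[-1,
1]`, where `exp` has a quadratic remainder. -/
theorem exists_jacobian_defect_bound (E : Type*) [NormedAddCommGroup E] [InnerProductSpace ℝ E]
    [FiniteDimensional ℝ E] {R : ℝ} (hR : 0 ≤ R) :
    ∃ C : ℝ, 0 ≤ C ∧ ∀ (x y : E) (A : E →L[ℝ] E) (δ : ℝ), ‖x‖ ≤ R → ‖y‖ ≤ δ → ‖A‖ ≤ δ →
      (R + 1) * δ ≤ 1 → LinearMap.trace ℝ E A = inner ℝ y x →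
      |(|(ContinuousLinearMap.id ℝ E + A).det| * gaussWeight (x + y) - gaussWeight x)|
        ≤ C * δ ^ 2 := by
  obtain ⟨C₀, hC₀, hdet⟩ := ContinuousLinearMap.exists_det_one_add_bound E
  refine ⟨(2 + C₀) * (R + 1) ^ 2 + (R ^ 2 + 1 + R + C₀ * 2), by positivity,
    fun x y A δ hx hy hA hδ htr => ?_⟩
  have hδ0 : 0 ≤ δ := (norm_nonneg y).trans hy
  have hδ1 : δ ≤ 1 := by nlinarith
  set D := (ContinuousLinearMap.id ℝ E + A).det
  set p : ℝ := inner ℝ y x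
  set q : ℝ := ‖y‖ ^ 2 / 2
  have hq0 : 0 ≤ q := by positivity
  have hq : q ≤ δ ^ 2 / 2 := by
    have : ‖y‖ ^ 2 ≤ δ ^ 2 := by gcongr
    simp only [q]; linarith
  have hp : |p| ≤ R * δ := by
    refine (abs_real_inner_le_norm _ _).trans ?_
    rw [mul_comm]
    exact mul_le_mul hx hy (norm_nonneg _) hR
  have hp1 : |p| ≤ 1 := hp.trans (by linarith)
  have hD : |D - 1 - p| ≤ C₀ * δ ^ 2 := by
    have := hdet A (hA.trans hδ1)
    rw [htr] at this
    exact this.trans (by gcongr)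
  have hq1 : q ≤ 1 / 2 := by nlinarith
  have hz : |-(p + q)| ≤ (R + 1) * δ := by
    rw [abs_neg]
    refine (abs_add_le _ _).trans ?_
    rw [abs_of_nonneg hq0]
    nlinarith
  have hez := Real.abs_exp_sub_one_sub_id_le (hz.trans hδ)
  have hez2 : |Real.exp (-(p + q)) - 1 - -(p + q)| ≤ (R + 1) ^ 2 * δ ^ 2 := by
    refine hez.trans ?_
    rw [← sq_abs, ← mul_pow]
    gcongr
  have hDa : |D| ≤ 2 + C₀ := by
    have e : D = (D - 1 - p) + (1 + p) := by ring
    rw [e]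
    refine (abs_add_le _ _).trans ?_
    have h1 : C₀ * δ ^ 2 ≤ C₀ := mul_le_of_le_one_right hC₀ (pow_le_one₀ hδ0 hδ1)
    have h2 := abs_add_le 1 p
    rw [abs_one] at h2
    linarith
  rw [gaussWeight_add]
  have e1 : |D| * (gaussWeight x * Real.exp (-(p + q))) - gaussWeight x
      = gaussWeight x * (|D| * Real.exp (-(p + q)) - 1) := by ring
  rw [e1, abs_mul, abs_of_pos (gaussWeight_pos x)]
  refine (mul_le_of_le_one_left (abs_nonneg _) (gaussWeight_le_one x)).trans ?_
  have e2 : |(|D| * Real.exp (-(p + q)) - 1)| ≤ |D * Real.exp (-(p + q)) - 1| := by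
    have := abs_abs_sub_abs_le (D * Real.exp (-(p + q))) 1
    rwa [abs_mul, abs_of_pos (Real.exp_pos _), abs_one] at this
  refine e2.trans ?_
  have e3 : D * Real.exp (-(p + q)) - 1 = D * (Real.exp (-(p + q)) - 1 - -(p + q))
      + (-p ^ 2 - q - p * q + (D - 1 - p) * (1 - p - q)) := by ring
  rw [e3]
  have h1 : |D * (Real.exp (-(p + q)) - 1 - -(p + q))| ≤ (2 + C₀) * ((R + 1) ^ 2 * δ ^ 2) := by
    rw [abs_mul]
    exact mul_le_mul hDa hez2 (abs_nonneg _) (by positivity)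
  have hzz : |1 - p - q| ≤ 2 := by
    rw [abs_le] at hp1 ⊢
    have : |p + q| ≤ 1 := by rw [← abs_neg]; exact hz.trans hδ
    rw [abs_le] at this
    constructor <;> linarith [this.1, this.2]
  have h2 : |(D - 1 - p) * (1 - p - q)| ≤ C₀ * δ ^ 2 * 2 := by
    rw [abs_mul]
    exact mul_le_mul hD hzz (abs_nonneg _) (by positivity)
  have h3 : |p * q| ≤ R * δ ^ 2 := by
    rw [abs_mul, abs_of_nonneg hq0]
    have : |p| * q ≤ (R * δ) * (δ ^ 2 / 2) := mul_le_mul hp hq hq0 (by positivity)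
    nlinarith [mul_nonneg hR (sq_nonneg δ)]
  have h4 : p ^ 2 ≤ R ^ 2 * δ ^ 2 := by
    rw [← sq_abs, ← mul_pow]
    gcongr
  refine (abs_add_le _ _).trans ?_
  have h5 : |(-p ^ 2 - q - p * q + (D - 1 - p) * (1 - p - q))|
      ≤ (R ^ 2 + 1 + R + C₀ * 2) * δ ^ 2 := by
    rw [abs_le] at h2 h3 ⊢
    constructor <;> nlinarith [h2.1, h2.2, h3.1, h3.2, sq_nonneg p, sq_nonneg δ]
  linarith

/-- A ball is covered by the image of a larger ball under a map close to the identity. -/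
theorem exists_add_eq_of_lipschitz {β : E → E} {R δ : ℝ} (hR : 0 ≤ R) (hδ : δ ≤ 1 / 2)
    (hβ : ∀ x, ‖x‖ ≤ R + 1 → ‖β x‖ ≤ δ)
    (hl : ∀ x y, ‖x‖ ≤ R + 1 → ‖y‖ ≤ R + 1 → ‖β x - β y‖ ≤ δ * ‖x - y‖) {y : E} (hy : ‖y‖ ≤ R) :
    ∃ x, ‖x‖ ≤ R + 1 ∧ x + β x = y := by
  have hm : MapsTo (fun x => y - β x) (Metric.closedBall 0 (R + 1)) (Metric.closedBall 0 (R + 1)) := by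
    intro x hx
    rw [mem_closedBall_zero_iff] at hx ⊢
    refine (norm_sub_le _ _).trans ?_
    linarith [hβ x hx]
  obtain ⟨x, hx, hfix, -⟩ := ContractingWith.exists_fixedPoint' (K := 1 / 2)
    (Metric.isClosed_closedBall (x := (0 : E)) (ε := R + 1)).isComplete hm
    ⟨by rw [← NNReal.coe_lt_coe]; push_cast; norm_num, LipschitzWith.of_dist_le_mul fun a b => by
      rw [Subtype.dist_eq, Subtype.dist_eq]
      simp only [MapsTo.val_restrict_apply, dist_eq_norm, sub_sub_sub_cancel_left]
      rw [norm_sub_rev]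
      refine (hl _ _ (mem_closedBall_zero_iff.1 a.2) (mem_closedBall_zero_iff.1 b.2)).trans ?_
      push_cast
      exact mul_le_mul_of_nonneg_right hδ (norm_nonneg _)⟩
    (x := 0) (by simp; linarith) (edist_ne_top _ _)
  refine ⟨x, mem_closedBall_zero_iff.1 hx, ?_⟩
  have : y - β x = x := hfix
  exact eq_sub_iff_add_eq.1 this.symm

/-- A map that is `δ`-close to the identity in `C¹`, with a Gaussian divergence-free displacement,
preserves the Gaussian weight up to an error of order `δ ^ 2`. -/
theorem exists_near_identity_bound (E : Type*) [NormedAddCommGroup E] [InnerProductSpace ℝ E]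
    [FiniteDimensional ℝ E] [MeasurableSpace E] [BorelSpace E] {R : ℝ} (hR : 0 ≤ R) :
    ∃ C : ℝ, 0 ≤ C ∧ ∀ (β : E → E) (β' : E → E →L[ℝ] E) (δ : ℝ), 0 ≤ δ → (R + 2) * δ ≤ 1 →
      δ ≤ 1 / 2 →
      (∀ x, ‖x‖ ≤ R + 1 → HasFDerivAt β (β' x) x ∧ ‖β x‖ ≤ δ ∧ ‖β' x‖ ≤ δ ∧
        LinearMap.trace ℝ E (β' x) = inner ℝ (β x) x) →
      ∀ (u : E → ℝ) (M : ℝ), Continuous u → (∀ x, |u x| ≤ M) → (∀ x, R < ‖x‖ → u x = 0) →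
      |(∫ x, u x * gaussWeight x) -
        ∫ x in Metric.closedBall 0 (R + 1), u (x + β x) * gaussWeight x| ≤ C * M * δ ^ 2 := by
  obtain ⟨C₀, hC₀, hJ⟩ := exists_jacobian_defect_bound E (R := R + 1) (by linarith)
  refine ⟨C₀ * (volume : Measure E).real (Metric.closedBall 0 (R + 1)), by positivity,
    fun β β' δ h0 hδR hδ hβ u M hu hM hsupp => ?_⟩
  set S : Set E := Metric.closedBall 0 (R + 1) with hS
  have hSm : MeasurableSet S := Metric.isClosed_closedBall.measurableSet
  have hSn : ∀ {x}, x ∈ S → ‖x‖ ≤ R + 1 := fun hx => mem_closedBall_zero_iff.1 hx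
  have hM0 : 0 ≤ M := (abs_nonneg _).trans (hM 0)
  have hl : ∀ x y, ‖x‖ ≤ R + 1 → ‖y‖ ≤ R + 1 → ‖β x - β y‖ ≤ δ * ‖x - y‖ := by
    intro x y hx hy
    refine (convex_closedBall (0 : E) (R + 1)).norm_image_sub_le_of_norm_hasFDerivWithin_le
      (𝕜 := ℝ) (f' := β') (fun z hz => (hβ z (hSn hz)).1.hasFDerivWithinAt)
      (fun z hz => (hβ z (hSn hz)).2.2.1) (mem_closedBall_zero_iff.2 hy)
      (mem_closedBall_zero_iff.2 hx)
  set T : E → E := fun x => x + β x with hT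
  have hTd : ∀ x ∈ S, HasFDerivWithinAt T (ContinuousLinearMap.id ℝ E + β' x) S x := fun x hx =>
    ((hasFDerivAt_id x).add (hβ x (hSn hx)).1).hasFDerivWithinAt
  have hTc : ContinuousOn T S := fun x hx => (hTd x hx).continuousWithinAt
  have hinj : InjOn T S := by
    intro x hx y hy hxy
    have h1 := hl x y (hSn hx) (hSn hy)
    have h2 : x - y = -(β x - β y) := by
      have : x + β x = y + β y := hxy
      rw [neg_sub, sub_eq_sub_iff_add_eq_add, this]; abel
    have h3 : ‖x - y‖ = ‖β x - β y‖ := by rw [h2, norm_neg]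
    have h4 : ‖x - y‖ ≤ 0 := by nlinarith [norm_nonneg (x - y)]
    exact sub_eq_zero.1 (norm_le_zero_iff.1 h4)
  -- The image of `S` covers the ball of radius `R`, outside of which `u` vanishes, so the change of
  -- variables on `S` captures the whole integral.
  have hcov : ∀ y, y ∉ T '' S → u y * gaussWeight y = 0 := by
    intro y hy
    rcases le_or_gt ‖y‖ R with hyR | hyR
    · obtain ⟨x, hx, hxy⟩ := exists_add_eq_of_lipschitz hR hδ
        (fun x hx => (hβ x hx).2.1) hl hyR
      exact absurd ⟨x, mem_closedBall_zero_iff.2 hx, hxy⟩ hy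
    · rw [hsupp y hyR, zero_mul]
  have hint : Integrable fun x => u x * gaussWeight x :=
    integrable_gaussWeight.bdd_mul hu.aestronglyMeasurable
      (Filter.Eventually.of_forall fun x => hM x)
  rw [← setIntegral_eq_integral_of_forall_compl_eq_zero hcov,
    integral_image_eq_integral_abs_det_fderiv_smul volume hSm hTd hinj]
  have hi1 := (integrableOn_image_iff_integrableOn_abs_det_fderiv_smul volume hSm hTd hinj
    (fun x => u x * gaussWeight x)).1 hint.integrableOn
  have hi2 : IntegrableOn (fun x => u (x + β x) * gaussWeight x) S :=
    ((hu.comp_continuousOn hTc).mul continuous_gaussWeight.continuousOn).integrableOn_compact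
      (isCompact_closedBall _ _)
  rw [← integral_sub hi1 hi2]
  have hfin : volume S < ∞ := measure_closedBall_lt_top
  have e0 : C₀ * (volume : Measure E).real S * M * δ ^ 2
      = M * (C₀ * δ ^ 2) * (volume : Measure E).real S := by ring
  rw [e0, ← Real.norm_eq_abs]
  refine norm_setIntegral_le_of_norm_le_const hfin fun x hx => ?_
  obtain ⟨-, hb1, hb2, hb3⟩ := hβ x (hSn hx)
  have := hJ x (β x) (β' x) δ (hSn hx) hb1 hb2 (by linarith) hb3
  have e : |(ContinuousLinearMap.id ℝ E + β' x).det| • (u (T x) * gaussWeight (T x))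
      - u (x + β x) * gaussWeight x = u (x + β x) *
      (|(ContinuousLinearMap.id ℝ E + β' x).det| * gaussWeight (x + β x) - gaussWeight x) := by
    simp only [hT, smul_eq_mul]; ring
  rw [e, norm_mul]
  exact mul_le_mul (hM _) this (norm_nonneg _) hM0
end

/-! ### Invariance of the Gaussian weight under the flow -/

section
variable {E : Type*} [NormedAddCommGroup E] [InnerProductSpace ℝ E] [FiniteDimensional ℝ E]
  [MeasurableSpace E] [BorelSpace E] {b : ℝ → E → E}

namespace IsGaussianField

theorem hasFDerivAt (hb : IsGaussianField b) (r : ℝ) (x : E) :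
    HasFDerivAt (b r) (fderiv ℝ (b r) x) x :=
  ((hb.contDiff r).differentiable one_ne_zero x).hasFDerivAt

/-- Each directional derivative is a limit of measurable difference quotients, and an operator is
assembled from its values on a finite basis. -/
theorem measurable_fderiv (hb : IsGaussianField b) (x : E) :
    Measurable fun r => fderiv ℝ (b r) x := by
  have h1 : ∀ h : E, Measurable fun r => fderiv ℝ (b r) x h := by
    intro h
    refine measurable_of_tendsto_metrizable
      (f := fun (n : ℕ) r => (n : ℝ) • (b r (x + (n : ℝ)⁻¹ • h) - b r x))
      (fun n => ((hb.measurable _).sub (hb.measurable _)).const_smul _) ?_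
    rw [tendsto_pi_nhds]
    intro r
    refine (hb.hasFDerivAt r x).lim h (c := fun n : ℕ => (n : ℝ)) ?_
    simpa using tendsto_natCast_atTop_atTop (R := ℝ)
  set e := stdOrthonormalBasis ℝ E
  have h2 : ∀ A : E →L[ℝ] E,
      A = ∑ i, ContinuousLinearMap.smulRightL ℝ E E (innerSL ℝ (e i)) (A (e i)) := by
    intro A
    ext v
    conv_lhs => rw [← e.sum_repr v]
    simp [e.repr_apply_apply]
  have h3 : (fun r => fderiv ℝ (b r) x) = fun r => ∑ i,
      ContinuousLinearMap.smulRightL ℝ E E (innerSL ℝ (e i)) (fderiv ℝ (b r) x (e i)) :=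
    funext fun r => h2 _
  rw [h3]
  exact Finset.measurable_fun_sum _ fun i _ =>
    (ContinuousLinearMap.continuous _).measurable.comp (h1 _)

theorem integrable_apply (hb : IsGaussianField b) (x : E) : Integrable fun r => b r x :=
  hb.integrable_comp continuous_const (fun _ => le_refl ‖x‖)

theorem hasFDerivAt_integral (hb : IsGaussianField b) (r r' : ℝ) (x : E) :
    HasFDerivAt (fun y => ∫ v in r..r', b v y) (∫ v in r..r', fderiv ℝ (b v) x) x := by
  obtain ⟨g, hg, hg0, hgb⟩ := hb.exists_bound (‖x‖ + 1)
  refine intervalIntegral.hasFDerivAt_integral_of_dominated_of_fderiv_le (bound := g)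
    (F' := fun y v => fderiv ℝ (b v) y) (Metric.ball_mem_nhds x one_pos)
    (Filter.Eventually.of_forall fun y => (hb.measurable y).aestronglyMeasurable)
    (hb.integrable_apply x).intervalIntegrable (hb.measurable_fderiv x).aestronglyMeasurable
    (Filter.Eventually.of_forall fun v _ y hy => (hgb v y ?_).2) hg.intervalIntegrable
    (Filter.Eventually.of_forall fun v _ y _ => hb.hasFDerivAt v y)
  have := norm_sub_norm_le y x
  rw [mem_ball_iff_norm] at hy
  linarith

/-- The divergence condition is linear in the field, so it is inherited by the displacement `∫ b` of
one Euler step. -/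
theorem trace_integral_fderiv (hb : IsGaussianField b) (r r' : ℝ) (x : E) :
    LinearMap.trace ℝ E (∫ v in r..r', fderiv ℝ (b v) x : E →L[ℝ] E)
      = inner ℝ (∫ v in r..r', b v x) x := by
  obtain ⟨g, hg, hg0, hgb⟩ := hb.exists_bound ‖x‖
  set tr : (E →L[ℝ] E) →ₗ[ℝ] ℝ :=
    LinearMap.trace ℝ E ∘ₗ ContinuousLinearMap.coeLM ℝ
  have hi : IntervalIntegrable (fun v => fderiv ℝ (b v) x) volume r r' :=
    (hg.mono' (hb.measurable_fderiv x).aestronglyMeasurable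
      (Filter.Eventually.of_forall fun v => (hgb v x le_rfl).2)).intervalIntegrable
  have h1 := (LinearMap.toContinuousLinearMap tr).intervalIntegral_comp_comm hi
  have h2 := (innerSL ℝ x).intervalIntegral_comp_comm
    ((hb.integrable_apply x).intervalIntegrable (a := r) (b := r'))
  rw [real_inner_comm]
  refine h1.symm.trans (Eq.trans ?_ h2)
  refine intervalIntegral.integral_congr fun v _ => ?_
  simp only [innerSL_apply_apply]
  rw [real_inner_comm]
  exact hb.trace v x

end IsGaussianField

/-- The standard Gaussian measure, up to a multiplicative constant. -/
noncomputable def gaussVolume (E : Type*) [NormedAddCommGroup E] [InnerProductSpace ℝ E]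
    [FiniteDimensional ℝ E] [MeasurableSpace E] [BorelSpace E] : Measure E :=
  volume.withDensity fun x => ENNReal.ofReal (gaussWeight x)

instance : IsFiniteMeasure (gaussVolume E) :=
  isFiniteMeasure_withDensity_ofReal integrable_gaussWeight.2

theorem integral_gaussVolume (f : E → ℝ) :
    ∫ x, f x ∂(gaussVolume E) = ∫ x, f x * gaussWeight x := by
  rw [gaussVolume, integral_withDensity_eq_integral_toReal_smul₀
    continuous_gaussWeight.measurable.ennreal_ofReal.aemeasurable
    (Filter.Eventually.of_forall fun _ => ENNReal.ofReal_lt_top)]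
  refine integral_congr_ae (Filter.Eventually.of_forall fun x => ?_)
  simp only [ENNReal.toReal_ofReal (gaussWeight_pos x).le, smul_eq_mul, mul_comm]

variable (hb : IsGaussianField b) (hE : ∀ s x, ∃ X, IsSol b s x X)
include hb hE

theorem continuous_fieldFlow_right (r v : ℝ) : Continuous (fieldFlow b r v) :=
  (continuous_fieldFlow hb hE).comp (by fun_prop : Continuous fun x : E => (r, v, x))

/-- With `F θ` the Gaussian integral of `ψ` composed with the flow from `θ` to `t`, the claim is `F
r = F t`. Over a step with `∫ g = δ` the flow differs by at most `δ²` from the Euler map `x + β x`,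
which preserves the weight up to order `δ²`. So `F` has quadratic increments and is constant. -/
theorem integral_comp_fieldFlow {r t : ℝ} (hrt : r ≤ t) {ψ : E → ℝ} {K : ℝ≥0}
    (hψ : LipschitzWith K ψ) {M R : ℝ} (hM : ∀ x, |ψ x| ≤ M) (hs : ∀ x, R < ‖x‖ → ψ x = 0) :
    ∫ x, ψ (fieldFlow b r t x) * gaussWeight x = ∫ x, ψ x * gaussWeight x := by
  have hflow := continuous_fieldFlow hb hE
  -- All `u θ` are supported in the ball of radius `R₁`. The ball of radius `R₂` contains the orbits
  -- that start in `S`, and the Euler points `x + β x` for `x` in `S`.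
  obtain ⟨R₁, -, hR₁0, hR₁⟩ := exists_norm_fieldFlow_le hb hE R
  obtain ⟨R₂, hR₁₂, hR₂0, hR₂⟩ := exists_norm_fieldFlow_le hb hE (R₁ + 2)
  obtain ⟨g, hg, hg0, hgb⟩ := hb.exists_bound R₂
  obtain ⟨C₁, hC₁, hl⟩ := exists_fieldFlow_lipschitz hb hE R₂
  obtain ⟨C₂, hC₂, hnear⟩ := exists_near_identity_bound E hR₁0
  have hM0 : 0 ≤ M := (abs_nonneg _).trans (hM 0)
  set u : ℝ → E → ℝ := fun θ x => ψ (fieldFlow b θ t x) with hu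
  have huc : Continuous fun p : ℝ × E => u p.1 p.2 :=
    hψ.continuous.comp (hflow.comp (by fun_prop : Continuous fun p : ℝ × E => (p.1, t, p.2)))
  have huc' : ∀ θ, Continuous (u θ) := fun θ =>
    huc.comp (by fun_prop : Continuous fun x : E => (θ, x))
  have hus : ∀ θ x, R₁ < ‖x‖ → u θ x = 0 := fun θ x hx => hs _ (by
    by_contra! hcon
    exact absurd ((hR₁ θ t x).2 hcon) (not_le.2 hx))
  set S : Set E := Metric.closedBall 0 (R₁ + 1) with hS
  have hSn : ∀ {x}, x ∈ S → ‖x‖ ≤ R₁ + 1 := fun hx => mem_closedBall_zero_iff.1 hx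
  have hSf : volume S < ∞ := measure_closedBall_lt_top
  set F : ℝ → ℝ := fun θ => ∫ x, u θ x * gaussWeight x with hF
  have hFc : Continuous F := by
    refine continuous_of_dominated (bound := fun x => M * gaussWeight x) (fun θ =>
      ((huc' θ).mul continuous_gaussWeight).aestronglyMeasurable)
      (fun θ => Filter.Eventually.of_forall fun x => ?_) (integrable_gaussWeight.const_mul M)
      (Filter.Eventually.of_forall fun x => ?_)
    · rw [norm_mul, Real.norm_of_nonneg (gaussWeight_pos x).le]
      exact mul_le_mul_of_nonneg_right (hM _) (gaussWeight_pos x).le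
    · exact (huc.comp (by fun_prop : Continuous fun θ : ℝ => (θ, x))).mul continuous_const
  have hmain := eq_of_abs_sub_le_sq (f := F) (G := fun θ => ∫ v in r..θ, g v)
    (C := C₂ * M + K * C₁ * volume.real S) (δ := min (1 / 2) (1 / (R₁ + 2))) hrt (by positivity)
    hFc.continuousOn (continuous_integral_primitive hg r).continuousOn
    ((monotone_integral_primitive hg hg0 r).monotoneOn _) ?_
  · have : F t = ∫ x, ψ x * gaussWeight x := by
      simp only [hF, hu, fieldFlow_of_le hE le_rfl]
    rw [← this, hmain]
  intro θ hθ θ' hθ' hδ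
  simp only [intervalIntegral_sub_eq hg] at hδ ⊢
  set δ := ∫ v in θ..θ', g v with hδdef
  have hδ0 : 0 ≤ δ := intervalIntegral.integral_nonneg hθ'.1 fun v _ => hg0 v
  have hδ1 : δ ≤ 1 / 2 := hδ.trans (min_le_left _ _)
  have hδ2 : (R₁ + 2) * δ ≤ 1 := by
    have := hδ.trans (min_le_right _ _)
    rw [le_div_iff₀ (by positivity)] at this
    linarith
  set β : E → E := fun y => ∫ v in θ..θ', b v y with hβ
  have hβS : ∀ x, ‖x‖ ≤ R₁ + 1 → HasFDerivAt β (∫ v in θ..θ', fderiv ℝ (b v) x) x ∧ ‖β x‖ ≤ δ ∧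
      ‖∫ v in θ..θ', fderiv ℝ (b v) x‖ ≤ δ ∧
      LinearMap.trace ℝ E (∫ v in θ..θ', fderiv ℝ (b v) x : E →L[ℝ] E) = inner ℝ (β x) x := by
    intro x hx
    have hx2 : ‖x‖ ≤ R₂ := by linarith
    refine ⟨hb.hasFDerivAt_integral θ θ' x, ?_, ?_, hb.trace_integral_fderiv θ θ' x⟩
    · exact intervalIntegral.norm_integral_le_of_norm_le hθ'.1
        (Filter.Eventually.of_forall fun v _ => (hgb v x hx2).1) hg.intervalIntegrable
    · exact intervalIntegral.norm_integral_le_of_norm_le hθ'.1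
        (Filter.Eventually.of_forall fun v _ => (hgb v x hx2).2) hg.intervalIntegrable
  have h1 := hnear β _ δ hδ0 hδ2 hδ1 hβS (u θ') M (huc' θ') (fun x => hM _) (hus θ')
  have h2 : F θ = ∫ x in S, u θ' (fieldFlow b θ θ' x) * gaussWeight x := by
    have e : ∀ x, u θ' (fieldFlow b θ θ' x) = u θ x := fun x => by
      simp only [hu]
      rw [fieldFlow_fieldFlow hb hE hθ'.1 hθ'.2]
    simp only [e]
    symm
    refine setIntegral_eq_integral_of_forall_compl_eq_zero fun x hx => ?_
    rw [hus θ x, zero_mul]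
    by_contra! hcon
    exact hx (mem_closedBall_zero_iff.2 (by linarith))
  have hflS : ∀ x ∈ S, ∀ v ∈ Icc θ θ', ‖fieldFlow b θ v x - x‖ ≤ δ := by
    intro x hx v hv
    have e := (isSol_fieldFlow hE θ x).eq v hv.1
    rw [e, add_sub_cancel_left]
    refine (intervalIntegral.norm_integral_le_of_norm_le hv.1
      (Filter.Eventually.of_forall fun τ _ => (hgb τ _ ((hR₂ θ τ x).1
        (by linarith [hSn hx]))).1) hg.intervalIntegrable).trans ?_
    exact intervalIntegral.integral_mono_interval le_rfl hv.1 hv.2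
      (Filter.Eventually.of_forall hg0) hg.intervalIntegrable
  have hclose : ∀ x ∈ S, ‖fieldFlow b θ θ' x - (x + β x)‖ ≤ δ ^ 2 := by
    intro x hx
    have hsol := isSol_fieldFlow hE θ x
    rw [hsol.eq θ' hθ'.1, add_sub_add_left_eq_sub, hβ,
      ← intervalIntegral.integral_sub (hb.intervalIntegrable hsol.continuous _ _)
        (hb.integrable_apply x).intervalIntegrable, sq, hδdef,
      ← intervalIntegral.integral_mul_const]
    refine intervalIntegral.norm_integral_le_of_norm_le hθ'.1
      (Filter.Eventually.of_forall fun v hv => ?_) (hg.mul_const _).intervalIntegrable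
    refine (hb.lipschitz hgb v ((hR₂ θ v x).1 (by linarith [hSn hx]))
      (by linarith [hSn hx])).trans ?_
    exact mul_le_mul_of_nonneg_left (hflS x hx v ⟨hv.1.le, hv.2⟩) (hg0 v)
  have hβc : ContinuousOn β S := fun x hx =>
    (hβS x (hSn hx)).1.continuousAt.continuousWithinAt
  have hi1 : IntegrableOn (fun x => u θ' (fieldFlow b θ θ' x) * gaussWeight x) S :=
    (((huc' θ').comp (continuous_fieldFlow_right hb hE θ θ')).mul
      continuous_gaussWeight).continuousOn.integrableOn_compact (isCompact_closedBall _ _)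
  have hi2 : IntegrableOn (fun x => u θ' (x + β x) * gaussWeight x) S :=
    (((huc' θ').comp_continuousOn (continuousOn_id.add hβc)).mul
      continuous_gaussWeight.continuousOn).integrableOn_compact (isCompact_closedBall _ _)
  have h3 : |(∫ x in S, u θ' (x + β x) * gaussWeight x) - F θ|
      ≤ K * (C₁ * δ ^ 2) * volume.real S := by
    rw [h2, ← integral_sub hi2 hi1, ← Real.norm_eq_abs]
    refine norm_setIntegral_le_of_norm_le_const hSf fun x hx => ?_
    rw [← sub_mul, norm_mul, Real.norm_of_nonneg (gaussWeight_pos x).le]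
    refine (mul_le_of_le_one_right (norm_nonneg _) (gaussWeight_le_one x)).trans ?_
    rw [← dist_eq_norm]
    refine (hψ.dist_le_mul _ _).trans (mul_le_mul_of_nonneg_left ?_ K.2)
    rw [dist_eq_norm]
    have hn : ‖x + β x‖ ≤ R₂ := by
      have := norm_add_le x (β x)
      linarith [hSn hx, (hβS x (hSn hx)).2.1]
    refine (hl θ' t _ _ hn ((hR₂ θ θ' x).1 (by linarith [hSn hx]))).trans ?_
    rw [norm_sub_rev]
    exact mul_le_mul_of_nonneg_left (hclose x hx) hC₁
  have h4 : F θ' - F θ = (F θ' - ∫ x in S, u θ' (x + β x) * gaussWeight x)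
      + ((∫ x in S, u θ' (x + β x) * gaussWeight x) - F θ) := by ring
  rw [h4]
  refine (abs_add_le _ _).trans ((add_le_add h1 h3).trans (le_of_eq ?_))
  ring

/-- The flow preserves the Gaussian measure. -/
theorem map_fieldFlow_gaussVolume {r t : ℝ} (hrt : r ≤ t) :
    (gaussVolume E).map (fieldFlow b r t) = gaussVolume E := by
  have hc := continuous_fieldFlow_right hb hE r t
  have hm := hc.measurable
  -- By inner regularity compact sets suffice, and their indicators are limits of Lipschitz
  -- functions with bounded support.
  have hK : ∀ A : Set E, IsCompact A →
      (gaussVolume E).map (fieldFlow b r t) A = gaussVolume E A := by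
    intro A hA
    have hpos : ∀ n : ℕ, (0 : ℝ) < 1 / ((n : ℝ) + 1) := fun n => by positivity
    have hlim := tendsto_one_div_add_atTop_nhds_zero_nat (𝕜 := ℝ)
    have h1 := tendsto_lintegral_thickenedIndicator_of_isClosed
      ((gaussVolume E).map (fieldFlow b r t)) hA.isClosed hpos hlim
    have h2 := tendsto_lintegral_thickenedIndicator_of_isClosed
      (gaussVolume E) hA.isClosed hpos hlim
    refine tendsto_nhds_unique h1 (h2.congr fun n => ?_)
    obtain ⟨R, hR⟩ := hA.isBounded.exists_norm_le
    set ψ := thickenedIndicator (hpos n) A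
    have hint : ∀ (m : Measure E) [IsFiniteMeasure m], ∫⁻ x, (ψ x : ℝ≥0∞) ∂m
        = ENNReal.ofReal (∫ x, (ψ x : ℝ) ∂m) := fun m _ =>
      lintegral_coe_eq_integral _ (integrable_thickenedIndicator A (hpos n))
    rw [hint, hint, integral_map hm.aemeasurable
      (by exact (NNReal.continuous_coe.comp ψ.continuous).aestronglyMeasurable),
      integral_gaussVolume, integral_gaussVolume]
    congr 1
    symm
    refine integral_comp_fieldFlow hb hE hrt (ψ := fun x => (ψ x : ℝ)) (M := 1) (R := R + 1)
      (lipschitzWith_thickenedIndicator (hpos n) A) (fun x => ?_) (fun x hx => ?_)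
    · rw [abs_of_nonneg (NNReal.coe_nonneg _)]
      have h1 : ψ x ≤ 1 := thickenedIndicator_le_one (hpos n) A x
      exact_mod_cast h1
    · rw [thickenedIndicator_zero (hpos n) A, NNReal.coe_zero]
      intro hmem
      rw [Metric.mem_thickening_iff] at hmem
      obtain ⟨z, hz, hd⟩ := hmem
      have h3 := hR z hz
      have h4 : 1 / ((n : ℝ) + 1) ≤ 1 := by
        rw [div_le_one (by positivity)]; linarith [(Nat.cast_nonneg n : (0 : ℝ) ≤ n)]
      rw [dist_eq_norm] at hd
      have := norm_sub_norm_le x z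
      linarith
  ext A hA
  rw [hA.measure_eq_iSup_isCompact_of_ne_top (measure_ne_top _ _),
    hA.measure_eq_iSup_isCompact_of_ne_top (measure_ne_top _ _)]
  exact iSup_congr fun B => iSup_congr fun _ => iSup_congr fun hB => hK B hB

end

/-! ### Comparison of two flows in another norm -/

section
variable {E : Type*} [NormedAddCommGroup E] [InnerProductSpace ℝ E] [FiniteDimensional ℝ E]
  [MeasurableSpace E] [BorelSpace E] {F : Type*} [NormedAddCommGroup F] [NormedSpace ℝ F]
  (L : E ≃L[ℝ] F) {b : ℝ → E → E}

/-- The operator norm of the derivative of the field `b`, for the norm transported by `L`. -/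
noncomputable def fieldSlope (b : ℝ → E → E) (v : ℝ) (x : E) : ℝ :=
  ‖(L : E →L[ℝ] F) ∘L fderiv ℝ (b v) x ∘L (L.symm : F →L[ℝ] E)‖

theorem fieldSlope_nonneg (v : ℝ) (x : E) : 0 ≤ fieldSlope L b v x := norm_nonneg _

theorem norm_fderiv_le_fieldSlope (v : ℝ) (x y : E) :
    ‖L (fderiv ℝ (b v) x y)‖ ≤ fieldSlope L b v x * ‖L y‖ := by
  have := ((L : E →L[ℝ] F) ∘L fderiv ℝ (b v) x ∘L (L.symm : F →L[ℝ] E)).le_opNorm (L y)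
  simpa [fieldSlope] using this

theorem fieldSlope_le (v : ℝ) (x : E) :
    fieldSlope L b v x ≤ ‖(L : E →L[ℝ] F)‖ * ‖(L.symm : F →L[ℝ] E)‖ * ‖fderiv ℝ (b v) x‖ := by
  refine (ContinuousLinearMap.opNorm_comp_le _ _).trans ?_
  rw [mul_assoc]
  refine mul_le_mul_of_nonneg_left ?_ (norm_nonneg _)
  rw [mul_comm]
  exact ContinuousLinearMap.opNorm_comp_le _ _

/-- The average of `fieldSlope` over the segment from `x` to `y`. -/
noncomputable def segmentSlope (b : ℝ → E → E) (v : ℝ) (x y : E) : ℝ :=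
  ∫ σ in (0 : ℝ)..1, fieldSlope L b v (x + σ • (y - x))

/-- The averaged slope controls two points at finite distance. Since it is continuous in the pair
and reduces to `fieldSlope` on the diagonal, estimates for nearby trajectories become estimates
along a single one. -/
theorem segmentSlope_self (v : ℝ) (x : E) : segmentSlope L b v x x = fieldSlope L b v x := by
  simp [segmentSlope]

theorem segmentSlope_nonneg (v : ℝ) (x y : E) : 0 ≤ segmentSlope L b v x y :=
  intervalIntegral.integral_nonneg zero_le_one fun _ _ => fieldSlope_nonneg L _ _

namespace IsGaussianField

theorem continuous_fderiv (hb : IsGaussianField b) (v : ℝ) : Continuous (fderiv ℝ (b v)) :=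
  (hb.contDiff v).continuous_fderiv one_ne_zero

theorem continuous_fieldSlope (hb : IsGaussianField b) (v : ℝ) : Continuous (fieldSlope L b v) := by
  have := hb.continuous_fderiv v
  unfold fieldSlope
  fun_prop

theorem measurable_fieldSlope (hb : IsGaussianField b) :
    Measurable fun p : ℝ × E => fieldSlope L b p.1 p.2 := by
  have hm : ∀ x, Measurable fun r => fieldSlope L b r x := by
    intro x
    have hc : Continuous fun A : E →L[ℝ] E =>
        ‖(L : E →L[ℝ] F) ∘L A ∘L (L.symm : F →L[ℝ] E)‖ := by fun_prop
    exact hc.measurable.comp (hb.measurable_fderiv x)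
  have h : Measurable (Function.uncurry fun (x : E) r => fieldSlope L b r x) :=
    measurable_uncurry_of_continuous_of_measurable (fun r => hb.continuous_fieldSlope L r) hm
  have e : (fun p : ℝ × E => fieldSlope L b p.1 p.2)
      = (Function.uncurry fun (x : E) r => fieldSlope L b r x) ∘ Prod.swap := by
    ext p
    rfl
  rw [e]
  exact h.comp measurable_swap

theorem continuous_segmentSlope (hb : IsGaussianField b) (v : ℝ) :
    Continuous fun p : E × E => segmentSlope L b v p.1 p.2 := by
  have := hb.continuous_fieldSlope L v
  unfold segmentSlope
  exact intervalIntegral.continuous_parametric_intervalIntegral_of_continuous' (by fun_prop) 0 1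

theorem measurable_segmentSlope (hb : IsGaussianField b) :
    Measurable fun p : ℝ × E × E => segmentSlope L b p.1 p.2.1 p.2.2 := by
  simp only [segmentSlope, intervalIntegral.integral_of_le zero_le_one]
  have h : Measurable fun q : (ℝ × E × E) × ℝ =>
      fieldSlope L b q.1.1 (q.1.2.1 + q.2 • (q.1.2.2 - q.1.2.1)) :=
    (hb.measurable_fieldSlope L).comp (f := fun q : (ℝ × E × E) × ℝ =>
      (q.1.1, q.1.2.1 + q.2 • (q.1.2.2 - q.1.2.1))) (by fun_prop)
  exact (h.stronglyMeasurable.integral_prod_right' (ν := volume.restrict (Ioc 0 1))).measurable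

/-- The mean value inequality, in integral form. -/
theorem norm_sub_le_segmentSlope (hb : IsGaussianField b) (v : ℝ) (x y : E) :
    ‖L (b v y - b v x)‖ ≤ segmentSlope L b v x y * ‖L (y - x)‖ := by
  have hd : ∀ σ ∈ uIcc (0 : ℝ) 1, HasDerivAt (fun σ : ℝ => L (b v (x + σ • (y - x))))
      (L (fderiv ℝ (b v) (x + σ • (y - x)) (y - x))) σ := by
    intro σ _
    have h1 : HasDerivAt (fun σ : ℝ => x + σ • (y - x)) (y - x) σ := by
      simpa using ((hasDerivAt_id σ).smul_const (y - x)).const_add x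
    exact (L : E →L[ℝ] F).hasFDerivAt.comp_hasDerivAt σ
      ((hb.hasFDerivAt v _).comp_hasDerivAt σ h1)
  have hcf := hb.continuous_fderiv v
  have hcs := hb.continuous_fieldSlope L v
  have : CompleteSpace F := by
    have : FiniteDimensional ℝ F := L.toLinearEquiv.finiteDimensional
    exact FiniteDimensional.complete ℝ F
  have hint := intervalIntegral.integral_eq_sub_of_hasDerivAt hd
    (Continuous.intervalIntegrable (by fun_prop) _ _)
  simp only [one_smul, add_sub_cancel, zero_smul, add_zero] at hint
  rw [map_sub, ← hint, segmentSlope, ← intervalIntegral.integral_mul_const]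
  refine intervalIntegral.norm_integral_le_of_norm_le zero_le_one
    (Filter.Eventually.of_forall fun σ _ => norm_fderiv_le_fieldSlope L v _ _)
    (Continuous.intervalIntegrable (by fun_prop) _ _)

theorem segmentSlope_le (hb : IsGaussianField b) {R : ℝ} {g : ℝ → ℝ}
    (hg : ∀ r x, ‖x‖ ≤ R → ‖b r x‖ ≤ g r ∧ ‖fderiv ℝ (b r) x‖ ≤ g r) (v : ℝ) {x y : E}
    (hx : ‖x‖ ≤ R) (hy : ‖y‖ ≤ R) :
    segmentSlope L b v x y ≤ ‖(L : E →L[ℝ] F)‖ * ‖(L.symm : F →L[ℝ] E)‖ * g v := by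
  have hcs := hb.continuous_fieldSlope L v
  have h1 : ∀ σ ∈ Icc (0 : ℝ) 1, fieldSlope L b v (x + σ • (y - x))
      ≤ ‖(L : E →L[ℝ] F)‖ * ‖(L.symm : F →L[ℝ] E)‖ * g v := by
    intro σ hσ
    refine (fieldSlope_le L v _).trans (mul_le_mul_of_nonneg_left (hg v _ ?_).2 (by positivity))
    have := (convex_closedBall (0 : E) R).add_smul_sub_mem (mem_closedBall_zero_iff.2 hx)
      (mem_closedBall_zero_iff.2 hy) hσ
    exact mem_closedBall_zero_iff.1 this
  have h2 := intervalIntegral.integral_mono_on zero_le_one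
    (Continuous.intervalIntegrable (by fun_prop) _ _) (intervalIntegrable_const (μ := volume)) h1
  simpa [segmentSlope] using h2

end IsGaussianField

/-! ### Slopes integrated along the trajectories of one flow -/

section oneflow
variable (hb : IsGaussianField b) (hE : ∀ s x, ∃ X, IsSol b s x X)
include hb hE

theorem measurable_flow_segmentSlope (r : ℝ) (x y : E) :
    Measurable fun v => segmentSlope L b v (fieldFlow b r v x) (fieldFlow b r v y) :=
  (hb.measurable_segmentSlope L).comp
    (f := fun v => (v, fieldFlow b r v x, fieldFlow b r v y)) (measurable_id.prodMk
    ((isSol_fieldFlow hE r x).continuous.measurable.prodMk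
      (isSol_fieldFlow hE r y).continuous.measurable))

theorem exists_flow_segmentSlope_bound (R : ℝ) : ∃ g : ℝ → ℝ, Integrable g ∧
    ∀ r v x y, ‖x‖ ≤ R → ‖y‖ ≤ R →
      segmentSlope L b v (fieldFlow b r v x) (fieldFlow b r v y) ≤ g v := by
  obtain ⟨R', -, -, hR'⟩ := exists_norm_fieldFlow_le hb hE R
  obtain ⟨g, hg, hg0, hgb⟩ := hb.exists_bound R'
  exact ⟨_, hg.const_mul _, fun r v x y hx hy =>
    hb.segmentSlope_le L hgb v ((hR' r v x).1 hx) ((hR' r v y).1 hy)⟩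

theorem integrable_flow_segmentSlope (r : ℝ) (x y : E) :
    Integrable fun v => segmentSlope L b v (fieldFlow b r v x) (fieldFlow b r v y) := by
  obtain ⟨g, hg, h⟩ := exists_flow_segmentSlope_bound L hb hE (max ‖x‖ ‖y‖)
  refine hg.mono' (measurable_flow_segmentSlope L hb hE r x y).aestronglyMeasurable
    (Filter.Eventually.of_forall fun v => ?_)
  rw [Real.norm_of_nonneg (segmentSlope_nonneg L v _ _)]
  exact h r v x y (le_max_left _ _) (le_max_right _ _)

/-- The flow expands distances at most by the exponential of the integrated slope. -/
theorem norm_fieldFlow_sub_le_exp {r u : ℝ} (hru : r ≤ u) (x y : E) :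
    ‖L (fieldFlow b r u y - fieldFlow b r u x)‖ ≤ ‖L (y - x)‖ *
      Real.exp (∫ v in r..u, segmentSlope L b v (fieldFlow b r v x) (fieldFlow b r v y)) := by
  have hX := isSol_fieldFlow hE r x
  have hY := isSol_fieldFlow hE r y
  have hcX := hX.continuous
  have hcY := hY.continuous
  have hI := integrable_flow_segmentSlope L hb hE r x y
  have := le_mul_exp_of_increments
    (h := fun v => ‖L (fieldFlow b r v y - fieldFlow b r v x)‖) hru hI
    (fun v => segmentSlope_nonneg L v _ _) (by fun_prop) (fun τ _ => norm_nonneg _)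
    fun τ hτ τ' hτ' => ?_
  · simpa only [fieldFlow_of_le hE le_rfl] using this
  · have e1 := hX.sub_eq hb hτ.1 (hτ.1.trans hτ'.1)
    have e2 := hY.sub_eq hb hτ.1 (hτ.1.trans hτ'.1)
    have hIX := hb.intervalIntegrable hcX τ τ'
    have hIY := hb.intervalIntegrable hcY τ τ'
    have hIs := hIY.sub hIX
    have e3 : fieldFlow b r τ' y - fieldFlow b r τ' x = (fieldFlow b r τ y - fieldFlow b r τ x)
        + ∫ v in τ..τ', (b v (fieldFlow b r v y) - b v (fieldFlow b r v x)) := by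
      rw [intervalIntegral.integral_sub hIY hIX, ← e1, ← e2]
      abel
    have : CompleteSpace F := by
      have : FiniteDimensional ℝ F := L.toLinearEquiv.finiteDimensional
      exact FiniteDimensional.complete ℝ F
    have e4 := (L : E →L[ℝ] F).intervalIntegral_comp_comm hIs
    simp only [ContinuousLinearEquiv.coe_coe] at e4
    rw [e3, map_add, ← e4]
    refine (norm_add_le _ _).trans (add_le_add_right ?_ _)
    exact intervalIntegral.norm_integral_le_of_norm_le hτ'.1
      (Filter.Eventually.of_forall fun v _ => hb.norm_sub_le_segmentSlope L v _ _)
      (hI.intervalIntegrable.mul_continuousOn (by fun_prop))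

/-- Dominated convergence with a moving endpoint: near `p₀` all starting points lie in one ball, on
which the slopes share an integrable bound. This continuity makes the amplification factors of
neighbouring trajectories comparable. -/
theorem continuous_integral_segmentSlope (u : ℝ) : Continuous fun p : ℝ × E × E =>
    ∫ v in p.1..u, segmentSlope L b v (fieldFlow b p.1 v p.2.1) (fieldFlow b p.1 v p.2.2) := by
  rw [continuous_iff_continuousAt]
  intro p₀
  set f : ℝ × E × E → ℝ → ℝ := fun p v =>
    segmentSlope L b v (fieldFlow b p.1 v p.2.1) (fieldFlow b p.1 v p.2.2)
  set R := max ‖p₀.2.1‖ ‖p₀.2.2‖ + 1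
  obtain ⟨g, hg, h⟩ := exists_flow_segmentSlope_bound L hb hE R
  have hflow := continuous_fieldFlow hb hE
  have key := intervalIntegral.continuousAt_parametric_primitive_of_dominated (μ := volume)
    (F := f) g (min u p₀.1 - 1) (max u p₀.1 + 1) (a₀ := u) (b₀ := p₀.1) (x₀ := p₀)
    (fun p => (measurable_flow_segmentSlope L hb hE p.1 p.2.1 p.2.2).aestronglyMeasurable)
    ?_ hg.intervalIntegrable ?_ ?_ ?_ (by simp)
  · have h2 : ContinuousAt (fun p : ℝ × E × E => (p, p.1)) p₀ := by fun_prop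
    have h3 := (ContinuousAt.comp (f := fun p : ℝ × E × E => (p, p.1)) key h2).neg
    refine h3.congr (Filter.Eventually.of_forall fun p => ?_)
    exact (intervalIntegral.integral_symm _ _).symm
  · have h1 : ∀ᶠ p : ℝ × E × E in nhds p₀, ‖p.2.1‖ < R :=
      (Continuous.tendsto (by fun_prop) p₀).eventually_lt_const (by simp [R]; grind)
    have h2 : ∀ᶠ p : ℝ × E × E in nhds p₀, ‖p.2.2‖ < R :=
      (Continuous.tendsto (by fun_prop) p₀).eventually_lt_const (by simp [R]; grind)
    filter_upwards [h1, h2] with p hp1 hp2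
    refine Filter.Eventually.of_forall fun v => ?_
    rw [Real.norm_of_nonneg (segmentSlope_nonneg L v _ _)]
    exact h p.1 v _ _ hp1.le hp2.le
  · refine Filter.Eventually.of_forall fun v => Continuous.continuousAt ?_
    refine (hb.continuous_segmentSlope L v).comp
      (f := fun p : ℝ × E × E => (fieldFlow b p.1 v p.2.1, fieldFlow b p.1 v p.2.2))
      (Continuous.prodMk ?_ ?_)
    · exact hflow.comp (by fun_prop : Continuous fun p : ℝ × E × E => (p.1, v, p.2.1))
    · exact hflow.comp (by fun_prop : Continuous fun p : ℝ × E × E => (p.1, v, p.2.2))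
  · constructor
    · linarith [min_le_left u p₀.1]
    · linarith [le_max_left u p₀.1]
  · constructor
    · linarith [min_le_right u p₀.1]
    · linarith [le_max_right u p₀.1]

theorem integrable_flow_fieldSlope (r : ℝ) (x : E) :
    Integrable fun v => fieldSlope L b v (fieldFlow b r v x) := by
  simpa only [segmentSlope_self] using integrable_flow_segmentSlope L hb hE r x x

theorem continuous_integral_fieldSlope (u : ℝ) : Continuous fun p : ℝ × E =>
    ∫ v in p.1..u, fieldSlope L b v (fieldFlow b p.1 v p.2) := by
  have := (continuous_integral_segmentSlope L hb hE u).comp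
    (by fun_prop : Continuous fun p : ℝ × E => (p.1, p.2, p.2))
  simpa only [Function.comp_def, segmentSlope_self] using this

end oneflow

/-- The distance between two flows is controlled by the difference of the fields along the first
flow, amplified by the second one. -/
theorem norm_fieldFlow_sub_fieldFlow_le {c : ℝ → E → E} (hb : IsGaussianField b)
    (hbE : ∀ s x, ∃ X, IsSol b s x X) (hc : IsGaussianField c)
    (hcE : ∀ s x, ∃ X, IsSol c s x X) {s u : ℝ} (hsu : s ≤ u) (x : E) :
    ‖L (fieldFlow b s u x - fieldFlow c s u x)‖ ≤ ∫ v in s..u,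
      Real.exp (∫ τ in v..u, fieldSlope L c τ (fieldFlow c v τ (fieldFlow b s v x))) *
        ‖L (b v (fieldFlow b s v x) - c v (fieldFlow b s v x))‖ := by
  set z : ℝ → E := fun v => fieldFlow b s v x with hz
  have hzsol : IsSol b s x z := isSol_fieldFlow hbE s x
  have hzc : Continuous z := hzsol.continuous
  set D : ℝ → ℝ := fun v => ‖L (b v (z v) - c v (z v))‖ with hD
  set Ψ : ℝ × E × E → ℝ := fun p => Real.exp
    (∫ v in p.1..u, segmentSlope L c v (fieldFlow c p.1 v p.2.1) (fieldFlow c p.1 v p.2.2)) with hΨ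
  have hΨc : Continuous Ψ := Real.continuous_exp.comp (continuous_integral_segmentSlope L hc hcE u)
  set Λ : ℝ → ℝ := fun v => Ψ (v, z v, z v) with hΛ
  have hΛc : Continuous Λ := hΨc.comp (by fun_prop)
  have hΛeq : ∀ v, Real.exp (∫ τ in v..u, fieldSlope L c τ (fieldFlow c v τ (z v))) = Λ v := fun v => by
    simp only [hΛ, hΨ, segmentSlope_self]
  have hgoal : (∫ v in s..u,
      Real.exp (∫ τ in v..u, fieldSlope L c τ (fieldFlow c v τ (fieldFlow b s v x))) *
        ‖L (b v (fieldFlow b s v x) - c v (fieldFlow b s v x))‖) = ∫ v in s..u, Λ v * D v :=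
    intervalIntegral.integral_congr fun v _ => congrArg (· * D v) (hΛeq v)
  rw [hgoal]
  obtain ⟨R, -, hR0, hR⟩ := exists_norm_fieldFlow_le hb hbE ‖x‖
  have hzR : ∀ v, ‖z v‖ ≤ R := fun v => (hR s v x).1 le_rfl
  obtain ⟨R', hRR', -, hR'⟩ := exists_norm_fieldFlow_le hc hcE R
  obtain ⟨g, hg, hg0, hgc⟩ := hc.exists_bound R'
  have hbi : Integrable fun v => b v (z v) := hb.integrable_comp hzc hzR
  have hci : Integrable fun v => c v (z v) := hc.integrable_comp hzc hzR
  have hDi : Integrable D := ((L : E →L[ℝ] F).integrable_comp (hbi.sub hci)).norm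
  have hD0 : ∀ v, 0 ≤ D v := fun v => norm_nonneg _
  have hΛD : ∀ p q, IntervalIntegrable (fun v => Λ v * D v) volume p q := fun p q =>
    hDi.intervalIntegrable.continuousOn_mul hΛc.continuousOn
  -- The interpolation between the flows: follow `b` up to time `θ`, then `c` up to time `u`.
  set Y : ℝ → E := fun θ => fieldFlow c θ u (z θ) with hY
  have hYc : Continuous Y := (continuous_fieldFlow hc hcE).comp
    (by fun_prop : Continuous fun θ : ℝ => (θ, u, z θ))
  have hYs : Y s = fieldFlow c s u x := by simp only [hY, hz, fieldFlow_of_le hbE le_rfl]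
  have hYu : Y u = fieldFlow b s u x := by simp only [hY, hz, fieldFlow_of_le hcE le_rfl]
  have main := sub_le_sub_of_eventually_right (f := fun θ => ‖L (Y θ - Y s)‖)
    (Φ := fun θ => ∫ v in s..θ, Λ v * D v)
    (G := fun θ => (∫ v in s..θ, D v) + ∫ v in s..θ, g v) hsu
    (by fun_prop) (intervalIntegral.continuous_primitive hΛD s).continuousOn
    ((continuous_integral_primitive hDi s).add
      (continuous_integral_primitive hg s)).continuousOn ?_
  · simpa [hYs, hYu] using main
  intro ε hε θ hθ
  set η := min (ε / 2) 1 with hη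
  have hη0 : 0 < η := by positivity
  have hΛpos : 0 < Λ θ := Real.exp_pos _
  -- Chosen so that the drift between `z` and `w`, after applying `L` and amplifying by `Λ θ + η`,
  -- costs at most `ε ∫ g`. The choice `η ≤ ε / 2` pays for replacing `Λ θ + η` by `Λ v`.
  set η' := ε / ((‖(L : E →L[ℝ] F)‖ + 1) * (Λ θ + 1)) with hη'
  have hη'0 : 0 < η' := by positivity
  set w : ℝ → E := fun v => fieldFlow c θ v (z θ) with hw
  have hwsol : IsSol c θ (z θ) w := isSol_fieldFlow hcE θ (z θ)
  have hwc : Continuous w := hwsol.continuous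
  have hwθ : w θ = z θ := hwsol.init
  have ev1 : ∀ᶠ v in nhds θ, Ψ (v, z v, w v) < Λ θ + η := by
    have h1 : Continuous fun v => Ψ (v, z v, w v) := hΨc.comp (by fun_prop)
    refine (h1.tendsto θ).eventually_lt_const ?_
    rw [hwθ]; simp only [hΛ]; linarith
  have ev2 : ∀ᶠ v in nhds θ, Λ θ - η < Λ v :=
    (hΛc.tendsto θ).eventually_const_lt (by linarith)
  have ev3 : ∀ᶠ v in nhds θ, ‖z v - w v‖ < η' := by
    refine ((hzc.sub hwc).norm.tendsto θ).eventually_lt_const ?_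
    simpa [hwθ] using hη'0
  obtain ⟨d, hd, hev⟩ := Metric.eventually_nhds_iff.1 (ev1.and (ev2.and ev3))
  have hev' : ∀ᶠ y in nhdsWithin θ (Ioi θ), y ∈ Ioo θ (min (θ + d) u) :=
    Ioo_mem_nhdsGT (by rw [lt_min_iff]; exact ⟨by linarith, hθ.2⟩)
  filter_upwards [hev'] with y hy
  have hθy : θ ≤ y := hy.1.le
  have hyu : y ≤ u := (hy.2.trans_le (min_le_right _ _)).le
  have hnear : ∀ v ∈ Icc θ y, Ψ (v, z v, w v) < Λ θ + η ∧ Λ θ - η < Λ v ∧ ‖z v - w v‖ < η' := by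
    intro v hv
    apply hev
    rw [Real.dist_eq, abs_of_nonneg (by linarith [hv.1])]
    linarith [hv.2, hy.2.trans_le (min_le_left _ _)]
  -- Both `Y θ` and `Y y` are now values of the flow of `c` from time `y`, started at `w y` and `z
  -- y`. These points differ by the integral of `b - c` along `z`, plus a term that is small because
  -- `z` and `w` leave the same point.
  have hYθ : Y θ = fieldFlow c y u (w y) := (fieldFlow_fieldFlow hc hcE hθy hyu (z θ)).symm
  have hsolz := hzsol.restart hb hθ.1
  have hIz := hb.intervalIntegrable hzc θ y
  have hIc := hc.intervalIntegrable hzc θ y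
  have hIw := hc.intervalIntegrable hwc θ y
  have hdiff : z y - w y = (∫ v in θ..y, (b v (z v) - c v (z v)))
      + ∫ v in θ..y, (c v (z v) - c v (w v)) := by
    rw [intervalIntegral.integral_sub hIz hIc, intervalIntegral.integral_sub hIc hIw,
      hsolz.eq y hθy, hwsol.eq y hθy]
    abel
  have hCF : CompleteSpace F := by
    have : FiniteDimensional ℝ F := L.toLinearEquiv.finiteDimensional
    exact FiniteDimensional.complete ℝ F
  have hL1 : ‖L (∫ v in θ..y, (b v (z v) - c v (z v)))‖ ≤ ∫ v in θ..y, D v := by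
    have e := (L : E →L[ℝ] F).intervalIntegral_comp_comm (hIz.sub hIc)
    simp only [ContinuousLinearEquiv.coe_coe] at e
    rw [← e]
    exact intervalIntegral.norm_integral_le_of_norm_le hθy
      (Filter.Eventually.of_forall fun v _ => le_rfl) hDi.intervalIntegrable
  have hL2 : ‖L (∫ v in θ..y, (c v (z v) - c v (w v)))‖
      ≤ ‖(L : E →L[ℝ] F)‖ * (η' * ∫ v in θ..y, g v) := by
    refine ((L : E →L[ℝ] F).le_opNorm _).trans (mul_le_mul_of_nonneg_left ?_ (norm_nonneg _))
    rw [mul_comm, ← intervalIntegral.integral_mul_const]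
    refine intervalIntegral.norm_integral_le_of_norm_le hθy
      (Filter.Eventually.of_forall fun v hv => ?_) (hg.mul_const _).intervalIntegrable
    refine (hc.lipschitz hgc v ((hzR v).trans hRR') ((hR' θ v (z θ)).1 (hzR θ))).trans ?_
    exact mul_le_mul_of_nonneg_left (hnear v ⟨hv.1.le, hv.2⟩).2.2.le (hg0 v)
  have hg0' : 0 ≤ ∫ v in θ..y, g v := intervalIntegral.integral_nonneg hθy fun v _ => hg0 v
  have hD0' : 0 ≤ ∫ v in θ..y, D v := intervalIntegral.integral_nonneg hθy fun v _ => hD0 v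
  have hL3 : ‖L (z y - w y)‖ ≤ (∫ v in θ..y, D v) + ‖(L : E →L[ℝ] F)‖ * (η' * ∫ v in θ..y, g v) := by
    rw [hdiff, map_add]
    exact (norm_add_le _ _).trans (add_le_add hL1 hL2)
  have hstep : ‖L (Y y - Y θ)‖ ≤ ‖L (z y - w y)‖ * (Λ θ + η) := by
    rw [hYθ, ← norm_neg, ← map_neg, neg_sub]
    refine (norm_fieldFlow_sub_le_exp L hc hcE hyu (z y) (w y)).trans ?_
    rw [← norm_neg (L (w y - z y)), ← map_neg, neg_sub]
    exact mul_le_mul_of_nonneg_left (hnear y ⟨hθy, le_rfl⟩).1.le (norm_nonneg _)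
  have hΛint : (∫ v in θ..y, D v) * (Λ θ - η) ≤ ∫ v in θ..y, Λ v * D v := by
    rw [← intervalIntegral.integral_mul_const]
    refine intervalIntegral.integral_mono_on hθy (hDi.mul_const _).intervalIntegrable
      (hΛD _ _) fun v hv => ?_
    rw [mul_comm]
    exact mul_le_mul_of_nonneg_right (hnear v hv).2.1.le (hD0 v)
  have hε1 : 2 * η ≤ ε := by linarith [min_le_left (ε / 2) 1]
  have hε2 : ‖(L : E →L[ℝ] F)‖ * η' * (Λ θ + η) ≤ ε := by
    have h1 : ‖(L : E →L[ℝ] F)‖ * η' * (Λ θ + η)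
        ≤ (‖(L : E →L[ℝ] F)‖ + 1) * η' * (Λ θ + 1) := by
      gcongr
      · linarith
      · exact min_le_right _ _
    refine h1.trans (le_of_eq ?_)
    rw [hη']
    field_simp
  have hf : ‖L (Y y - Y s)‖ - ‖L (Y θ - Y s)‖ ≤ ‖L (Y y - Y θ)‖ := by
    have e : L (Y y - Y s) - L (Y θ - Y s) = L (Y y - Y θ) := by
      rw [← map_sub]; congr 1; abel
    rw [← e]
    exact norm_sub_norm_le _ _
  have hΦ : (∫ v in s..y, Λ v * D v) - ∫ v in s..θ, Λ v * D v = ∫ v in θ..y, Λ v * D v :=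
    intervalIntegral.integral_interval_sub_left (hΛD _ _) (hΛD _ _)
  have hG1 := intervalIntegral_sub_eq hDi s θ y
  have hG2 := intervalIntegral_sub_eq hg s θ y
  rw [hΦ]
  have hGG : (∫ v in s..y, D v) + (∫ v in s..y, g v) - ((∫ v in s..θ, D v) + ∫ v in s..θ, g v)
      = (∫ v in θ..y, D v) + ∫ v in θ..y, g v := by linarith
  rw [hGG]
  set ID := ∫ v in θ..y, D v
  set Ig := ∫ v in θ..y, g v
  have h1 : ‖L (z y - w y)‖ * (Λ θ + η)
      ≤ (ID + ‖(L : E →L[ℝ] F)‖ * (η' * Ig)) * (Λ θ + η) :=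
    mul_le_mul_of_nonneg_right hL3 (by positivity)
  have h2 := mul_le_mul_of_nonneg_right hε2 hg0'
  have h3 := mul_le_mul_of_nonneg_right hε1 hD0'
  nlinarith

/-- Both integrands are nonnegative, so both integrals may be extended up to `t`. The bound then no
longer depends on `u` and passes to the supremum. -/
theorem norm_fieldFlow_sub_fieldFlow_le_of_le {c : ℝ → E → E} (hb : IsGaussianField b)
    (hbE : ∀ s x, ∃ X, IsSol b s x X) (hc : IsGaussianField c)
    (hcE : ∀ s x, ∃ X, IsSol c s x X) {s u t : ℝ} (hsu : s ≤ u) (hut : u ≤ t) (x : E) :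
    ‖L (fieldFlow b s u x - fieldFlow c s u x)‖ ≤ ∫ v in s..t,
      Real.exp (∫ τ in v..t, fieldSlope L c τ (fieldFlow c v τ (fieldFlow b s v x))) *
        ‖L (b v (fieldFlow b s v x) - c v (fieldFlow b s v x))‖ := by
  have hzc : Continuous fun v => fieldFlow b s v x := (isSol_fieldFlow hbE s x).continuous
  obtain ⟨R, -, hR0, hR⟩ := exists_norm_fieldFlow_le hb hbE ‖x‖
  have hzR : ∀ v, ‖fieldFlow b s v x‖ ≤ R := fun v => (hR s v x).1 le_rfl
  have hDi : Integrable fun v => ‖L (b v (fieldFlow b s v x) - c v (fieldFlow b s v x))‖ :=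
    ((L : E →L[ℝ] F).integrable_comp
      ((hb.integrable_comp hzc hzR).sub (hc.integrable_comp hzc hzR))).norm
  have hcont : ∀ u, Continuous fun v =>
      Real.exp (∫ τ in v..u, fieldSlope L c τ (fieldFlow c v τ (fieldFlow b s v x))) := fun u =>
    Real.continuous_exp.comp ((continuous_integral_fieldSlope L hc hcE u).comp
      (by fun_prop : Continuous fun v : ℝ => (v, fieldFlow b s v x)))
  have hI : ∀ u p q, IntervalIntegrable (fun v =>
      Real.exp (∫ τ in v..u, fieldSlope L c τ (fieldFlow c v τ (fieldFlow b s v x))) *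
        ‖L (b v (fieldFlow b s v x) - c v (fieldFlow b s v x))‖) volume p q := fun u p q =>
    hDi.intervalIntegrable.continuousOn_mul (hcont u).continuousOn
  refine (norm_fieldFlow_sub_fieldFlow_le L hb hbE hc hcE hsu x).trans ?_
  refine (intervalIntegral.integral_mono_on hsu (hI u s u) (hI t s u) fun v hv => ?_).trans ?_
  · refine mul_le_mul_of_nonneg_right (Real.exp_le_exp.2 ?_) (norm_nonneg _)
    exact intervalIntegral.integral_mono_interval le_rfl hv.2 hut
      (Filter.Eventually.of_forall fun τ => fieldSlope_nonneg L τ _)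
      (integrable_flow_fieldSlope L hc hcE _ _).intervalIntegrable
  · exact intervalIntegral.integral_mono_interval le_rfl hsu hut
      (Filter.Eventually.of_forall fun v => by positivity) (hI t s t)
end

/-! ### The moment estimate -/

/-- Jensen's inequality for the exponential, without integrability of the exponential. -/
theorem ofReal_exp_integral_le {h : ℝ → ℝ} {s t c ε : ℝ} (hst : s < t) (hh : Integrable h)
    (h0 : ∀ v, 0 ≤ h v) (hc : (t - s) * c ≤ ε) :
    ENNReal.ofReal (Real.exp (c * ∫ v in s..t, h v)) ≤ ENNReal.ofReal (1 / (t - s)) *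
      ∫⁻ v in Icc s t, ENNReal.ofReal (Real.exp (ε * h v)) := by
  have hd : 0 < t - s := sub_pos.2 hst
  have hmono : ∫⁻ v in Icc s t, ENNReal.ofReal (Real.exp ((t - s) * c * h v))
      ≤ ∫⁻ v in Icc s t, ENNReal.ofReal (Real.exp (ε * h v)) :=
    lintegral_mono fun v => ENNReal.ofReal_le_ofReal
      (Real.exp_le_exp.2 (mul_le_mul_of_nonneg_right hc (h0 v)))
  refine le_trans ?_ (mul_le_mul_right hmono _)
  set Y : ℝ → ℝ := fun v => (t - s) * c * h v with hY
  have hYi : IntegrableOn Y (Icc s t) := (hh.const_mul _).integrableOn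
  set m := c * ∫ v in s..t, h v with hm
  have hYint : ∫ v in Icc s t, Y v = (t - s) * m := by
    rw [hY, integral_const_mul, hm, intervalIntegral.integral_of_le hst.le, integral_Icc_eq_integral_Ioc]
    ring
  have hpos : (0 : ℝ) < 1 / (t - s) := by positivity
  by_cases hfin : ∫⁻ v in Icc s t, ENNReal.ofReal (Real.exp (Y v)) = ∞
  · rw [hfin, ENNReal.mul_top (by simpa using hd)]
    exact le_top
  have hmeas : AEStronglyMeasurable (fun v => Real.exp (Y v)) (volume.restrict (Icc s t)) :=
    Real.continuous_exp.comp_aestronglyMeasurable hYi.aestronglyMeasurable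
  have hei : Integrable (fun v => Real.exp (Y v)) (volume.restrict (Icc s t)) :=
    (lintegral_ofReal_ne_top_iff_integrable hmeas
      (Filter.Eventually.of_forall fun v => (Real.exp_pos _).le)).1 hfin
  rw [← ofReal_integral_eq_lintegral_ofReal hei
    (Filter.Eventually.of_forall fun v => (Real.exp_pos _).le), ← ENNReal.ofReal_mul hpos.le]
  refine ENNReal.ofReal_le_ofReal ?_
  have hconst : ∀ a : ℝ, ∫ _ in Icc s t, a = (t - s) * a := fun a => by
    rw [setIntegral_const, Measure.real, Real.volume_Icc, ENNReal.toReal_ofReal hd.le, smul_eq_mul]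
  have hci : ∀ a : ℝ, Integrable (fun _ : ℝ => a) (volume.restrict (Icc s t)) := fun a =>
    integrable_const a
  -- Jensen's inequality by the tangent line of `exp` at `m`, the mean of `Y` over `[s, t]`.
  have h1 : ∫ v in Icc s t, Real.exp m * (1 + (Y v - m)) ≤ ∫ v in Icc s t, Real.exp (Y v) := by
    refine integral_mono (((hci 1).add (hYi.sub (hci m))).const_mul _) hei fun v => ?_
    have h2 := Real.add_one_le_exp (Y v - m)
    have h3 : Real.exp (Y v) = Real.exp m * Real.exp (Y v - m) := by
      rw [← Real.exp_add]; congr 1; ring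
    rw [h3]
    exact mul_le_mul_of_nonneg_left (by linarith) (Real.exp_pos _).le
  have h4 : ∫ v in Icc s t, Real.exp m * (1 + (Y v - m)) = (t - s) * Real.exp m := by
    rw [integral_const_mul, integral_add (g := fun v => Y v - m) (hci 1) (hYi.sub (hci m)),
      integral_sub hYi (hci m),
      hYint, hconst, hconst]
    ring
  rw [h4] at h1
  have h5 : Real.exp m = 1 / (t - s) * ((t - s) * Real.exp m) := by field_simp
  rw [h5]
  exact mul_le_mul_of_nonneg_left h1 hpos.le

section
variable {E : Type*} [NormedAddCommGroup E] [InnerProductSpace ℝ E] [FiniteDimensional ℝ E]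
  [MeasurableSpace E] [BorelSpace E] {F : Type*} [NormedAddCommGroup F] [NormedSpace ℝ F]
  (L : E ≃L[ℝ] F) {b c : ℝ → E → E}

/-- Space-time integrals are invariant under a measure preserving flow. -/
theorem lintegral_comp_fieldFlow (hb : IsGaussianField b) (hbE : ∀ s x, ∃ X, IsSol b s x X)
    (γ : Measure E) [SFinite γ] (hγ : ∀ r v, γ.map (fieldFlow b r v) = γ) (I : Set ℝ)
    (s : ℝ) {f : ℝ × E → ℝ≥0∞} (hf : Measurable f) :
    ∫⁻ x, ∫⁻ v in I, f (v, fieldFlow b s v x) ∂volume ∂γ = ∫⁻ v in I, ∫⁻ x, f (v, x) ∂γ := by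
  have hz : Measurable fun p : E × ℝ => (p.2, fieldFlow b s p.2 p.1) :=
    measurable_snd.prodMk ((continuous_fieldFlow hb hbE).comp
      (by fun_prop : Continuous fun p : E × ℝ => (s, p.2, p.1))).measurable
  rw [lintegral_lintegral_swap (f := fun x v => f (v, fieldFlow b s v x))
    (hf.comp hz).aemeasurable]
  refine lintegral_congr fun v => ?_
  conv_rhs => rw [← hγ s v]
  have hm : Measurable fun x : E => f (v, x) := hf.comp (by fun_prop)
  rw [lintegral_map hm (continuous_fieldFlow_right hb hbE s v).measurable]

/-- Hölder's inequality on the product of `γ` and Lebesgue measure splits the pathwise bound.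
Invariance under the flow of `b` then replaces `fieldFlow b s v x` by `x` in both factors, so that
only the flow of `c` remains, in the exponential. -/
theorem lintegral_fieldFlow_sub_fieldFlow_le (hb : IsGaussianField b)
    (hbE : ∀ s x, ∃ X, IsSol b s x X) (hc : IsGaussianField c)
    (hcE : ∀ s x, ∃ X, IsSol c s x X) (γ : Measure E) [SFinite γ]
    (hγb : ∀ r v, γ.map (fieldFlow b r v) = γ) (hγc : ∀ r v, γ.map (fieldFlow c r v) = γ)
    {p q ε s t : ℝ} (hpq : p.HolderConjugate q) (hst : s < t) (hε : (t - s) * q ≤ ε) :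
    ∫⁻ x, ⨆ u ∈ Icc s t, ‖L (fieldFlow b s u x - fieldFlow c s u x)‖ₑ ∂γ
      ≤ (∫⁻ x, ∫⁻ r in Icc s t, ‖L (b r x - c r x)‖ₑ ^ p ∂volume ∂γ) ^ (1 / p)
        * (∫⁻ x, ∫⁻ r in Icc s t,
          ENNReal.ofReal (Real.exp (ε * fieldSlope L c r x)) ∂volume ∂γ) ^ (1 / q) := by
  set A : ℝ × E → ℝ := fun y => Real.exp
    (∫ τ in y.1..t, fieldSlope L c τ (fieldFlow c y.1 τ y.2)) with hA
  have hAc : Continuous A := Real.continuous_exp.comp (continuous_integral_fieldSlope L hc hcE t)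
  set D : ℝ × E → ℝ≥0∞ := fun y => ‖L (b y.1 y.2 - c y.1 y.2)‖ₑ with hD
  have hDm : Measurable D := by
    have h1 : Measurable fun y : ℝ × E => b y.1 y.2 - c y.1 y.2 :=
      hb.measurable_uncurry.sub hc.measurable_uncurry
    have h2 : Continuous fun x : E => ‖L x‖ₑ := L.continuous.enorm
    exact h2.measurable.comp h1
  have hAm : Measurable fun y => ENNReal.ofReal (A y) := hAc.measurable.ennreal_ofReal
  have hz : Measurable fun y : E × ℝ => (y.2, fieldFlow b s y.2 y.1) :=
    measurable_snd.prodMk ((continuous_fieldFlow hb hbE).comp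
      (by fun_prop : Continuous fun y : E × ℝ => (s, y.2, y.1))).measurable
  have hpath : ∀ x, (⨆ u ∈ Icc s t, ‖L (fieldFlow b s u x - fieldFlow c s u x)‖ₑ)
      ≤ ∫⁻ v in Icc s t, ENNReal.ofReal (A (v, fieldFlow b s v x)) * D (v, fieldFlow b s v x) := by
    intro x
    have hzc : Continuous fun v => fieldFlow b s v x := (isSol_fieldFlow hbE s x).continuous
    obtain ⟨R, -, hR0, hR⟩ := exists_norm_fieldFlow_le hb hbE ‖x‖
    have hzR : ∀ v, ‖fieldFlow b s v x‖ ≤ R := fun v => (hR s v x).1 le_rfl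
    have hDi : Integrable fun v => ‖L (b v (fieldFlow b s v x) - c v (fieldFlow b s v x))‖ :=
      ((L : E →L[ℝ] F).integrable_comp
        ((hb.integrable_comp hzc hzR).sub (hc.integrable_comp hzc hzR))).norm
    have hi : IntegrableOn (fun v => A (v, fieldFlow b s v x) *
        ‖L (b v (fieldFlow b s v x) - c v (fieldFlow b s v x))‖) (Icc s t) :=
      hDi.integrableOn.continuousOn_mul
        (hAc.comp (by fun_prop : Continuous fun v => (v, fieldFlow b s v x))).continuousOn
        isCompact_Icc
    refine iSup₂_le fun u hu => ?_
    have h1 := norm_fieldFlow_sub_fieldFlow_le_of_le L hb hbE hc hcE hu.1 hu.2 x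
    rw [intervalIntegral.integral_of_le hst.le, ← integral_Icc_eq_integral_Ioc] at h1
    rw [← ofReal_norm]
    refine (ENNReal.ofReal_le_ofReal h1).trans ?_
    rw [ofReal_integral_eq_lintegral_ofReal hi
      (Filter.Eventually.of_forall fun v => mul_nonneg (Real.exp_pos _).le (norm_nonneg _))]
    refine le_of_eq (lintegral_congr fun v => ?_)
    rw [ENNReal.ofReal_mul (Real.exp_pos _).le, ofReal_norm]
  refine (lintegral_mono hpath).trans ?_
  rw [← lintegral_prod (μ := γ) (ν := volume.restrict (Icc s t)) (f := fun y : E × ℝ =>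
    ENNReal.ofReal (A (y.2, fieldFlow b s y.2 y.1)) * D (y.2, fieldFlow b s y.2 y.1))
    ((hAm.comp hz).mul (hDm.comp hz)).aemeasurable]
  have hH := ENNReal.lintegral_mul_le_Lp_mul_Lq (γ.prod (volume.restrict (Icc s t))) hpq
    (hDm.comp hz).aemeasurable (hAm.comp hz).aemeasurable
  have hcomm : (fun y : E × ℝ => ENNReal.ofReal (A (y.2, fieldFlow b s y.2 y.1)) *
      D (y.2, fieldFlow b s y.2 y.1))
      = (D ∘ fun y : E × ℝ => (y.2, fieldFlow b s y.2 y.1)) *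
        ((fun y => ENNReal.ofReal (A y)) ∘ fun y : E × ℝ => (y.2, fieldFlow b s y.2 y.1)) := by
    ext y
    exact mul_comm _ _
  rw [hcomm]
  refine hH.trans (mul_le_mul' (ENNReal.rpow_le_rpow (le_of_eq ?_) (one_div_nonneg.2 hpq.nonneg))
    (ENNReal.rpow_le_rpow ?_ (one_div_nonneg.2 hpq.symm.nonneg)))
  · rw [lintegral_prod _ ((hDm.comp hz).pow_const p).aemeasurable,
      lintegral_lintegral_swap (f := fun x r => ‖L (b r x - c r x)‖ₑ ^ p)
        ((hDm.pow_const p).comp measurable_swap).aemeasurable]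
    exact lintegral_comp_fieldFlow hb hbE γ hγb (Icc s t) s (hDm.pow_const p)
  · rw [lintegral_prod _ ((hAm.comp hz).pow_const q).aemeasurable]
    refine (lintegral_comp_fieldFlow hb hbE γ hγb (Icc s t) s (hAm.pow_const q)).trans_le ?_
    set G : ℝ × E → ℝ≥0∞ := fun y => ENNReal.ofReal (Real.exp (ε * fieldSlope L c y.1 y.2)) with hG
    have hGm : Measurable G :=
      (Real.measurable_exp.comp ((hc.measurable_fieldSlope L).const_mul ε)).ennreal_ofReal
    have hswap : ∫⁻ x, ∫⁻ r in Icc s t, G (r, x) ∂volume ∂γ = ∫⁻ r in Icc s t, ∫⁻ x, G (r, x) ∂γ :=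
      lintegral_lintegral_swap (f := fun x r => G (r, x)) (hGm.comp measurable_swap).aemeasurable
    change _ ≤ ∫⁻ x, ∫⁻ r in Icc s t, G (r, x) ∂volume ∂γ
    -- Jensen is applied on all of `[s, t]` rather than on `[v, t]`, so that the constant does not
    -- depend on `v`. At times before `v` the flow started at `v` is the identity, which also
    -- preserves `γ`.
    have hJ : ∀ v ∈ Icc s t, ∫⁻ x, ENNReal.ofReal (A (v, x)) ^ q ∂γ
        ≤ ENNReal.ofReal (1 / (t - s)) * ∫⁻ x, ∫⁻ r in Icc s t, G (r, x) ∂volume ∂γ := by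
      intro v hv
      rw [hswap, ← lintegral_comp_fieldFlow hc hcE γ hγc (Icc s t) v hGm]
      rw [← lintegral_const_mul' _ _ ENNReal.ofReal_ne_top]
      refine lintegral_mono fun x => ?_
      have hi := integrable_flow_fieldSlope L hc hcE v x
      refine le_trans ?_ (ofReal_exp_integral_le hst hi (fun τ => fieldSlope_nonneg L τ _) hε)
      rw [ENNReal.ofReal_rpow_of_nonneg (Real.exp_pos _).le hpq.symm.nonneg, ← Real.exp_mul]
      refine ENNReal.ofReal_le_ofReal (Real.exp_le_exp.2 ?_)
      rw [mul_comm]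
      refine mul_le_mul_of_nonneg_left ?_ hpq.symm.nonneg
      exact intervalIntegral.integral_mono_interval hv.1 hv.2 le_rfl
        (Filter.Eventually.of_forall fun τ => fieldSlope_nonneg L τ _) hi.intervalIntegrable
    -- Integrating the uniform bound over `v` gives a factor `t - s`, which cancels the one from
    -- Jensen.
    refine (setLIntegral_mono' measurableSet_Icc hJ).trans ?_
    rw [setLIntegral_const, Real.volume_Icc, mul_right_comm, ← ENNReal.ofReal_mul (by
      have := sub_pos.2 hst; positivity), one_div_mul_cancel (sub_pos.2 hst).ne',
      ENNReal.ofReal_one, one_mul]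
end

/-! ### The Gaussian divergence field of a skew-symmetric matrix field -/

/-- A function that is measurable in time for each point of space and continuous in space can be
made measurable in time by discarding a null set of times independent of the point. -/
theorem exists_indicator_measurable {E F : Type*} [TopologicalSpace E] [Nonempty E]
    [TopologicalSpace.SeparableSpace E] [FirstCountableTopology E]
    [TopologicalSpace F] [TopologicalSpace.PseudoMetrizableSpace F] [Zero F]
    [MeasurableSpace F] [BorelSpace F] {f : ℝ → E → F} {I : Set ℝ} (hI : MeasurableSet I)
    (hc : ∀ r ∈ I, Continuous (f r))
    (hm : ∀ x, AEMeasurable (fun r => f r x) (volume.restrict I)) :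
    ∃ A ⊆ I, (∀ᵐ r ∂volume.restrict I, r ∈ A) ∧
      ∀ x, Measurable (A.indicator fun r => f r x) := by
  set d : ℕ → E := TopologicalSpace.denseSeq E
  have hae : ∀ᵐ r ∂volume.restrict I, r ∈ I ∧ ∀ k, f r (d k) = (hm (d k)).mk _ r :=
    (ae_restrict_mem hI).and (ae_all_iff.2 fun k => (hm (d k)).ae_eq_mk)
  obtain ⟨A, hA, hAm, hAn⟩ := hae.exists_measurable_mem
  refine ⟨A, fun r hr => (hAn r hr).1, hA, fun x => ?_⟩
  have hd : ∀ k, Measurable (A.indicator fun r => f r (d k)) := fun k => by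
    have : (A.indicator fun r => f r (d k)) = A.indicator ((hm (d k)).mk _) :=
      indicator_congr fun r hr => (hAn r hr).2 k
    rw [this]
    exact (hm (d k)).measurable_mk.indicator hAm
  obtain ⟨y, hy, hyx⟩ := mem_closure_iff_seq_limit.1 (TopologicalSpace.denseRange_denseSeq E x)
  choose k hk using hy
  refine measurable_of_tendsto_metrizable (f := fun (n : ℕ) => A.indicator fun r => f r (y n))
    (fun n => by rw [← hk n]; exact hd _) ?_
  rw [tendsto_pi_nhds]
  intro r
  by_cases hr : r ∈ A
  · simp only [indicator_of_mem hr]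
    exact ((hc r (hAn r hr).1).tendsto x).comp hyx
  · simp only [indicator_of_notMem hr]
    exact tendsto_const_nhds

section
variable {E : Type*} [NormedAddCommGroup E] [InnerProductSpace ℝ E] [FiniteDimensional ℝ E]
  [MeasurableSpace E] [BorelSpace E] {κ : Type*} [Fintype κ] (ε : OrthonormalBasis κ ℝ E)
  (f : κ → κ → E → ℝ)

/-- The vector field whose components are the Gaussian divergences of the rows of a matrix field. -/
noncomputable def divField (x : E) : E :=
  ∑ i, ∑ j, (f i j x * inner ℝ (ε j) x - fderiv ℝ (f i j) x (ε j)) • ε i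

/-- The derivative of `divField`. -/
noncomputable def divFieldDeriv (x : E) : E →L[ℝ] E :=
  ∑ i, ∑ j, (f i j x • innerSL ℝ (ε j) + (inner ℝ (ε j) x : ℝ) • fderiv ℝ (f i j) x
    - (fderiv ℝ (fderiv ℝ (f i j)) x).flip (ε j)).smulRight (ε i)

variable {f} (hf : ∀ i j, ContDiff ℝ 2 (f i j))
include hf

theorem contDiff_divField : ContDiff ℝ 1 (divField ε f) := by
  unfold divField
  refine ContDiff.sum fun i _ => ContDiff.sum fun j _ => ContDiff.smul ?_ contDiff_const
  refine (((hf i j).of_le one_le_two).mul (contDiff_const.inner ℝ contDiff_id)).sub ?_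
  exact ((hf i j).fderiv_right (m := 1) (by norm_num)).clm_apply contDiff_const

theorem hasFDerivAt_divField (x : E) : HasFDerivAt (divField ε f) (divFieldDeriv ε f x) x := by
  unfold divField divFieldDeriv
  refine HasFDerivAt.fun_sum fun i _ => HasFDerivAt.fun_sum fun j _ => HasFDerivAt.smul_const ?_ _
  have h1 : HasFDerivAt (f i j) (fderiv ℝ (f i j) x) x :=
    ((hf i j).differentiable two_ne_zero x).hasFDerivAt
  have h2 : HasFDerivAt (fderiv ℝ (f i j)) (fderiv ℝ (fderiv ℝ (f i j)) x) x :=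
    (((hf i j).fderiv_right (m := 1) (by norm_num)).differentiable one_ne_zero x).hasFDerivAt
  refine (h1.mul (innerSL ℝ (ε j)).hasFDerivAt).sub ?_
  have h3 := ((ContinuousLinearMap.apply ℝ ℝ (ε j)).hasFDerivAt (x := fderiv ℝ (f i j) x)).comp x h2
  exact h3

theorem norm_divField_le {K g : κ → κ → ℝ} {ρ : ℝ} {x : E} (hx : ‖x‖ ≤ ρ)
    (hK : ∀ i j, ‖fderiv ℝ (f i j) x‖ ≤ K i j) (hg : ∀ i j, |f i j x| ≤ g i j) :
    ‖divField ε f x‖ ≤ ∑ i, ∑ j, (ρ * g i j + K i j) := by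
  refine (norm_sum_le _ _).trans (Finset.sum_le_sum fun i _ => (norm_sum_le _ _).trans
    (Finset.sum_le_sum fun j _ => ?_))
  rw [norm_smul, ε.norm_eq_one, mul_one]
  refine (norm_sub_le _ _).trans (add_le_add ?_ ?_)
  · rw [norm_mul, mul_comm]
    refine mul_le_mul ?_ (hg i j) (norm_nonneg _) ((norm_nonneg x).trans hx)
    refine (norm_inner_le_norm _ _).trans ?_
    rwa [ε.norm_eq_one, one_mul]
  · refine ((fderiv ℝ (f i j) x).le_opNorm _).trans ?_
    rw [ε.norm_eq_one, mul_one]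
    exact hK i j

theorem norm_divFieldDeriv_le {K g : κ → κ → ℝ} {ρ : ℝ} {x : E} (hx : ‖x‖ ≤ ρ)
    (hK : ∀ i j, ‖fderiv ℝ (f i j) x‖ ≤ K i j) (hg : ∀ i j, |f i j x| ≤ g i j)
    (hg2 : ∀ i j, ‖fderiv ℝ (fderiv ℝ (f i j)) x‖ ≤ g i j) :
    ‖divFieldDeriv ε f x‖ ≤ ∑ i, ∑ j, (2 * g i j + ρ * K i j) := by
  refine (norm_sum_le _ _).trans (Finset.sum_le_sum fun i _ => (norm_sum_le _ _).trans
    (Finset.sum_le_sum fun j _ => ?_))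
  rw [ContinuousLinearMap.norm_smulRight_apply, ε.norm_eq_one, mul_one]
  refine (norm_sub_le _ _).trans ?_
  have h1 : ‖f i j x • innerSL ℝ (ε j)‖ ≤ g i j := by
    rw [norm_smul, innerSL_apply_norm, ε.norm_eq_one, mul_one]
    exact hg i j
  have h2 : ‖(inner ℝ (ε j) x : ℝ) • fderiv ℝ (f i j) x‖ ≤ ρ * K i j := by
    rw [norm_smul]
    refine mul_le_mul ?_ (hK i j) (norm_nonneg _) ((norm_nonneg x).trans hx)
    refine (norm_inner_le_norm _ _).trans ?_
    rwa [ε.norm_eq_one, one_mul]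
  have h3 : ‖(fderiv ℝ (fderiv ℝ (f i j)) x).flip (ε j)‖ ≤ g i j := by
    refine ((fderiv ℝ (fderiv ℝ (f i j)) x).flip.le_opNorm _).trans ?_
    rw [ε.norm_eq_one, mul_one, ContinuousLinearMap.opNorm_flip]
    exact hg2 i j
  have h4 := norm_add_le (f i j x • innerSL ℝ (ε j)) ((inner ℝ (ε j) x : ℝ) • fderiv ℝ (f i j) x)
  linarith

variable (hskew : ∀ i j x, f i j x = - f j i x)
include hskew

theorem fderiv_skew (i j : κ) (x : E) : fderiv ℝ (f i j) x = - fderiv ℝ (f j i) x := by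
  have : f i j = fun x => - f j i x := funext (hskew i j)
  rw [this, fderiv_fun_neg]

/-- The quadratic form `∑ f i j x_i x_j` vanishes by skew-symmetry. What remains involves only first
derivatives, which are bounded in space, so the radial growth is linear. -/
theorem inner_divField (x : E) : inner ℝ (divField ε f x) x
    = - ∑ i, ∑ j, fderiv ℝ (f i j) x (ε j) * inner ℝ (ε i) x := by
  have h1 : inner ℝ (divField ε f x) x = ∑ i, ∑ j, (f i j x * inner ℝ (ε j) x * inner ℝ (ε i) x
      - fderiv ℝ (f i j) x (ε j) * inner ℝ (ε i) x) := by
    simp only [divField, sum_inner, real_inner_smul_left, sub_mul]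
  have h2 : ∑ i, ∑ j, f i j x * inner ℝ (ε j) x * inner ℝ (ε i) x = 0 := by
    have h3 : ∑ i, ∑ j, f i j x * inner ℝ (ε j) x * inner ℝ (ε i) x
        = - ∑ i, ∑ j, f i j x * inner ℝ (ε j) x * inner ℝ (ε i) x := by
      conv_lhs => rw [Finset.sum_comm]
      rw [← Finset.sum_neg_distrib]
      refine Finset.sum_congr rfl fun i _ => ?_
      rw [← Finset.sum_neg_distrib]
      refine Finset.sum_congr rfl fun j _ => ?_
      rw [hskew j i x]; ring
    linarith
  rw [h1]
  simp only [Finset.sum_sub_distrib, h2, zero_sub]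

theorem abs_inner_divField_le {K : κ → κ → ℝ} {x : E}
    (hK : ∀ i j, ‖fderiv ℝ (f i j) x‖ ≤ K i j) :
    |inner ℝ (divField ε f x) x| ≤ (∑ i, ∑ j, K i j) * ‖x‖ := by
  rw [inner_divField ε hf hskew, abs_neg, Finset.sum_mul]
  refine (Finset.abs_sum_le_sum_abs _ _).trans (Finset.sum_le_sum fun i _ => ?_)
  rw [Finset.sum_mul]
  refine (Finset.abs_sum_le_sum_abs _ _).trans (Finset.sum_le_sum fun j _ => ?_)
  rw [abs_mul]
  refine mul_le_mul ?_ ?_ (abs_nonneg _) ((norm_nonneg _).trans (hK i j))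
  · have := (fderiv ℝ (f i j) x).le_opNorm (ε j)
    rw [ε.norm_eq_one, mul_one] at this
    exact this.trans (hK i j)
  · have := abs_real_inner_le_norm (ε i) x
    rwa [ε.norm_eq_one, one_mul] at this

/-- The Gaussian divergence field of a skew-symmetric matrix field is divergence free. -/
theorem trace_divFieldDeriv (x : E) :
    LinearMap.trace ℝ E (divFieldDeriv ε f x) = inner ℝ (divField ε f x) x := by
  classical
  have h1 : LinearMap.trace ℝ E (divFieldDeriv ε f x) = ∑ i, ∑ j, (f i j x * inner ℝ (ε j) (ε i)
      + inner ℝ (ε j) x * fderiv ℝ (f i j) x (ε i)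
      - fderiv ℝ (fderiv ℝ (f i j)) x (ε i) (ε j)) := by
    rw [LinearMap.trace_eq_sum_inner _ ε]
    refine Finset.sum_congr rfl fun l _ => ?_
    simp only [divFieldDeriv, ContinuousLinearMap.coe_coe, FunLike.coe_sum,
      Finset.sum_apply, inner_sum]
    rw [Finset.sum_eq_single l]
    · refine Finset.sum_congr rfl fun j _ => ?_
      simp [real_inner_smul_right]
    · intro i _ hi
      refine Finset.sum_eq_zero fun j _ => ?_
      simp [real_inner_smul_right, ε.inner_eq_zero hi.symm]
    · simp
  have h2 : ∑ i, ∑ j, f i j x * inner ℝ (ε j) (ε i) = 0 := by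
    refine Finset.sum_eq_zero fun i _ => ?_
    rw [Finset.sum_eq_single i]
    · have := hskew i i x
      have h0 : f i i x = 0 := by linarith
      rw [h0, zero_mul]
    · intro j _ hj
      rw [ε.inner_eq_zero hj, mul_zero]
    · simp
  -- The symmetric second derivative is contracted with indices in which `f` is skew.
  have h3 : ∑ i, ∑ j, fderiv ℝ (fderiv ℝ (f i j)) x (ε i) (ε j) = 0 := by
    have h4 : ∀ i j, fderiv ℝ (fderiv ℝ (f i j)) x (ε i) (ε j)
        = - fderiv ℝ (fderiv ℝ (f j i)) x (ε j) (ε i) := by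
      intro i j
      have h5 : fderiv ℝ (f i j) = fun y => - fderiv ℝ (f j i) y :=
        funext (fderiv_skew hf hskew i j)
      have h6 : IsSymmSndFDerivAt ℝ (f j i) x :=
        (hf j i).contDiffAt.isSymmSndFDerivAt (by simp)
      rw [h5, fderiv_fun_neg]
      simp only [neg_apply]
      rw [h6.eq]
    have h7 : ∑ i, ∑ j, fderiv ℝ (fderiv ℝ (f i j)) x (ε i) (ε j)
        = - ∑ i, ∑ j, fderiv ℝ (fderiv ℝ (f i j)) x (ε i) (ε j) := by
      conv_lhs => rw [Finset.sum_comm]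
      rw [← Finset.sum_neg_distrib]
      refine Finset.sum_congr rfl fun i _ => ?_
      rw [← Finset.sum_neg_distrib]
      exact Finset.sum_congr rfl fun j _ => h4 j i
    linarith
  have h8 : ∑ i, ∑ j, inner ℝ (ε j) x * fderiv ℝ (f i j) x (ε i)
      = - ∑ i, ∑ j, fderiv ℝ (f i j) x (ε j) * inner ℝ (ε i) x := by
    rw [Finset.sum_comm, ← Finset.sum_neg_distrib]
    refine Finset.sum_congr rfl fun i _ => ?_
    rw [← Finset.sum_neg_distrib]
    refine Finset.sum_congr rfl fun j _ => ?_
    rw [fderiv_skew hf hskew j i, neg_apply]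
    ring
  rw [h1, inner_divField ε hf hskew]
  simp only [Finset.sum_sub_distrib, Finset.sum_add_distrib, h2, h3, h8]
  ring

end

section
variable {E : Type*} [NormedAddCommGroup E] [InnerProductSpace ℝ E] [FiniteDimensional ℝ E]
  [MeasurableSpace E] [BorelSpace E] {κ : Type*} [Fintype κ]

/-- The time-dependent divergence field of a Carathéodory family of skew-symmetric matrix fields is,
up to a null set of times, a field in the class `IsGaussianField`. -/
theorem exists_isGaussianField (ε : OrthonormalBasis κ ℝ E) (T : ℝ) {f : κ → κ → ℝ → E → ℝ}
    (hskew : ∀ r ∈ Icc 0 T, ∀ i j x, f i j r x = - f j i r x)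
    (hC : ∀ r ∈ Icc 0 T, ∀ i j, ContDiff ℝ 2 (f i j r))
    (hmeas : ∀ i j x, AEMeasurable (fun r => f i j r x) (volume.restrict (Icc 0 T)))
    (hK : ∀ i j, ∃ K : ℝ → ℝ, IntegrableOn K (Icc 0 T) ∧
      ∀ r ∈ Icc 0 T, ∀ x, ‖fderiv ℝ (f i j r) x‖ ≤ K r)
    (hg : ∀ i j, ∀ R : ℝ, ∃ g : ℝ → ℝ, IntegrableOn g (Icc 0 T) ∧
      ∀ r ∈ Icc 0 T, ∀ x, ‖x‖ ≤ R →
        |f i j r x| ≤ g r ∧ ‖fderiv ℝ (fderiv ℝ (f i j r)) x‖ ≤ g r) :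
    ∃ b : ℝ → E → E, IsGaussianField b ∧ (∀ r ∉ Icc 0 T, ∀ x, b r x = 0) ∧
      ∀ᵐ r ∂volume.restrict (Icc 0 T), ∀ x, b r x = divField ε (fun i j => f i j r) x := by
  have hcont : ∀ r ∈ Icc 0 T, Continuous (divField ε fun i j => f i j r) := fun r hr =>
    (contDiff_divField ε (hC r hr)).continuous
  have hm : ∀ x, AEMeasurable (fun r => divField ε (fun i j => f i j r) x)
      (volume.restrict (Icc 0 T)) := by
    intro x
    unfold divField
    refine Finset.aemeasurable_fun_sum _ fun i _ => Finset.aemeasurable_fun_sum _ fun j _ =>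
      AEMeasurable.smul_const (((hmeas i j x).mul_const _).sub ?_) _
    refine aemeasurable_of_tendsto_metrizable_ae (u := Filter.atTop)
      (f := fun (n : ℕ) r => (n : ℝ) • (f i j r (x + (n : ℝ)⁻¹ • ε j) - f i j r x))
      (fun n => ((hmeas i j (x + (n : ℝ)⁻¹ • ε j)).sub (hmeas i j x)).const_smul (n : ℝ)) ?_
    filter_upwards [ae_restrict_mem measurableSet_Icc] with r hr
    refine (((hC r hr i j).differentiable two_ne_zero x).hasFDerivAt).lim (ε j)
      (c := fun n : ℕ => (n : ℝ)) ?_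
    simpa using tendsto_natCast_atTop_atTop (R := ℝ)
  obtain ⟨A, hAI, hA, hAm⟩ := exists_indicator_measurable measurableSet_Icc hcont hm
  choose K hKi hKb using hK
  -- Setting the field to zero at exceptional times, and outside `[0, T]`, makes every condition
  -- hold at all times and not just almost all.
  set b : ℝ → E → E := fun r x => A.indicator (fun r => divField ε (fun i j => f i j r) x) r with hb
  have hbA : ∀ r ∈ A, b r = divField ε (fun i j => f i j r) := fun r hr => by
    ext1 x; simp [hb, hr]
  have hbA' : ∀ r ∉ A, b r = fun _ => 0 := fun r hr => by
    ext1 x; simp [hb, hr]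
  have hKs : Integrable ((Icc 0 T).indicator fun r => ∑ i, ∑ j, K i j r) := by
    rw [integrable_indicator_iff measurableSet_Icc]
    exact integrable_finsetSum _ fun i _ => integrable_finsetSum _ fun j _ => hKi i j
  have hK0 : ∀ r ∈ Icc 0 T, ∀ i j, 0 ≤ K i j r := fun r hr i j =>
    (norm_nonneg _).trans (hKb i j r hr 0)
  refine ⟨b, ⟨fun x => hAm x, fun r => ?_, fun R => ?_, ?_, fun r x => ?_⟩, fun r hr x => ?_, ?_⟩
  · by_cases hr : r ∈ A
    · rw [hbA r hr]; exact contDiff_divField ε (hC r (hAI hr))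
    · rw [hbA' r hr]; exact contDiff_const
  -- With `|R|` in place of `R` the origin lies in the ball, which forces `g` to be nonnegative.
  · choose g hgi hgb using fun i j => hg i j |R|
    have hg0 : ∀ r ∈ Icc 0 T, ∀ i j, 0 ≤ g i j r := fun r hr i j =>
      (abs_nonneg _).trans (hgb i j r hr 0 (by simp)).1
    refine ⟨(Icc 0 T).indicator fun r => ∑ i, ∑ j, ((|R| + 2) * g i j r + (|R| + 1) * K i j r),
      (integrable_indicator_iff measurableSet_Icc).2 (integrable_finsetSum _ fun i _ =>
        integrable_finsetSum _ fun j _ => ((hgi i j).const_mul _).add ((hKi i j).const_mul _)),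
      fun r x hx => ?_⟩
    by_cases hr : r ∈ A
    · have hrI := hAI hr
      rw [indicator_of_mem hrI, hbA r hr, (hasFDerivAt_divField ε (hC r hrI) x).fderiv]
      have hx' : ‖x‖ ≤ |R| := hx.trans (le_abs_self R)
      constructor
      · refine (norm_divField_le ε (hC r hrI) hx' (fun i j => hKb i j r hrI x)
          (fun i j => (hgb i j r hrI x hx').1)).trans
          (Finset.sum_le_sum fun i _ => Finset.sum_le_sum fun j _ => ?_)
        nlinarith [hg0 r hrI i j, hK0 r hrI i j, abs_nonneg R,
          mul_nonneg (abs_nonneg R) (hK0 r hrI i j)]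
      · refine (norm_divFieldDeriv_le ε (hC r hrI) hx' (fun i j => hKb i j r hrI x)
          (fun i j => (hgb i j r hrI x hx').1) (fun i j => (hgb i j r hrI x hx').2)).trans
          (Finset.sum_le_sum fun i _ => Finset.sum_le_sum fun j _ => ?_)
        nlinarith [hg0 r hrI i j, hK0 r hrI i j, abs_nonneg R,
          mul_nonneg (abs_nonneg R) (hg0 r hrI i j)]
    · have h0 : 0 ≤ (Icc 0 T).indicator
          (fun r => ∑ i, ∑ j, ((|R| + 2) * g i j r + (|R| + 1) * K i j r)) r :=
        indicator_nonneg (fun r hr => Finset.sum_nonneg fun i _ => Finset.sum_nonneg fun j _ => by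
          have := hg0 r hr i j
          have := hK0 r hr i j
          positivity) r
      rw [hbA' r hr]
      simpa using h0
  · refine ⟨_, hKs, fun r x => ?_⟩
    by_cases hr : r ∈ A
    · rw [indicator_of_mem (hAI hr), hbA r hr]
      exact abs_inner_divField_le ε (hC r (hAI hr)) (hskew r (hAI hr))
        fun i j => hKb i j r (hAI hr) x
    · have h0 : 0 ≤ (Icc 0 T).indicator (fun r => ∑ i, ∑ j, K i j r) r :=
        indicator_nonneg (fun r hr => Finset.sum_nonneg fun i _ => Finset.sum_nonneg fun j _ =>
          hK0 r hr i j) r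
      rw [hbA' r hr]
      simpa using mul_nonneg h0 (norm_nonneg x)
  · by_cases hr : r ∈ A
    · rw [hbA r hr, (hasFDerivAt_divField ε (hC r (hAI hr)) x).fderiv]
      exact trace_divFieldDeriv ε (hC r (hAI hr)) (hskew r (hAI hr)) x
    · rw [hbA' r hr]
      simp
  · simp [hbA' r fun h => hr (hAI h)]
  · filter_upwards [hA] with r hr x
    rw [hbA r hr]
end

/-! ### Reduction of cylindrical fields to finitely many coordinates -/

section
variable {W H : Type*} [NormedAddCommGroup W] [NormedSpace ℝ W]
  [NormedAddCommGroup H] [InnerProductSpace ℝ H]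
  (ι : H →L[ℝ] W) (e : HilbertBasis ℕ ℝ H) (e' : ℕ → StrongDual ℝ W) (n : ℕ)

/-- The first `n` coordinates of a point of `W`. -/
noncomputable def coordMap : W →L[ℝ] EuclideanSpace ℝ (Fin n) :=
  ((EuclideanSpace.equiv (Fin n) ℝ).symm : (Fin n → ℝ) →L[ℝ] EuclideanSpace ℝ (Fin n)) ∘L
    ContinuousLinearMap.pi fun k : Fin n => e' k

/-- The embedding of `ℝⁿ` into `W` along the first `n` basis vectors. -/
noncomputable def embedMap : EuclideanSpace ℝ (Fin n) →L[ℝ] W :=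
  ∑ k : Fin n, (EuclideanSpace.proj k : EuclideanSpace ℝ (Fin n) →L[ℝ] ℝ).smulRight (ι (e k))

/-- The matrix of a cylindrical operator as a function of finitely many coordinates. -/
noncomputable def cylMatrix (Q : W → H →L[ℝ] H) (i j : Fin n) (x : EuclideanSpace ℝ (Fin n)) : ℝ :=
  inner ℝ (e j) (Q (embedMap ι e n x) (e i))

theorem coordMap_apply (w : W) (k : Fin n) : coordMap e' n w k = e' k w := rfl

theorem embedMap_apply (x : EuclideanSpace ℝ (Fin n)) :
    embedMap ι e n x = ∑ k : Fin n, x k • ι (e k) := by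
  simp [embedMap]

theorem embedMap_basisFun (k : Fin n) :
    embedMap ι e n (EuclideanSpace.basisFun (Fin n) ℝ k) = ι (e k) := by
  rw [embedMap_apply, Finset.sum_eq_single k] <;> simp +contextual

variable {ι e e'} (he : InducedBy ι e e')
include he

theorem dual_apply_basis (i j : ℕ) : e' i (ι (e j)) = if i = j then 1 else 0 := by
  rw [he i (e j)]
  exact orthonormal_iff_ite.1 e.orthonormal i j

theorem coordMap_basis (k : Fin n) :
    coordMap e' n (ι (e k)) = EuclideanSpace.basisFun (Fin n) ℝ k := by
  ext i
  rw [coordMap_apply, dual_apply_basis he]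
  simp [Fin.ext_iff]

theorem coordMap_embedMap (x : EuclideanSpace ℝ (Fin n)) :
    coordMap e' n (embedMap ι e n x) = x := by
  rw [embedMap_apply, map_sum]
  simp only [map_smul, coordMap_basis n he]
  ext i
  simp [Pi.single_apply]

variable {n} {m : ℕ} (hmn : m ≤ n) {T : ℝ} {Q : ℝ → W → H →L[ℝ] H}
  (hQ : IsCylindricalSkewFamily e e' T m Q)
include hmn hQ

/-- The points `w` and `embedMap ι e n (coordMap e' n w)` have the same first `n` coordinates, and
the matrix entries see only the first `m ≤ n` of them. -/
theorem inner_eq_cylMatrix {r : ℝ} (hr : r ∈ Icc 0 T) (w : W) (i j : Fin n) :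
    inner ℝ (e j) (Q r w (e i)) = cylMatrix ι e n (Q r) i j (coordMap e' n w) := by
  unfold cylMatrix
  by_cases h : (i : ℕ) < m ∧ (j : ℕ) < m
  · obtain ⟨F, hF, -⟩ := hQ.cylindrical i h.1 j h.2
    rw [hF r hr, hF r hr]
    congr 1
    ext k
    have := congrFun (congrArg WithLp.ofLp (coordMap_embedMap n he (coordMap e' n w)))
      (Fin.castLE hmn k)
    exact this.symm
  · have h' : m ≤ (i : ℕ) ∨ m ≤ (j : ℕ) := by
      rcases not_and_or.1 h with h | h
      · exact Or.inl (not_lt.1 h)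
      · exact Or.inr (not_lt.1 h)
    rw [hQ.zero r hr _ _ _ h', hQ.zero r hr _ _ _ h']

/-- A nonzero entry is `F r ∘ P` with `P` a coordinate projection from the Euclidean to the sup
norm. As `‖P‖ ≤ 1`, the bounds on `F` carry over with the same `K` and `g`. -/
theorem exists_cylMatrix_regularity (i j : Fin n) :
    (∀ r ∈ Icc 0 T, ContDiff ℝ 2 (cylMatrix ι e n (Q r) i j)) ∧
    (∀ x, AEMeasurable (fun r => cylMatrix ι e n (Q r) i j x) (volume.restrict (Icc 0 T))) ∧
    (∃ K : ℝ → ℝ, IntegrableOn K (Icc 0 T) ∧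
      ∀ r ∈ Icc 0 T, ∀ x, ‖fderiv ℝ (cylMatrix ι e n (Q r) i j) x‖ ≤ K r) ∧
    (∀ R : ℝ, ∃ g : ℝ → ℝ, IntegrableOn g (Icc 0 T) ∧ ∀ r ∈ Icc 0 T, ∀ x, ‖x‖ ≤ R →
      |cylMatrix ι e n (Q r) i j x| ≤ g r ∧
        ‖fderiv ℝ (fderiv ℝ (cylMatrix ι e n (Q r) i j)) x‖ ≤ g r) := by
  by_cases h : (i : ℕ) < m ∧ (j : ℕ) < m
  · obtain ⟨F, hF, hC, hm, ⟨K, hKi, hK⟩, hg⟩ := hQ.cylindrical i h.1 j h.2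
    set P : EuclideanSpace ℝ (Fin n) →L[ℝ] (Fin m → ℝ) := ContinuousLinearMap.pi fun k =>
      EuclideanSpace.proj (Fin.castLE hmn k) with hP
    have hPn : ∀ x, ‖P x‖ ≤ ‖x‖ := fun x => by
      rw [pi_norm_le_iff_of_nonneg (norm_nonneg _)]
      exact fun k => PiLp.norm_apply_le x _
    have hP1 : ‖P‖ ≤ 1 := P.opNorm_le_bound zero_le_one fun x => by
      rw [one_mul]; exact hPn x
    have hFP : ∀ r ∈ Icc 0 T, cylMatrix ι e n (Q r) i j = F r ∘ P := by
      intro r hr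
      ext x
      simp only [cylMatrix, Function.comp_apply]
      rw [hF r hr]
      congr 1
      ext k
      exact congrFun (congrArg WithLp.ofLp (coordMap_embedMap n he x)) (Fin.castLE hmn k)
    refine ⟨fun r hr => ?_, fun x => ?_, ⟨K, hKi, fun r hr x => ?_⟩, fun R => ?_⟩
    · rw [hFP r hr]
      exact (hC r hr).comp P.contDiff
    · refine (hm (P x)).congr ?_
      filter_upwards [ae_restrict_mem measurableSet_Icc] with r hr
      rw [hFP r hr, Function.comp_apply]
    · rw [hFP r hr, fderiv_comp x ((hC r hr).differentiable two_ne_zero _) P.differentiableAt,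
        ContinuousLinearMap.fderiv]
      refine (ContinuousLinearMap.opNorm_comp_le _ _).trans ?_
      refine (mul_le_of_le_one_right (norm_nonneg _) hP1).trans (hK r hr _)
    · obtain ⟨g, hgi, hgb⟩ := hg R
      refine ⟨g, hgi, fun r hr x hx => ?_⟩
      have hb := hgb r hr (P x) ((hPn x).trans hx)
      rw [hFP r hr]
      refine ⟨hb.1, ?_⟩
      rw [← norm_iteratedFDeriv_one, norm_iteratedFDeriv_fderiv,
        P.iteratedFDeriv_comp_right (hC r hr) x (i := 1 + 1) (by norm_num)]
      refine (ContinuousMultilinearMap.norm_compContinuousLinearMap_le _ _).trans ?_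
      refine (mul_le_of_le_one_right (norm_nonneg _) ?_).trans hb.2
      exact Finset.prod_le_one (fun _ _ => norm_nonneg _) fun _ _ => hP1
  · have h' : m ≤ (i : ℕ) ∨ m ≤ (j : ℕ) := by
      rcases not_and_or.1 h with h | h
      · exact Or.inl (not_lt.1 h)
      · exact Or.inr (not_lt.1 h)
    have h0 : ∀ r ∈ Icc 0 T, cylMatrix ι e n (Q r) i j = fun _ => 0 := fun r hr => by
      ext x
      exact hQ.zero r hr _ _ _ h'
    refine ⟨fun r hr => ?_, fun x => ?_, ⟨0, integrableOn_zero, fun r hr x => ?_⟩,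
      fun R => ⟨0, integrableOn_zero, fun r hr x _ => ?_⟩⟩
    · rw [h0 r hr]; exact contDiff_const
    · refine (aemeasurable_const (b := (0 : ℝ))).congr ?_
      filter_upwards [ae_restrict_mem measurableSet_Icc] with r hr
      rw [h0 r hr]
    · rw [h0 r hr]; simp
    · have h1 : fderiv ℝ (fun _ : EuclideanSpace ℝ (Fin n) => (0 : ℝ)) = fun _ => 0 :=
        funext fun _ => fderiv_const_apply _
      rw [h0 r hr, h1, fderiv_const_apply]
      exact ⟨by simp, ContinuousLinearMap.opNorm_zero.le⟩

/-- Raising the range of the sums from `m` to `n` only adds zero terms, so families with different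
`m` can share one `n`. Derivatives along `ι (e j)` become partial derivatives in the coordinates. -/
theorem tangentField_eq_embedMap {r : ℝ} (hr : r ∈ Icc 0 T) (w : W) :
    tangentField ι e e' m (Q r) w = embedMap ι e n
      (divField (EuclideanSpace.basisFun (Fin n) ℝ) (cylMatrix ι e n (Q r)) (coordMap e' n w)) := by
  have hterm : ∀ i j : Fin n, inner ℝ (e j) (Q r w (e i)) * e' j w
      - lineDeriv ℝ (fun v => inner ℝ (e j) (Q r v (e i))) w (ι (e j))
      = cylMatrix ι e n (Q r) i j (coordMap e' n w)
          * inner ℝ (EuclideanSpace.basisFun (Fin n) ℝ j) (coordMap e' n w)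
        - fderiv ℝ (cylMatrix ι e n (Q r) i j) (coordMap e' n w)
          (EuclideanSpace.basisFun (Fin n) ℝ j) := by
    intro i j
    have h1 : (fun v => (inner ℝ (e j) (Q r v (e i)) : ℝ))
        = cylMatrix ι e n (Q r) i j ∘ coordMap e' n :=
      funext fun v => inner_eq_cylMatrix he hmn hQ hr v i j
    have hC := (exists_cylMatrix_regularity he hmn hQ i j).1 r hr
    have h2 := ((hC.differentiable two_ne_zero (coordMap e' n w)).hasFDerivAt.comp w
      (coordMap e' n).hasFDerivAt).hasLineDerivAt (ι (e j))
    rw [inner_eq_cylMatrix he hmn hQ hr, h1, h2.lineDeriv]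
    simp only [ContinuousLinearMap.comp_apply, coordMap_basis n he]
    congr 2
    rw [EuclideanSpace.basisFun_apply, EuclideanSpace.inner_single_left, coordMap_apply]
    simp
  have hzero : ∀ i j : ℕ, m ≤ i ∨ m ≤ j → inner ℝ (e j) (Q r w (e i)) * e' j w
      - lineDeriv ℝ (fun v => inner ℝ (e j) (Q r v (e i))) w (ι (e j)) = 0 := by
    intro i j hij
    have h1 : (fun v => (inner ℝ (e j) (Q r v (e i)) : ℝ)) = fun _ => 0 :=
      funext fun v => hQ.zero r hr v i j hij
    have h2 : lineDeriv ℝ (fun _ : W => (0 : ℝ)) w (ι (e j)) = 0 := by simp [lineDeriv]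
    rw [h1, hQ.zero r hr w i j hij, h2, zero_mul, sub_zero]
  have hsum : ∀ i, cylDivergence ι e e' m (fun v => Q r v (e i)) w
      = ∑ j : Fin n, (inner ℝ (e j) (Q r w (e i)) * e' j w
      - lineDeriv ℝ (fun v => inner ℝ (e j) (Q r v (e i))) w (ι (e j))) := by
    intro i
    rw [cylDivergence, ← Finset.sum_range (n := n) fun j => inner ℝ (e j) (Q r w (e i)) * e' j w
      - lineDeriv ℝ (fun v => inner ℝ (e j) (Q r v (e i))) w (ι (e j))]
    refine Finset.sum_subset (Finset.range_mono hmn) fun j _ hj => hzero i j (Or.inr ?_)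
    simpa using hj
  have h3 : tangentField ι e e' m (Q r) w = ∑ i : Fin n,
      cylDivergence ι e e' m (fun v => Q r v (e i)) w • ι (e i) := by
    rw [tangentField, ← Finset.sum_range (n := n) fun i =>
      cylDivergence ι e e' m (fun v => Q r v (e i)) w • ι (e i)]
    refine Finset.sum_subset (Finset.range_mono hmn) fun i _ hi => ?_
    have hi' : m ≤ i := by simpa using hi
    rw [hsum, Finset.sum_eq_zero fun (j : Fin n) _ => hzero i j (Or.inl hi'), zero_smul]
  rw [h3, divField, map_sum]
  refine Finset.sum_congr rfl fun i _ => ?_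
  rw [hsum, map_sum, Finset.sum_smul]
  refine Finset.sum_congr rfl fun j _ => ?_
  rw [hterm, map_smul, embedMap_basisFun]

/-- The field on `W` induced by a cylindrical family is the image of a field on `ℝⁿ`. -/
theorem exists_isGaussianField_tangentField :
    ∃ b : ℝ → EuclideanSpace ℝ (Fin n) → EuclideanSpace ℝ (Fin n), IsGaussianField b ∧
      (∀ r ∉ Icc 0 T, ∀ x, b r x = 0) ∧ ∀ᵐ r ∂volume.restrict (Icc 0 T), ∀ w,
        tangentField ι e e' m (Q r) w = embedMap ι e n (b r (coordMap e' n w)) := by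
  have hreg := exists_cylMatrix_regularity he hmn hQ
  obtain ⟨b, hb, hb0, hbe⟩ := exists_isGaussianField (EuclideanSpace.basisFun (Fin n) ℝ) T
    (f := fun i j r => cylMatrix ι e n (Q r) i j)
    (fun r hr i j x => hQ.skew r hr _ _ _) (fun r hr i j => (hreg i j).1 r hr)
    (fun i j => (hreg i j).2.1) (fun i j => (hreg i j).2.2.1) (fun i j => (hreg i j).2.2.2)
  refine ⟨b, hb, hb0, ?_⟩
  filter_upwards [hbe, ae_restrict_mem measurableSet_Icc] with r hr hrI w
  rw [tangentField_eq_embedMap he hmn hQ hrI, hr]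

end

/-! ### The law of finitely many coordinates -/

section
variable {E : Type*} [NormedAddCommGroup E] [InnerProductSpace ℝ E] [FiniteDimensional ℝ E]
  [MeasurableSpace E] [BorelSpace E]

/-- Only proportionality to the standard Gaussian is needed, so the normalising constant is read off
at `t = 0`. -/
theorem charFun_gaussVolume (t : E) : charFun (gaussVolume E) t
    = (gaussVolume E).real univ * Complex.exp (-‖t‖ ^ 2 / 2) := by
  have key : ∀ t : E, charFun (gaussVolume E) t
      = (Real.pi / (1 / 2 : ℂ)) ^ (Module.finrank ℝ E / 2 : ℂ) * Complex.exp (-‖t‖ ^ 2 / 2) := by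
    intro t
    have h := GaussianFourier.integral_cexp_neg_mul_sq_norm_add (V := E) (b := 1 / 2)
      (by norm_num) Complex.I t
    rw [charFun_apply, gaussVolume, integral_withDensity_eq_integral_toReal_smul₀
      continuous_gaussWeight.measurable.ennreal_ofReal.aemeasurable (by simp)]
    convert h using 1
    · refine integral_congr_ae (Filter.Eventually.of_forall fun x => ?_)
      simp only [ENNReal.toReal_ofReal (gaussWeight_pos x).le]
      rw [gaussWeight, Complex.real_smul, Complex.ofReal_exp, ← Complex.exp_add, real_inner_comm]
      congr 1
      push_cast
      ring
    · congr 2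
      rw [Complex.I_sq]
      ring
  have h0 := key 0
  rw [charFun_zero] at h0
  rw [key t, h0]
  simp

theorem gaussVolume_pos_of_isOpen {U : Set E} (hU : IsOpen U) (hne : U.Nonempty) :
    gaussVolume E U ≠ 0 := by
  intro h
  rw [gaussVolume, withDensity_apply_eq_zero
    continuous_gaussWeight.measurable.ennreal_ofReal] at h
  have h1 : {x : E | ENNReal.ofReal (gaussWeight x) ≠ 0} ∩ U = U := by
    refine inter_eq_right.2 fun x _ => ?_
    simpa using gaussWeight_pos x
  rw [h1] at h
  exact (hU.measure_pos volume hne).ne' h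

end

section
variable {W H : Type*} [NormedAddCommGroup W] [NormedSpace ℝ W] [MeasurableSpace W] [BorelSpace W]
  [NormedAddCommGroup H] [InnerProductSpace ℝ H] {ι : H →L[ℝ] W} {μ : Measure W}
  [IsProbabilityMeasure μ] (hW : IsAbstractWienerSpace ι μ) {e : HilbertBasis ℕ ℝ H}
  {e' : ℕ → StrongDual ℝ W} (he : InducedBy ι e e') (n : ℕ)
include hW he

/-- Pairing the coordinates with `t` is an element of `W*` whose image in `H` is `∑ t k • e k`, of
norm `‖t‖`; its law is given by `IsAbstractWienerSpace.gaussian`. -/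
theorem charFun_map_coordMap (t : EuclideanSpace ℝ (Fin n)) :
    charFun (μ.map (coordMap e' n)) t = Complex.exp (-‖t‖ ^ 2 / 2) := by
  set α : StrongDual ℝ W := (innerSL ℝ t) ∘L coordMap e' n with hα
  have hι : α.comp ι = innerSL ℝ (∑ k : Fin n, t k • e k) := by
    ext h
    simp only [hα, ContinuousLinearMap.comp_apply, innerSL_apply_apply, sum_inner,
      real_inner_smul_left, PiLp.inner_apply, coordMap_apply, he _ h]
    simp [mul_comm]
  have hn : ‖α.comp ι‖ = ‖t‖ := by
    rw [hι, innerSL_apply_norm, ← sq_eq_sq₀ (norm_nonneg _) (norm_nonneg _),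
      ← real_inner_self_eq_norm_sq, ← real_inner_self_eq_norm_sq]
    have := (e.orthonormal.comp (fun k : Fin n => (k : ℕ)) Fin.val_injective).inner_sum
      t.ofLp t.ofLp Finset.univ
    simp only [Function.comp_apply] at this
    rw [this, PiLp.inner_apply]
    simp [sq]
  have h1 : charFun (μ.map α) 1 = charFun (μ.map (coordMap e' n)) t := by
    rw [charFun_apply, charFun_apply, integral_map (by fun_prop) (by fun_prop),
      integral_map (by fun_prop) (by fun_prop)]
    refine integral_congr_ae (Filter.Eventually.of_forall fun w => ?_)
    simp [hα, real_inner_comm]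
  rw [← h1, hW.gaussian, charFun_gaussianReal]
  congr 1
  have : ((‖α.comp ι‖₊ ^ 2 : ℝ≥0) : ℂ) = ((‖t‖ ^ 2 : ℝ) : ℂ) := by
    rw [← hn]; push_cast; rfl
  simp only [Complex.ofReal_one, Complex.ofReal_zero]
  rw [show ((((‖α.comp ι‖₊ ^ 2 : ℝ≥0) : ℝ)) : ℂ) = ((‖t‖ ^ 2 : ℝ) : ℂ) from this]
  push_cast
  ring

theorem gaussVolume_eq_smul_map_coordMap : gaussVolume (EuclideanSpace ℝ (Fin n))
    = gaussVolume (EuclideanSpace ℝ (Fin n)) univ • μ.map (coordMap e' n) := by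
  have hf : IsFiniteMeasure (gaussVolume (EuclideanSpace ℝ (Fin n)) univ •
      μ.map (coordMap e' n)) := by
    refine Measure.smul_finite _ (measure_ne_top _ _)
  refine Measure.ext_of_charFun (funext fun t => ?_)
  rw [charFun_gaussVolume, ← charFun_map_coordMap hW he n t, charFun_apply, charFun_apply,
    integral_smul_measure, Complex.real_smul]
  rfl

theorem map_coordMap_eq_smul : μ.map (coordMap e' n)
    = (gaussVolume (EuclideanSpace ℝ (Fin n)) univ)⁻¹ • gaussVolume (EuclideanSpace ℝ (Fin n)) := by
  have h := congrArg ((gaussVolume (EuclideanSpace ℝ (Fin n)) univ)⁻¹ • ·)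
    (gaussVolume_eq_smul_map_coordMap hW he n)
  simp only [smul_smul] at h
  rw [h, ENNReal.inv_mul_cancel (gaussVolume_pos_of_isOpen isOpen_univ univ_nonempty)
    (measure_ne_top _ _), one_smul]

theorem map_fieldFlow_map_coordMap
    {b : ℝ → EuclideanSpace ℝ (Fin n) → EuclideanSpace ℝ (Fin n)} (hb : IsGaussianField b)
    (hE : ∀ s x, ∃ X, IsSol b s x X) (r v : ℝ) :
    (μ.map (coordMap e' n)).map (fieldFlow b r v) = μ.map (coordMap e' n) := by
  rcases le_total r v with h | h
  · rw [map_coordMap_eq_smul hW he n, Measure.map_smul, map_fieldFlow_gaussVolume hb hE h]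
  · have : fieldFlow b r v = id := funext fun x => fieldFlow_of_le hE h x
    rw [this, Measure.map_id]

/-- A set of full measure for the law of the coordinates is dense. -/
theorem dense_of_ae_map_coordMap {S : Set (EuclideanSpace ℝ (Fin n))}
    (hS : ∀ᵐ w ∂μ, coordMap e' n w ∈ S) : Dense S := by
  rw [dense_iff_inter_open]
  intro U hU hne
  by_contra hcon
  have h1 : μ (coordMap e' n ⁻¹' U) = 0 := by
    refine measure_mono_null (fun w hw => ?_) (ae_iff.1 hS)
    exact fun hw' => hcon ⟨_, hw, hw'⟩
  refine gaussVolume_pos_of_isOpen hU hne ?_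
  rw [gaussVolume_eq_smul_map_coordMap hW he n, Measure.smul_apply,
    Measure.map_apply (coordMap e' n).continuous.measurable hU.measurableSet, h1, smul_zero]

end

/-! ### Flows on the Wiener space and flows of finitely many coordinates -/

section
variable {W H : Type*} [NormedAddCommGroup W] [NormedSpace ℝ W] [CompleteSpace W]
  [MeasurableSpace W] [BorelSpace W]
  [NormedAddCommGroup H] [InnerProductSpace ℝ H] {ι : H →L[ℝ] W} {μ : Measure W}
  {e : HilbertBasis ℕ ℝ H} {e' : ℕ → StrongDual ℝ W} (he : InducedBy ι e e') {n : ℕ}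
  {b : ℝ → EuclideanSpace ℝ (Fin n) → EuclideanSpace ℝ (Fin n)} (hb : IsGaussianField b)
  {T : ℝ} (hb0 : ∀ r ∉ Icc 0 T, ∀ x, b r x = 0) {B : ℝ → W → W}
  (hB : ∀ᵐ r ∂volume.restrict (Icc 0 T), ∀ w, B r w = embedMap ι e n (b r (coordMap e' n w)))
include he hb hb0 hB

/-- The path leaves `w` only along the range of `embedMap`, so it is recovered from its coordinates.
These solve an equation for all later times because the field vanishes after `T`. -/
theorem exists_isSol_of_eq_add_integral {s : ℝ} (hs : s ∈ Icc 0 T) {w : W} {Y : ℝ → W}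
    (hi : IntegrableOn (fun r => B r (Y r)) (Icc s T))
    (hY : ∀ t ∈ Icc s T, Y t = w + ∫ r in s..t, B r (Y r)) :
    ∃ X, IsSol b s (coordMap e' n w) X ∧
      ∀ u ∈ Icc s T, Y u = w + embedMap ι e n (X u - coordMap e' n w) := by
  set G : ℝ → W := (Icc s T).indicator fun r => B r (Y r) with hG
  have hGi : Integrable G := hi.integrable_indicator measurableSet_Icc
  -- `Y` is controlled only on `[s, T]`; `P` agrees with it there and is continuous on `ℝ`.
  set P : ℝ → W := fun v => w + ∫ r in s..v, G r with hP
  have hPc : Continuous P := continuous_const.add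
    (intervalIntegral.continuous_primitive (fun a c => hGi.intervalIntegrable) s)
  have hPY : ∀ v ∈ Icc s T, P v = Y v := by
    intro v hv
    rw [hY v hv]
    change w + ∫ r in s..v, G r = _
    congr 1
    refine intervalIntegral.integral_congr fun r hr => ?_
    rw [uIcc_of_le hv.1] at hr
    have hm : r ∈ Icc s T := ⟨hr.1, hr.2.trans hv.2⟩
    simp only [hG, indicator_of_mem hm]
  set X : ℝ → EuclideanSpace ℝ (Fin n) := fun v => coordMap e' n (P v) with hX
  have hXc : Continuous X := (coordMap e' n).continuous.comp hPc
  have hGX : ∀ᵐ r, s ≤ r → G r = embedMap ι e n (b r (X r)) := by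
    rw [ae_restrict_iff' measurableSet_Icc] at hB
    filter_upwards [hB] with r hr hsr
    by_cases hrT : r ≤ T
    · have hm : r ∈ Icc s T := ⟨hsr, hrT⟩
      rw [hG, indicator_of_mem hm, hr ⟨hs.1.trans hsr, hrT⟩, hX]
      simp only [hPY r hm]
    · rw [hG, indicator_of_notMem (fun h => hrT h.2), hb0 r (fun h => hrT h.2), map_zero]
  have hPe : ∀ t, s ≤ t → P t = w + embedMap ι e n (∫ r in s..t, b r (X r)) := by
    intro t ht
    rw [← (embedMap ι e n).intervalIntegral_comp_comm (hb.intervalIntegrable hXc s t)]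
    change w + ∫ r in s..t, G r = _
    congr 1
    refine intervalIntegral.integral_congr_ae ?_
    filter_upwards [hGX] with r hr hrI
    rw [uIoc_of_le ht] at hrI
    exact hr hrI.1.le
  have hXe : ∀ t, s ≤ t → X t = coordMap e' n w + ∫ r in s..t, b r (X r) := by
    intro t ht
    change coordMap e' n (P t) = _
    rw [hPe t ht, map_add, coordMap_embedMap n he]
  refine ⟨X, ⟨hXc, hXe⟩, fun u hu => ?_⟩
  rw [← hPY u hu, hPe u hu.1, hXe u hu.1, add_sub_cancel_left]

variable {φ : ℝ → ℝ → W → W} (hφ : IsFlowOf μ T B φ)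
include hφ

/-- For `s` in `[0, T]` the flow on `W` gives solutions for a dense set of coordinates, since a
Gaussian charges every open set. For other `s` the field vanishes: a path stays constant after `T`,
and waits until time `0` when started earlier. -/
theorem exists_isSol_of_isFlowOf [IsProbabilityMeasure μ] (hW : IsAbstractWienerSpace ι μ)
    (hT : 0 ≤ T) (s : ℝ) (x : EuclideanSpace ℝ (Fin n)) : ∃ X, IsSol b s x X := by
  have hmid : ∀ s ∈ Icc 0 T, ∀ x, ∃ X, IsSol b s x X := by
    intro s hs
    refine hb.exists_isSol_of_dense (dense_of_ae_map_coordMap hW he n ?_)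
    filter_upwards [hφ s hs] with w hw
    obtain ⟨X, hX, -⟩ := exists_isSol_of_eq_add_integral he hb hb0 hB hs hw.1 hw.2
    exact ⟨X, hX⟩
  rcases lt_or_ge T s with hTs | hsT
  · refine ⟨fun _ => x, continuous_const, fun t ht => ?_⟩
    rw [intervalIntegral.integral_congr (g := fun _ => 0)]
    · simp
    · intro r hr
      rw [uIcc_of_le ht] at hr
      exact hb0 r (fun h => absurd (hr.1.trans h.2) (not_le.2 hTs)) x
  rcases le_or_gt 0 s with h0 | h0
  · exact hmid s ⟨h0, hsT⟩ x
  obtain ⟨X, hX⟩ := hmid 0 ⟨le_rfl, hT⟩ x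
  have hX' := hX.comp_max
  set Z := fun v => X (max 0 v) with hZ
  have hneg : ∀ t, s ≤ t → t ≤ 0 → ∫ r in s..t, b r (Z r) = 0 := by
    intro t hst ht
    refine intervalIntegral.integral_zero_ae ?_
    filter_upwards [Measure.ae_ne volume (0 : ℝ)] with r hr hrI
    rw [uIoc_of_le hst] at hrI
    exact hb0 r (fun h => hr (le_antisymm (hrI.2.trans ht) h.1)) _
  refine ⟨Z, hX'.continuous, fun t ht => ?_⟩
  rcases le_total t 0 with ht0 | ht0
  · rw [hneg t ht ht0, add_zero]
    simp only [hZ, max_eq_left ht0]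
    exact hX.init
  · rw [hX'.eq t ht0, ← intervalIntegral.integral_add_adjacent_intervals (a := s) (b := 0)
      (hb.intervalIntegrable hX'.continuous _ _) (hb.intervalIntegrable hX'.continuous _ _),
      hneg 0 h0.le le_rfl, zero_add]

theorem ae_isFlowOf_eq_add_embedMap [IsProbabilityMeasure μ] (hE : ∀ s x, ∃ X, IsSol b s x X)
    {s : ℝ} (hs : s ∈ Icc 0 T) : ∀ᵐ w ∂μ, ∀ u ∈ Icc s T,
      φ s u w = w + embedMap ι e n (fieldFlow b s u (coordMap e' n w) - coordMap e' n w) := by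
  filter_upwards [hφ s hs] with w hw u hu
  obtain ⟨X, hX, hXu⟩ := exists_isSol_of_eq_add_integral he hb hb0 hB hs hw.1 hw.2
  rw [hXu u hu, IsSol.eq_fieldFlow hb hE hX hu.1]

end

/-! ### The transported operator norm and `gradNorm` -/

section
variable {W H : Type*} [NormedAddCommGroup W] [NormedSpace ℝ W]
  [NormedAddCommGroup H] [InnerProductSpace ℝ H] {ι : H →L[ℝ] W}
  {e : HilbertBasis ℕ ℝ H} {e' : ℕ → StrongDual ℝ W} (he : InducedBy ι e e') (n : ℕ)

/-- The embedding of `ℝⁿ` into `W` as an isomorphism onto its range. -/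
noncomputable def embedEquiv :
    EuclideanSpace ℝ (Fin n) ≃L[ℝ] LinearMap.range (embedMap ι e n : EuclideanSpace ℝ (Fin n) →ₗ[ℝ] W) :=
  (LinearEquiv.ofInjective (embedMap ι e n : EuclideanSpace ℝ (Fin n) →ₗ[ℝ] W)
    (Function.LeftInverse.injective (coordMap_embedMap n he))).toContinuousLinearEquiv

variable {n} {b : ℝ → EuclideanSpace ℝ (Fin n) → EuclideanSpace ℝ (Fin n)}

/-- The supremum in `gradNorm` is tested on the direction `∑ x k • e k`, scaled to have norm one in
`W`, and on a functional `α` norming the image of the derivative. -/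
theorem ofReal_fieldSlope_le_gradNorm {B : W → W} {r : ℝ}
    (hb : Differentiable ℝ (b r)) (hB : ∀ w, B w = embedMap ι e n (b r (coordMap e' n w))) (w : W) :
    ENNReal.ofReal (fieldSlope (embedEquiv he n) b r (coordMap e' n w)) ≤ gradNorm ι B w := by
  by_cases htop : gradNorm ι B w = ∞
  · rw [htop]; exact le_top
  refine ENNReal.ofReal_le_of_le_toReal ?_
  refine ContinuousLinearMap.opNorm_le_bound _ ENNReal.toReal_nonneg fun y => ?_
  set A := fderiv ℝ (b r) (coordMap e' n w) with hA
  obtain ⟨x, rfl⟩ := (embedEquiv he n).surjective y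
  rcases eq_or_ne x 0 with rfl | hx
  · simp
  set c : ℝ := ‖embedEquiv he n x‖ with hc
  have hcpos : 0 < c := norm_pos_iff.2 (by simpa using hx)
  obtain ⟨α, hα1, hα⟩ := exists_dual_vector'' ℝ (embedMap ι e n (A x))
  set h : H := c⁻¹ • ∑ k : Fin n, x k • e k with hh
  have hιh : ι h = c⁻¹ • embedMap ι e n x := by
    rw [hh, embedMap_apply, map_smul, map_sum]
    simp only [map_smul]
  have hnorm : ‖ι h‖ = 1 := by
    have h1 : ‖embedMap ι e n x‖ = c := rfl
    rw [hιh, norm_smul, h1, norm_inv, Real.norm_of_nonneg hcpos.le, inv_mul_cancel₀ hcpos.ne']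
  have hline : lineDeriv ℝ (fun v => α (B v)) w (ι h) = c⁻¹ * ‖embedMap ι e n (A x)‖ := by
    have h1 : (fun v => α (B v)) = (α ∘L embedMap ι e n) ∘ (b r ∘ coordMap e' n) :=
      funext fun v => by simp [hB]
    have h2 := ((α ∘L embedMap ι e n).hasFDerivAt.comp w
      ((hb (coordMap e' n w)).hasFDerivAt.comp w (coordMap e' n).hasFDerivAt)).hasLineDerivAt (ι h)
    rw [h1, h2.lineDeriv, hιh]
    simp only [ContinuousLinearMap.comp_apply, map_smul, coordMap_embedMap n he, smul_eq_mul]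
    rw [← hA, hα]
    rfl
  have hle : ‖lineDeriv ℝ (fun v => α (B v)) w (ι h)‖ₑ ≤ gradNorm ι B w :=
    le_iSup₂_of_le h hnorm (le_iSup₂_of_le α hα1 le_rfl)
  have hle' := ENNReal.toReal_mono htop hle
  rw [toReal_enorm, hline, Real.norm_of_nonneg (by positivity)] at hle'
  have hgoal : ‖((embedEquiv he n : EuclideanSpace ℝ (Fin n) →L[ℝ]
      LinearMap.range (embedMap ι e n : EuclideanSpace ℝ (Fin n) →ₗ[ℝ] W)) ∘L A ∘L
      ((embedEquiv he n).symm :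
      LinearMap.range (embedMap ι e n : EuclideanSpace ℝ (Fin n) →ₗ[ℝ] W) →L[ℝ] EuclideanSpace ℝ (Fin n))) (embedEquiv he n x)‖
      = ‖embedMap ι e n (A x)‖ := by
    simp only [ContinuousLinearMap.comp_apply, ContinuousLinearEquiv.coe_coe,
      ContinuousLinearEquiv.symm_apply_apply]
    rfl
  rw [hgoal]
  rw [inv_mul_le_iff₀ hcpos] at hle'
  linarith

theorem ofReal_exp_fieldSlope_le {B : W → W} {r : ℝ} {ε : ℝ} (hε : 0 ≤ ε)
    (hb : Differentiable ℝ (b r)) (hB : ∀ w, B w = embedMap ι e n (b r (coordMap e' n w))) (w : W) :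
    ENNReal.ofReal (Real.exp (ε * fieldSlope (embedEquiv he n) b r (coordMap e' n w)))
      ≤ EReal.exp ((ε : EReal) * (gradNorm ι B w : EReal)) := by
  rw [← EReal.exp_coe]
  refine EReal.exp_monotone ?_
  have h := ofReal_fieldSlope_le_gradNorm he hb hB w
  have h1 : ((fieldSlope (embedEquiv he n) b r (coordMap e' n w) : ℝ) : EReal)
      ≤ (gradNorm ι B w : EReal) := by
    refine le_trans (le_of_eq ?_) (EReal.coe_ennreal_le_coe_ennreal_iff.2 h)
    rw [EReal.coe_ennreal_ofReal, max_eq_left (fieldSlope_nonneg _ _ _)]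
  rw [EReal.coe_mul]
  exact mul_le_mul_of_nonneg_left h1 (EReal.coe_nonneg.2 hε)

end

/-! ### The comparison of the two flows -/

/-- The maximal distance of two flows is a lower semicontinuous function of the starting point. -/
theorem measurable_iSup_fieldFlow_sub {E F : Type*} [NormedAddCommGroup E] [InnerProductSpace ℝ E]
    [FiniteDimensional ℝ E] [MeasurableSpace E] [BorelSpace E] [NormedAddCommGroup F]
    [NormedSpace ℝ F] (L : E ≃L[ℝ] F) {b c : ℝ → E → E} (hb : IsGaussianField b)
    (hbE : ∀ s x, ∃ X, IsSol b s x X) (hc : IsGaussianField c)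
    (hcE : ∀ s x, ∃ X, IsSol c s x X) (s : ℝ) (I : Set ℝ) :
    Measurable fun x => ⨆ u ∈ I, ‖L (fieldFlow b s u x - fieldFlow c s u x)‖ₑ := by
  refine LowerSemicontinuous.measurable (lowerSemicontinuous_biSup fun u _ => ?_)
  refine Continuous.lowerSemicontinuous ?_
  exact (L.continuous.comp ((continuous_fieldFlow_right hb hbE s u).sub
    (continuous_fieldFlow_right hc hcE s u))).enorm

theorem proposition6p1 {W H : Type*} [NormedAddCommGroup W] [NormedSpace ℝ W] [CompleteSpace W]
    [TopologicalSpace.SeparableSpace W] [MeasurableSpace W] [BorelSpace W]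
    [NormedAddCommGroup H] [InnerProductSpace ℝ H] [CompleteSpace H]
    (ι : H →L[ℝ] W) (μ : Measure W) [IsProbabilityMeasure μ]
    (hW : IsAbstractWienerSpace ι μ)
    (e : HilbertBasis ℕ ℝ H) (e' : ℕ → StrongDual ℝ W) (he : InducedBy ι e e')
    (T : ℝ) (ma mb : ℕ) (Qa Qb : ℝ → W → H →L[ℝ] H)
    (hQa : IsCylindricalSkewFamily e e' T ma Qa)
    (hQb : IsCylindricalSkewFamily e e' T mb Qb)
    (Ba Bb : ℝ → W → W)
    (hBa : ∀ r w, Ba r w = tangentField ι e e' ma (Qa r) w)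
    (hBb : ∀ r w, Bb r w = tangentField ι e e' mb (Qb r) w)
    (ε : ℝ) (hε : 0 < ε)
    (hΓ : expGradMoment ι μ ε Ba Bb 0 T < ∞)
    (φa φb : ℝ → ℝ → W → W) (hφa : IsFlowOf μ T Ba φa) (hφb : IsFlowOf μ T Bb φb)
    (p q : ℝ) (hpq : p.HolderConjugate q)
    (s t : ℝ) (hs : 0 ≤ s) (hst : s < t) (ht : t ≤ T)
    (hst_one : t - s ≤ 1) (hst_eps : (t - s) * q ≤ ε) :
    ∫⁻ w, ⨆ u ∈ Icc s t, ‖φa s u w - φb s u w‖ₑ ∂μ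
      ≤ (∫⁻ w, ∫⁻ r in Icc s t, ‖Ba r w - Bb r w‖ₑ ^ p ∂volume ∂μ) ^ (1 / p)
        * expGradMoment ι μ ε Ba Bb s t ^ (1 / q)
        * ENNReal.ofReal (1 / (t - s)) ^ (1 / q) := by
  have hT : 0 ≤ T := hs.trans (hst.le.trans ht)
  have hsT : s ∈ Icc 0 T := ⟨hs, hst.le.trans ht⟩
  have hsub : Icc s t ⊆ Icc 0 T := Icc_subset_Icc hs ht
  set n := max ma mb
  obtain ⟨b, hb, hb0, hbB⟩ :=
    exists_isGaussianField_tangentField he (le_max_left ma mb : ma ≤ n) hQa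
  obtain ⟨c, hc, hc0, hcB⟩ :=
    exists_isGaussianField_tangentField he (le_max_right ma mb : mb ≤ n) hQb
  simp only [← hBa] at hbB
  simp only [← hBb] at hcB
  have hbE := exists_isSol_of_isFlowOf he hb hb0 hbB hφa hW hT
  have hcE := exists_isSol_of_isFlowOf he hc hc0 hcB hφb hW hT
  set L := embedEquiv he n
  set γ := μ.map (coordMap e' n) with hγ
  have hcm : Measurable (coordMap e' n) := (coordMap e' n).continuous.measurable
  have hbst := ae_restrict_of_ae_restrict_of_subset hsub hbB
  have hcst := ae_restrict_of_ae_restrict_of_subset hsub hcB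
  have hmain := lintegral_fieldFlow_sub_fieldFlow_le L hb hbE hc hcE γ
    (map_fieldFlow_map_coordMap hW he n hb hbE) (map_fieldFlow_map_coordMap hW he n hc hcE)
    hpq hst hst_eps
  have hq : 0 ≤ 1 / q := one_div_nonneg.2 hpq.symm.nonneg
  have hp : 0 ≤ 1 / p := one_div_nonneg.2 hpq.nonneg
  have hleft : ∫⁻ w, ⨆ u ∈ Icc s t, ‖φa s u w - φb s u w‖ₑ ∂μ
      = ∫⁻ x, ⨆ u ∈ Icc s t, ‖L (fieldFlow b s u x - fieldFlow c s u x)‖ₑ ∂γ := by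
    rw [hγ, lintegral_map (measurable_iSup_fieldFlow_sub L hb hbE hc hcE s _) hcm]
    refine lintegral_congr_ae ?_
    filter_upwards [ae_isFlowOf_eq_add_embedMap he hb hb0 hbB hφa hbE hsT,
      ae_isFlowOf_eq_add_embedMap he hc hc0 hcB hφb hcE hsT] with w hwa hwb
    refine biSup_congr fun u hu => ?_
    have hu' : u ∈ Icc s T := ⟨hu.1, hu.2.trans ht⟩
    rw [hwa u hu', hwb u hu', add_sub_add_left_eq_sub, ← map_sub, sub_sub_sub_cancel_right]
    rfl
  -- Only an upper bound is needed, and `lintegral_map_le` gives it without any measurability on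
  -- `W`.
  have hfst : ∫⁻ x, ∫⁻ r in Icc s t, ‖L (b r x - c r x)‖ₑ ^ p ∂volume ∂γ
      ≤ ∫⁻ w, ∫⁻ r in Icc s t, ‖Ba r w - Bb r w‖ₑ ^ p ∂volume ∂μ := by
    refine (lintegral_map_le _ _).trans (lintegral_mono fun w => lintegral_mono_ae ?_)
    filter_upwards [hbst, hcst] with r hra hrb
    rw [hra, hrb, ← map_sub]
    exact le_rfl
  have hsnd : ∫⁻ x, ∫⁻ r in Icc s t, ENNReal.ofReal (Real.exp (ε * fieldSlope L c r x)) ∂volume ∂γ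
      ≤ expGradMoment ι μ ε Ba Bb s t := by
    refine (lintegral_map_le _ _).trans (lintegral_mono fun w => lintegral_mono_ae ?_)
    filter_upwards [hcst] with r hr
    -- Only the second field amplifies distances, so the exponential of the first one is discarded
    -- from the moment.
    exact (ofReal_exp_fieldSlope_le he hε.le ((hc.contDiff r).differentiable one_ne_zero) hr w).trans
      le_add_self
  have hone : 1 ≤ ENNReal.ofReal (1 / (t - s)) ^ (1 / q) := by
    rw [← ENNReal.one_rpow (1 / q)]
    refine ENNReal.rpow_le_rpow ?_ hq
    rw [ENNReal.one_le_ofReal, le_div_iff₀ (sub_pos.2 hst), one_mul]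
    exact hst_one
  rw [hleft]
  refine hmain.trans (le_trans ?_ (le_mul_of_one_le_right' hone))
  exact mul_le_mul' (ENNReal.rpow_le_rpow hfst hp) (ENNReal.rpow_le_rpow hsnd hq)
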